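/- Let $L_x,L_y>0$, $0<\mathrm{Pr}<\infty$, $\eta\in[0,\infty]$, and let $R$ satisfy $$R\ge \tfrac{32}{3}\ \text{ if }\eta\le\tfrac12,\qquad R\ge\tfrac{128}{3}\,\frac{\eta}{1+2\eta}\ \text{ if }\eta\ge\tfrac12,$$ where $\eta/(1+2\eta)$ means $\tfrac12$ for $\eta=\infty$. Let $\mathbf u=(u,v,w)$, $T$, $p$ be a classical solution for all times of the Boussinesq equations $$\mathrm{Pr}^{-1}(\partial_t\mathbf u+\mathbf u\cdot\nabla\mathbf u)+\nabla p=\nabla^2\mathbf u+R\,T\,\mathbf e_z,\qquad \nabla\cdot\mathbf u=0,\qquad \partial_tT+\mathbf u\cdot\nabla T=\nabla^2T$$ in the layer $0\le z\le1$, with all fields $L_x$-periodic in $x$ and $L_y$-periodic in $y$, with $\mathbf u=\mathbf 0$ at $z=0,1$, and with the thermal boundary conditions of Biot number $\eta$: $T-\eta T_z=1+\eta$ at $z=0$ and $T+\eta T_z=-\eta$ at $z=1$ if $\eta<\infty$, and $T_z=-1$ at $z=0,1$ if $\eta=\infty$. (Classical: $\mathbf u,T$ are continuous for $t\ge0$,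 $0\le z\le1$; for $t>0$ they are $C^1$ in time and $C^2$ in space, and $p$ is $C^1$ in space, with all these derivatives continuous up to $z=0,1$.) Put $A=L_xL_y$, $\langle g\rangle=\limsup_{\tau\to\infty}\frac1\tau\int_0^\tau g(t)\,dt$, let $\overline h$ be the average over $[0,L_x]\times[0,L_y]$ and $\int_f$ the integral over $[0,L_x]\times[0,L_y]\times[0,1]$. Let $$\Delta T=\langle\overline T|_{z=0}-\overline T|_{z=1}\rangle,\quad \mathrm{Ra}=R\,\Delta T,\quad j_c=\int_f(-T_z),\quad j_v=\int_f wT,\quad \mathrm{Nu}=\frac{\langle j_c+j_v\rangle}{\langle j_c\rangle}.$$ Then the means over $[0,\tau]$ of $\overline T|_{z=0}-\overline T|_{z=1}$, $j_c$, $j_v$ and $j_c+j_v$ are well defined and bounded for large $\tau$, $\langle j_c\rangle=A\,\Delta T>0$, and $$\mathrm{Nu}\le\frac{3\sqrt6}{4}\,\mathrm{Ra}^{1/2},\qquad \mathrm{Nu}\le\frac{3}{2\delta_s},$$ where $\delta_s=2(2/3)^{1/2}R^{-1/2}$ if $\eta\le\frac12$ and $R\eta^2<\frac83$; $\delta_s=2(\eta/3)^{1/3}R^{-1/3}$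 if $\eta\le\frac12$ and $R\eta^2\ge\frac83$; and $\delta_s=2(2/3)^{1/3}\big(\frac{\eta}{1+2\eta}\big)^{1/3}R^{-1/3}$ if $\eta>\frac12$. Moreover, if $0<\eta\le\frac12$ and $R\ge\frac83\eta^{-2}$, then $$\mathrm{Nu}\le\frac34\Big(\frac3\eta\Big)^{1/3}R^{1/3},\qquad \mathrm{Ra}\ge\frac12\Big(\frac1{3\eta^2}\Big)^{1/3}R^{2/3},$$ and if $\frac12\le\eta\le\infty$, then $$\mathrm{Nu}\le\frac34\Big(\frac32\,\frac{1+2\eta}{\eta}\Big)^{1/3}R^{1/3},\qquad \mathrm{Ra}\ge\frac14\Big(\frac23\Big)^{1/3}\Big(\frac{1+2\eta}{\eta}\Big)^{2/3}R^{2/3}.$$ All the bounds on $\mathrm{Nu}$ also hold with $1+\frac1A\langle j_v\rangle/\Delta T$ in place of $\mathrm{Nu}$ (the two expressions agree when the means over $[0,\tau]$ converge). -/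

import Mathlib

open Set Filter Topology MeasureTheory
open scoped ENNReal

noncomputable section

namespace RayleighBenard

/-- A scalar field, written `f t x y z`. Only the values with `0 ≤ t` and `0 ≤ z ≤ 1` matter. -/
abbrev Field : Type := ℝ → ℝ → ℝ → ℝ → ℝ

/-- Time derivative. -/
def dt (f : Field) : Field := fun t x y z => deriv (fun s => f s x y z) t

/-- Derivative in the first horizontal variable. -/
def dx (f : Field) : Field := fun t x y z => deriv (fun s => f t s y z) x

/-- Derivative in the second horizontal variable. -/
def dy (f : Field) : Field := fun t x y z => deriv (fun s => f t x s z) y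

/-- Vertical derivative in the layer `0 ≤ z ≤ 1`, one-sided at the plates. -/
def dz (f : Field) : Field := fun t x y z => derivWithin (fun s => f t x y s) (Icc 0 1) z

/-- The spatial Laplacian. -/
def lap (f : Field) : Field := fun t x y z =>
  dx (dx f) t x y z + dy (dy f) t x y z + dz (dz f) t x y z

/-- Joint continuity of `f` for times in `I`, up to the plates `z = 0` and `z = 1`. -/
def ContOn (I : Set ℝ) (f : Field) : Prop :=
  ContinuousOn (fun q : ℝ × ℝ × ℝ × ℝ => f q.1 q.2.1 q.2.2.1 q.2.2.2)
    (I ×ˢ (univ : Set ℝ) ×ˢ (univ : Set ℝ) ×ˢ Icc (0 : ℝ) 1)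

/-- For `t > 0`, `f` is continuous and has continuous first spatial derivatives, up to the
plates. -/
structure SpaceC1 (f : Field) : Prop where
  cont : ContOn (Ioi 0) f
  diff_x : ∀ t > 0, ∀ x y, ∀ z ∈ Icc (0 : ℝ) 1, DifferentiableAt ℝ (fun s => f t s y z) x
  diff_y : ∀ t > 0, ∀ x y, ∀ z ∈ Icc (0 : ℝ) 1, DifferentiableAt ℝ (fun s => f t x s z) y
  diff_z : ∀ t > 0, ∀ x y, ∀ z ∈ Icc (0 : ℝ) 1,
    DifferentiableWithinAt ℝ (fun s => f t x y s) (Icc 0 1) z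
  cont_dx : ContOn (Ioi 0) (dx f)
  cont_dy : ContOn (Ioi 0) (dy f)
  cont_dz : ContOn (Ioi 0) (dz f)

/-- The regularity of a classical solution: `f` is continuous for `t ≥ 0`, and for `t > 0` it
is continuously differentiable once in time and twice in space, up to the plates. -/
structure ClassicalReg (f : Field) : Prop where
  cont : ContOn (Ici 0) f
  spaceC1 : SpaceC1 f
  dx_spaceC1 : SpaceC1 (dx f)
  dy_spaceC1 : SpaceC1 (dy f)
  dz_spaceC1 : SpaceC1 (dz f)
  diff_t : ∀ t > 0, ∀ x y, ∀ z ∈ Icc (0 : ℝ) 1, DifferentiableAt ℝ (fun s => f s x y z) t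
  cont_dt : ContOn (Ioi 0) (dt f)

/-- Horizontal periodicity with periods `Lx` and `Ly`. -/
def HPeriodic (Lx Ly : ℝ) (f : Field) : Prop :=
  ∀ t > 0, ∀ x y, ∀ z ∈ Icc (0 : ℝ) 1,
    f t (x + Lx) y z = f t x y z ∧ f t x (y + Ly) z = f t x y z

/-- The unknowns: velocity `(u, v, w)`, temperature `T` and pressure `p`. -/
structure Fields where
  u : Field
  v : Field
  w : Field
  T : Field
  p : Field

/-- The material derivative `∂f/∂t + (u, v, w) · ∇f`. -/
def Fields.matDeriv (F : Fields) (f : Field) : Field := fun t x y z =>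
  dt f t x y z + F.u t x y z * dx f t x y z + F.v t x y z * dy f t x y z
    + F.w t x y z * dz f t x y z

/-- The thermal boundary conditions with Biot number `η ∈ [0, ∞]`; fixed flux for `η = ∞`. -/
def ThermalBC (η : ℝ≥0∞) (T : Field) : Prop :=
  ∀ t > 0, ∀ x y,
    if η = ⊤ then dz T t x y 0 = -1 ∧ dz T t x y 1 = -1
    else T t x y 0 - η.toReal * dz T t x y 0 = 1 + η.toReal ∧
      T t x y 1 + η.toReal * dz T t x y 1 = -η.toReal

/-- Classical solutions, global in time, of the nondimensional Boussinesq equations in the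
layer `0 ≤ z ≤ 1`, with Prandtl number `Pr` and control parameter `R`, no-slip plates,
horizontal periods `Lx`, `Ly`, and thermal boundary conditions of Biot number `η`. -/
structure IsSolution (Pr R Lx Ly : ℝ) (η : ℝ≥0∞) (F : Fields) : Prop where
  reg_u : ClassicalReg F.u
  reg_v : ClassicalReg F.v
  reg_w : ClassicalReg F.w
  reg_T : ClassicalReg F.T
  reg_p : SpaceC1 F.p
  per_u : HPeriodic Lx Ly F.u
  per_v : HPeriodic Lx Ly F.v
  per_w : HPeriodic Lx Ly F.w
  per_T : HPeriodic Lx Ly F.T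
  per_p : HPeriodic Lx Ly F.p
  momentum_x : ∀ t > 0, ∀ x y, ∀ z ∈ Icc (0 : ℝ) 1,
    Pr⁻¹ * F.matDeriv F.u t x y z + dx F.p t x y z = lap F.u t x y z
  momentum_y : ∀ t > 0, ∀ x y, ∀ z ∈ Icc (0 : ℝ) 1,
    Pr⁻¹ * F.matDeriv F.v t x y z + dy F.p t x y z = lap F.v t x y z
  momentum_z : ∀ t > 0, ∀ x y, ∀ z ∈ Icc (0 : ℝ) 1,
    Pr⁻¹ * F.matDeriv F.w t x y z + dz F.p t x y z = lap F.w t x y z + R * F.T t x y z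
  incompressible : ∀ t > 0, ∀ x y, ∀ z ∈ Icc (0 : ℝ) 1,
    dx F.u t x y z + dy F.v t x y z + dz F.w t x y z = 0
  heat : ∀ t > 0, ∀ x y, ∀ z ∈ Icc (0 : ℝ) 1,
    F.matDeriv F.T t x y z = lap F.T t x y z
  no_slip : ∀ t > 0, ∀ x y, ∀ z ∈ ({0, 1} : Set ℝ),
    F.u t x y z = 0 ∧ F.v t x y z = 0 ∧ F.w t x y z = 0
  thermal : ThermalBC η F.T

/-- The mean of `g` over the time interval `[0, τ]`. -/
def timeMean (g : ℝ → ℝ) (τ : ℝ) : ℝ := 1 / τ * ∫ t in (0 : ℝ)..τ, g t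

/-- The long-time average: the limit superior of the means over `[0, τ]` as `τ → ∞`. -/
def timeAvg (g : ℝ → ℝ) : ℝ := limsup (timeMean g) atTop

/-- `g` is integrable over bounded time intervals and its means over `[0, τ]` are bounded for
large `τ`, so that `timeAvg g` is a genuine finite limit superior. -/
def HasFiniteTimeAvg (g : ℝ → ℝ) : Prop :=
  (∀ τ > 0, IntervalIntegrable g volume 0 τ) ∧
    IsBoundedUnder (· ≤ ·) atTop (timeMean g) ∧ IsBoundedUnder (· ≥ ·) atTop (timeMean g)

/-- The horizontal average over a periodic cell. -/
def hAvg (Lx Ly : ℝ) (h : ℝ → ℝ → ℝ) : ℝ :=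
  1 / (Lx * Ly) * ∫ y in (0 : ℝ)..Ly, ∫ x in (0 : ℝ)..Lx, h x y

/-- The integral over the fluid layer. -/
def volInt (Lx Ly : ℝ) (h : ℝ → ℝ → ℝ → ℝ) : ℝ :=
  ∫ z in (0 : ℝ)..1, ∫ y in (0 : ℝ)..Ly, ∫ x in (0 : ℝ)..Lx, h x y z

namespace Fields

/-- The instantaneous horizontally averaged temperature drop. -/
def drop (F : Fields) (Lx Ly : ℝ) (t : ℝ) : ℝ :=
  hAvg Lx Ly (fun x y => F.T t x y 0) - hAvg Lx Ly (fun x y => F.T t x y 1)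

/-- The averaged temperature drop. -/
def tempDrop (F : Fields) (Lx Ly : ℝ) : ℝ := timeAvg (F.drop Lx Ly)

/-- The vertical conductive heat transport. -/
def condTransport (F : Fields) (Lx Ly : ℝ) (t : ℝ) : ℝ :=
  volInt Lx Ly (fun x y z => -dz F.T t x y z)

/-- The vertical convective heat transport. -/
def convTransport (F : Fields) (Lx Ly : ℝ) (t : ℝ) : ℝ :=
  volInt Lx Ly (fun x y z => F.w t x y z * F.T t x y z)

/-- The total vertical heat transport. -/
def totalTransport (F : Fields) (Lx Ly : ℝ) (t : ℝ) : ℝ :=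
  F.condTransport Lx Ly t + F.convTransport Lx Ly t

/-- The Nusselt number: the ratio of the averaged total to the averaged conductive
transport. -/
def nusselt (F : Fields) (Lx Ly : ℝ) : ℝ :=
  timeAvg (F.totalTransport Lx Ly) / timeAvg (F.condTransport Lx Ly)

/-- The other usual expression for the Nusselt number. It is the same number when the means
over `[0, τ]` converge, and may differ from `nusselt` when they only have limits superior. -/
def nusseltConv (F : Fields) (Lx Ly : ℝ) : ℝ :=
  1 + 1 / (Lx * Ly) * timeAvg (F.convTransport Lx Ly) / F.tempDrop Lx Ly

/-- The Rayleigh number. -/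
def rayleigh (F : Fields) (R Lx Ly : ℝ) : ℝ := R * F.tempDrop Lx Ly

end Fields

/-- `η / (1 + 2 η)`, with its limit `1 / 2` at `η = ∞`. -/
def biotRatio (η : ℝ≥0∞) : ℝ := if η = ⊤ then 1 / 2 else η.toReal / (1 + 2 * η.toReal)

/-- The length `δ_s(η, R)`. -/
def deltaS (η : ℝ≥0∞) (R : ℝ) : ℝ :=
  if η ≤ 1 / 2 then
    if R * η.toReal ^ 2 < 8 / 3 then 2 * (2 / 3 : ℝ) ^ (1 / 2 : ℝ) * R ^ (-1 / 2 : ℝ)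
    else 2 * (η.toReal / 3) ^ (1 / 3 : ℝ) * R ^ (-1 / 3 : ℝ)
  else 2 * (2 / 3 : ℝ) ^ (1 / 3 : ℝ) * biotRatio η ^ (1 / 3 : ℝ) * R ^ (-1 / 3 : ℝ)

end RayleighBenard

end

noncomputable section

namespace RayleighBenard

/-! The proof is the background method, carried out on time means instead of on a stationary
variational problem. Let `N` and `D` be the means over `[0, τ]` of the total transport per unit area
and of the temperature drop. The functional is the volume integral of `α / (2 R Pr) |u|² + (T -
profile)² / 2`, where the profile has slope `-σ` in two plate layers of width `δ` and is constant in
between. In its time derivative the profile is tested against the vertical heat flux, so only the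
layers and the plates contribute. The conductive part in the layers is bounded by completing a
square in `T_z` (`layers_cond_le`); the convective part has to be absorbed by the dissipation
(`layers_conv_le`).

For `η > 0` the temperature is not prescribed at the plates, so `w T` is not estimated through
`T_z`. Instead `w` is the vertical integral of `w_z = -(u_x + v_y)`, and an integration by parts
over the periodic cell moves the horizontal derivatives onto `T` (`LayerData.cellInt_wz_mul`). Hence
`w T` is controlled by the horizontal temperature gradient and, since `u` and `v` vanish at the
plate, by the vertical shear. With `s = σ δ`, absorption is possible once `s² δ² R ≤ 4 α`.

The boundary terms are linearized around a flux `m` with matching drop `d` (`boundary_le`).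
Averaging in time gives `(2 s - α - d) N + (α - m) D ≤ σ² δ / 2 - d m` up to a vanishing remainder
(`background_mean_le`). The remainder vanishes because the first moment of the temperature, whose
rate is total transport minus plate flux, is `o(τ)` (`tendsto_moment_div`).

The means satisfy `D + 2 η N → 1 + 2 η` for finite `η`, and `N → 1` for fixed flux. So there is a
cluster point `(n, d)` of `(N, D)` at which `N` is extremal from above and `D` from below
(`exists_extremes`). The averaged inequality at this point, with `m = n`, `σ = 2 n`, `s³ R = 4 n²`
and `α = s / 4`, yields `3/4 s ≤ d`, that is `27 n² ≤ 16 R d³` (`exists_extremes_bound`). Since `ΔT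
≥ d`, both Nusselt numbers are at most `n / d` (`nusselt_le`). All bounds then follow by algebra
from the cubic inequality, `d ≤ 1 ≤ n` and the relation between `n` and `d`. -/

/-- The integral over a periodic cell. -/
def cellInt (Lx Ly : ℝ) (h : ℝ → ℝ → ℝ) : ℝ := ∫ y in (0 : ℝ)..Ly, ∫ x in (0 : ℝ)..Lx, h x y

/-- Joint continuity of a function of two variables. -/
def Cont2 (h : ℝ → ℝ → ℝ) : Prop := Continuous fun q : ℝ × ℝ => h q.1 q.2

/-- Joint continuity in the layer, up to the plates. -/
def ContLayer (f : ℝ → ℝ → ℝ → ℝ) : Prop :=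
  ContinuousOn (fun q : ℝ × ℝ × ℝ => f q.1 q.2.1 q.2.2)
    ((univ : Set ℝ) ×ˢ (univ : Set ℝ) ×ˢ Icc (0 : ℝ) 1)

/-- The retraction of the line onto `[0, 1]`. -/
def clampUnit (z : ℝ) : ℝ := max 0 (min z 1)

lemma continuous_clampUnit : Continuous clampUnit := by unfold clampUnit; fun_prop

lemma clampUnit_mem (z : ℝ) : clampUnit z ∈ Icc (0 : ℝ) 1 := by
  unfold clampUnit; constructor
  · exact le_max_left _ _
  · exact max_le zero_le_one (min_le_right _ _)

lemma clampUnit_of_mem {z : ℝ} (hz : z ∈ Icc (0 : ℝ) 1) : clampUnit z = z := by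
  unfold clampUnit; rw [min_eq_left hz.2, max_eq_right hz.1]

/-! ### Calculus of integrals over a periodic cell. -/

section Cell

variable {Lx Ly : ℝ}

lemma continuous_cellInt_param {X : Type*} [TopologicalSpace X] [FirstCountableTopology X]
    {h : X → ℝ → ℝ → ℝ} (hh : Continuous fun p : X × ℝ × ℝ => h p.1 p.2.1 p.2.2) :
    Continuous fun p => cellInt Lx Ly (h p) := by
  unfold cellInt
  apply intervalIntegral.continuous_parametric_intervalIntegral_of_continuous'
  apply intervalIntegral.continuous_parametric_intervalIntegral_of_continuous'
    (f := fun (q : X × ℝ) x => h q.1 x q.2)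
  exact hh.comp (by fun_prop : Continuous fun r : (X × ℝ) × ℝ => (r.1.1, r.2, r.1.2))

lemma Cont2.inner {h : ℝ → ℝ → ℝ} (hh : Cont2 h) :
    Continuous fun y => ∫ x in (0 : ℝ)..Lx, h x y := by
  apply intervalIntegral.continuous_parametric_intervalIntegral_of_continuous'
    (f := fun y x => h x y)
  exact Continuous.comp (g := fun q : ℝ × ℝ => h q.1 q.2) hh continuous_swap

lemma Cont2.left {h : ℝ → ℝ → ℝ} (hh : Cont2 h) (y : ℝ) : Continuous fun x => h x y :=
  Continuous.comp hh (by fun_prop : Continuous fun x : ℝ => (x, y))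

lemma Cont2.right {h : ℝ → ℝ → ℝ} (hh : Cont2 h) (x : ℝ) : Continuous fun y => h x y :=
  Continuous.comp (g := fun q : ℝ × ℝ => h q.1 q.2) hh (by fun_prop : Continuous fun y : ℝ => (x, y))

lemma Cont2.add {f g : ℝ → ℝ → ℝ} (hf : Cont2 f) (hg : Cont2 g) :
    Cont2 fun x y => f x y + g x y := Continuous.add hf hg

lemma cont2_const (c : ℝ) : Cont2 fun _ _ => c := continuous_const

lemma Cont2.const_mul {f : ℝ → ℝ → ℝ} (hf : Cont2 f) (c : ℝ) :
    Cont2 fun x y => c * f x y := Continuous.mul continuous_const hf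

lemma intervalIntegral_swap_of_continuous {h : ℝ → ℝ → ℝ} (hh : Cont2 h) (a b c d : ℝ) :
    ∫ y in a..b, ∫ x in c..d, h x y = ∫ x in c..d, ∫ y in a..b, h x y := by
  refine MeasureTheory.intervalIntegral_intervalIntegral_swap ?_
  refine IntegrableOn.mono_set (t := uIcc a b ×ˢ uIcc c d) ?_
    (prod_mono uIoc_subset_uIcc uIoc_subset_uIcc)
  refine ContinuousOn.integrableOn_compact (isCompact_uIcc.prod isCompact_uIcc) ?_
  exact (Continuous.comp (g := fun q : ℝ × ℝ => h q.1 q.2) hh continuous_swap).continuousOn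

lemma cellInt_add {f g : ℝ → ℝ → ℝ} (hf : Cont2 f) (hg : Cont2 g) :
    cellInt Lx Ly (fun x y => f x y + g x y) = cellInt Lx Ly f + cellInt Lx Ly g := by
  unfold cellInt
  rw [← intervalIntegral.integral_add (hf.inner.intervalIntegrable _ _)
    (hg.inner.intervalIntegrable _ _)]
  refine intervalIntegral.integral_congr fun y _ => ?_
  exact intervalIntegral.integral_add ((hf.left y).intervalIntegrable _ _)
    ((hg.left y).intervalIntegrable _ _)

lemma cellInt_const_mul (c : ℝ) (f : ℝ → ℝ → ℝ) :
    cellInt Lx Ly (fun x y => c * f x y) = c * cellInt Lx Ly f := by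
  simp [cellInt, intervalIntegral.integral_const_mul]

lemma cellInt_neg (f : ℝ → ℝ → ℝ) :
    cellInt Lx Ly (fun x y => -f x y) = -cellInt Lx Ly f := by
  simp [cellInt, intervalIntegral.integral_neg]

lemma cellInt_sub {f g : ℝ → ℝ → ℝ} (hf : Cont2 f) (hg : Cont2 g) :
    cellInt Lx Ly (fun x y => f x y - g x y) = cellInt Lx Ly f - cellInt Lx Ly g := by
  have hn : Cont2 fun x y => -g x y := Continuous.neg hg
  rw [sub_eq_add_neg, ← cellInt_neg, ← cellInt_add hf hn]
  simp only [sub_eq_add_neg]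

lemma cellInt_const (c : ℝ) : cellInt Lx Ly (fun _ _ => c) = Lx * Ly * c := by
  simp [cellInt]; ring

lemma cellInt_mono {f g : ℝ → ℝ → ℝ} (hLx : 0 ≤ Lx) (hLy : 0 ≤ Ly) (hf : Cont2 f) (hg : Cont2 g)
    (h : ∀ x y, f x y ≤ g x y) : cellInt Lx Ly f ≤ cellInt Lx Ly g := by
  refine intervalIntegral.integral_mono_on hLy (hf.inner.intervalIntegrable _ _)
    (hg.inner.intervalIntegrable _ _) fun y _ => ?_
  exact intervalIntegral.integral_mono_on hLx ((hf.left y).intervalIntegrable _ _)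
    ((hg.left y).intervalIntegrable _ _) fun x _ => h x y

lemma cellInt_nonneg {f : ℝ → ℝ → ℝ} (hLx : 0 ≤ Lx) (hLy : 0 ≤ Ly) (h : ∀ x y, 0 ≤ f x y) :
    0 ≤ cellInt Lx Ly f :=
  intervalIntegral.integral_nonneg hLy fun y _ =>
    intervalIntegral.integral_nonneg hLx fun x _ => h x y

lemma cellInt_deriv_left {f f' : ℝ → ℝ → ℝ} (hf' : Cont2 f')
    (hd : ∀ x y, HasDerivAt (fun s => f s y) (f' x y) x)
    (hp : ∀ y, f (0 + Lx) y = f 0 y) : cellInt Lx Ly f' = 0 := by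
  have : ∀ y, ∫ x in (0 : ℝ)..Lx, f' x y = 0 := fun y => by
    rw [intervalIntegral.integral_eq_sub_of_hasDerivAt (f := fun x => f x y)
      (fun x _ => hd x y) ((hf'.left y).intervalIntegrable _ _), ← zero_add Lx, hp y, sub_self]
  simp [cellInt, this]

lemma cellInt_deriv_right {f f' : ℝ → ℝ → ℝ} (hf' : Cont2 f')
    (hd : ∀ x y, HasDerivAt (fun s => f x s) (f' x y) y)
    (hp : ∀ x, f x (0 + Ly) = f x 0) : cellInt Lx Ly f' = 0 := by
  have : ∀ x, ∫ y in (0 : ℝ)..Ly, f' x y = 0 := fun x => by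
    rw [intervalIntegral.integral_eq_sub_of_hasDerivAt (f := fun y => f x y)
      (fun y _ => hd x y) ((hf'.right x).intervalIntegrable _ _), ← zero_add Ly, hp x, sub_self]
  unfold cellInt
  rw [intervalIntegral_swap_of_continuous hf']
  simp [this]

/-- Integration over a cell commutes with integration over an interval. -/
lemma integral_cellInt_swap {h : ℝ → ℝ → ℝ → ℝ}
    (hh : Continuous fun p : ℝ × ℝ × ℝ => h p.1 p.2.1 p.2.2) (a b : ℝ) :
    ∫ z in a..b, cellInt Lx Ly (h z) = cellInt Lx Ly fun x y => ∫ z in a..b, h z x y := by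
  unfold cellInt
  have h1 : Cont2 fun y z => ∫ x in (0 : ℝ)..Lx, h z x y := by
    unfold Cont2
    apply intervalIntegral.continuous_parametric_intervalIntegral_of_continuous'
      (f := fun (q : ℝ × ℝ) x => h q.2 x q.1)
    exact hh.comp (by fun_prop : Continuous fun r : (ℝ × ℝ) × ℝ => (r.1.2, r.2, r.1.1))
  rw [intervalIntegral_swap_of_continuous h1]
  refine intervalIntegral.integral_congr fun y _ => ?_
  refine intervalIntegral_swap_of_continuous (h := fun x z => h z x y) ?_ _ _ _ _
  exact hh.comp (by fun_prop : Continuous fun r : ℝ × ℝ => (r.2, r.1, y))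

end Cell

/-! ### Functions continuous up to the plates, and the divergence theorem in a slab. -/

section Layer

variable {Lx Ly : ℝ} {f g : ℝ → ℝ → ℝ → ℝ}

/-- Continuity is known only on the closed layer, while the results on parametric integrals and on
exchanging integrals are used for functions continuous everywhere. Precomposing with the retraction
supplies such a function without changing any value in the layer. -/
lemma ContLayer.clamp (hf : ContLayer f) :
    Continuous fun q : ℝ × ℝ × ℝ => f q.2.1 q.2.2 (clampUnit q.1) := by
  refine ContinuousOn.comp_continuous (f := fun q : ℝ × ℝ × ℝ => (q.2.1, q.2.2, clampUnit q.1))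
    hf ?_ fun q => ⟨mem_univ _, mem_univ _, clampUnit_mem _⟩
  have := continuous_clampUnit
  fun_prop

lemma ContLayer.slice (hf : ContLayer f) {z : ℝ} (hz : z ∈ Icc (0 : ℝ) 1) :
    Cont2 fun x y => f x y z := by
  have := hf.clamp.comp (by fun_prop : Continuous fun q : ℝ × ℝ => (z, q))
  simpa [Function.comp_def, clampUnit_of_mem hz, Cont2] using this

lemma ContLayer.vertical (hf : ContLayer f) (x y : ℝ) :
    ContinuousOn (fun z => f x y z) (Icc 0 1) := by
  refine ContinuousOn.comp (t := (univ : Set ℝ) ×ˢ (univ : Set ℝ) ×ˢ Icc (0 : ℝ) 1)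
    (f := fun z : ℝ => (x, y, z)) hf (by fun_prop) fun z hz => ⟨mem_univ _, mem_univ _, hz⟩

lemma ContLayer.cellInt (hf : ContLayer f) :
    ContinuousOn (fun z => cellInt Lx Ly fun x y => f x y z) (Icc 0 1) := by
  have := continuous_cellInt_param (Lx := Lx) (Ly := Ly)
    (h := fun z x y => f x y (clampUnit z)) hf.clamp
  exact this.continuousOn.congr fun z hz => by simp only [clampUnit_of_mem hz]

lemma ContLayer.add (hf : ContLayer f) (hg : ContLayer g) :
    ContLayer fun x y z => f x y z + g x y z := ContinuousOn.add hf hg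

lemma ContLayer.sub (hf : ContLayer f) (hg : ContLayer g) :
    ContLayer fun x y z => f x y z - g x y z := ContinuousOn.sub hf hg

lemma ContLayer.mul (hf : ContLayer f) (hg : ContLayer g) :
    ContLayer fun x y z => f x y z * g x y z := ContinuousOn.mul hf hg

lemma ContLayer.neg (hf : ContLayer f) : ContLayer fun x y z => -f x y z := ContinuousOn.neg hf

lemma ContLayer.pow (hf : ContLayer f) (n : ℕ) : ContLayer fun x y z => f x y z ^ n :=
  ContinuousOn.pow hf n

lemma ContLayer.const_mul (hf : ContLayer f) (c : ℝ) : ContLayer fun x y z => c * f x y z :=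
  ContinuousOn.mul continuousOn_const hf

lemma contLayer_vertical {τ : ℝ → ℝ} (hτ : Continuous τ) : ContLayer fun _ _ z => τ z :=
  (hτ.comp (by fun_prop : Continuous fun q : ℝ × ℝ × ℝ => q.2.2)).continuousOn

lemma intervalIntegrable_of_continuousOn_unit {h : ℝ → ℝ} (hh : ContinuousOn h (Icc 0 1))
    {a b : ℝ} (ha : a ∈ Icc (0 : ℝ) 1) (hb : b ∈ Icc (0 : ℝ) 1) :
    IntervalIntegrable h volume a b :=
  (hh.mono (uIcc_subset_Icc ha hb)).intervalIntegrable

/-- The fundamental theorem of calculus for cell integrals. -/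
lemma integral_cellInt_deriv {c c' : ℝ → ℝ → ℝ → ℝ} (hc : ContLayer c) (hc' : ContLayer c')
    (hd : ∀ x y, ∀ z ∈ Icc (0 : ℝ) 1, HasDerivWithinAt (fun s => c x y s) (c' x y z) (Icc 0 1) z)
    {a b : ℝ} (ha : a ∈ Icc (0 : ℝ) 1) (hb : b ∈ Icc (0 : ℝ) 1) (hab : a ≤ b) :
    ∫ z in a..b, cellInt Lx Ly (fun x y => c' x y z) =
      cellInt Lx Ly (fun x y => c x y b) - cellInt Lx Ly (fun x y => c x y a) := by
  have hsub : Icc a b ⊆ Icc 0 1 := Icc_subset_Icc ha.1 hb.2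
  rw [← cellInt_sub (hc.slice hb) (hc.slice ha)]
  calc ∫ z in a..b, cellInt Lx Ly (fun x y => c' x y z)
      = ∫ z in a..b, cellInt Lx Ly (fun x y => c' x y (clampUnit z)) := by
        refine intervalIntegral.integral_congr fun z hz => ?_
        rw [uIcc_of_le hab] at hz
        simp only [clampUnit_of_mem (hsub hz)]
    _ = cellInt Lx Ly fun x y => ∫ z in a..b, c' x y (clampUnit z) :=
        integral_cellInt_swap (h := fun z x y => c' x y (clampUnit z)) hc'.clamp a b
    _ = _ := by
        congr 1; ext x y
        have : ∫ z in a..b, c' x y (clampUnit z) = ∫ z in a..b, c' x y z := by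
          refine intervalIntegral.integral_congr fun z hz => ?_
          rw [uIcc_of_le hab] at hz
          simp only [clampUnit_of_mem (hsub hz)]
        rw [this]
        refine intervalIntegral.integral_eq_sub_of_hasDerivAt_of_le (f := fun z => c x y z) hab
          ((hc.vertical x y).mono hsub) (fun z hz => ?_)
          (intervalIntegrable_of_continuousOn_unit (hc'.vertical x y) ha hb)
        have hz' : z ∈ Ioo (0 : ℝ) 1 := ⟨ha.1.trans_lt hz.1, hz.2.trans_le hb.2⟩
        exact (hd x y z (Ioo_subset_Icc_self hz')).hasDerivAt (Icc_mem_nhds hz'.1 hz'.2)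

/-- The divergence theorem in a horizontal slab, for fluxes periodic in the horizontal
variables. -/
lemma integral_cellInt_div {a b c a' b' c' : ℝ → ℝ → ℝ → ℝ}
    (ha' : ContLayer a') (hb' : ContLayer b') (hc : ContLayer c) (hc' : ContLayer c')
    (hda : ∀ x y, ∀ z ∈ Icc (0 : ℝ) 1, HasDerivAt (fun s => a s y z) (a' x y z) x)
    (hdb : ∀ x y, ∀ z ∈ Icc (0 : ℝ) 1, HasDerivAt (fun s => b x s z) (b' x y z) y)
    (hdc : ∀ x y, ∀ z ∈ Icc (0 : ℝ) 1, HasDerivWithinAt (fun s => c x y s) (c' x y z) (Icc 0 1) z)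
    (hpa : ∀ x y, ∀ z ∈ Icc (0 : ℝ) 1, a (x + Lx) y z = a x y z)
    (hpb : ∀ x y, ∀ z ∈ Icc (0 : ℝ) 1, b x (y + Ly) z = b x y z)
    {z₀ z₁ : ℝ} (hz₀ : z₀ ∈ Icc (0 : ℝ) 1) (hz₁ : z₁ ∈ Icc (0 : ℝ) 1) (h01 : z₀ ≤ z₁) :
    ∫ z in z₀..z₁, cellInt Lx Ly (fun x y => a' x y z + b' x y z + c' x y z) =
      cellInt Lx Ly (fun x y => c x y z₁) - cellInt Lx Ly (fun x y => c x y z₀) := by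
  rw [← integral_cellInt_deriv hc hc' hdc hz₀ hz₁ h01]
  refine intervalIntegral.integral_congr fun z hz => ?_
  rw [uIcc_of_le h01] at hz
  replace hz : z ∈ Icc (0 : ℝ) 1 := Icc_subset_Icc hz₀.1 hz₁.2 hz
  change cellInt Lx Ly (fun x y => a' x y z + b' x y z + c' x y z) = _
  rw [cellInt_add ((ha'.add hb').slice hz) (hc'.slice hz),
    cellInt_add (ha'.slice hz) (hb'.slice hz),
    cellInt_deriv_left (ha'.slice hz) (fun x y => hda x y z hz) (fun y => hpa 0 y z hz),
    cellInt_deriv_right (hb'.slice hz) (fun x y => hdb x y z hz) (fun x => hpb x 0 z hz)]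
  simp

end Layer

/-! ### Integrals over the layer -/

section Vol

variable {Lx Ly : ℝ} {f g : ℝ → ℝ → ℝ → ℝ}

lemma volInt_eq (f : ℝ → ℝ → ℝ → ℝ) :
    volInt Lx Ly f = ∫ z in (0 : ℝ)..1, cellInt Lx Ly fun x y => f x y z := rfl

lemma ContLayer.integrable (hf : ContLayer f) :
    IntervalIntegrable (fun z => RayleighBenard.cellInt Lx Ly fun x y => f x y z) volume 0 1 :=
  intervalIntegrable_of_continuousOn_unit hf.cellInt (by simp) (by simp)

lemma volInt_congr (h : ∀ x y, ∀ z ∈ Icc (0 : ℝ) 1, f x y z = g x y z) :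
    volInt Lx Ly f = volInt Lx Ly g := by
  rw [volInt_eq, volInt_eq]
  refine intervalIntegral.integral_congr fun z hz => ?_
  rw [uIcc_of_le zero_le_one] at hz
  simp only [h _ _ z hz]

lemma volInt_add (hf : ContLayer f) (hg : ContLayer g) :
    volInt Lx Ly (fun x y z => f x y z + g x y z) = volInt Lx Ly f + volInt Lx Ly g := by
  simp only [volInt_eq]
  rw [← intervalIntegral.integral_add hf.integrable hg.integrable]
  refine intervalIntegral.integral_congr fun z hz => ?_
  rw [uIcc_of_le zero_le_one] at hz
  exact cellInt_add (hf.slice hz) (hg.slice hz)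

lemma volInt_sub (hf : ContLayer f) (hg : ContLayer g) :
    volInt Lx Ly (fun x y z => f x y z - g x y z) = volInt Lx Ly f - volInt Lx Ly g := by
  simp only [volInt_eq]
  rw [← intervalIntegral.integral_sub hf.integrable hg.integrable]
  refine intervalIntegral.integral_congr fun z hz => ?_
  rw [uIcc_of_le zero_le_one] at hz
  exact cellInt_sub (hf.slice hz) (hg.slice hz)

lemma volInt_const_mul (c : ℝ) (f : ℝ → ℝ → ℝ → ℝ) :
    volInt Lx Ly (fun x y z => c * f x y z) = c * volInt Lx Ly f := by
  simp [volInt_eq, cellInt_const_mul, intervalIntegral.integral_const_mul]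

lemma volInt_neg (f : ℝ → ℝ → ℝ → ℝ) :
    volInt Lx Ly (fun x y z => -f x y z) = -volInt Lx Ly f := by
  simp [volInt_eq, cellInt_neg, intervalIntegral.integral_neg]

lemma volInt_const (c : ℝ) : volInt Lx Ly (fun _ _ _ => c) = Lx * Ly * c := by
  simp [volInt_eq, cellInt_const]

lemma volInt_mono (hLx : 0 ≤ Lx) (hLy : 0 ≤ Ly) (hf : ContLayer f) (hg : ContLayer g)
    (h : ∀ x y, ∀ z ∈ Icc (0 : ℝ) 1, f x y z ≤ g x y z) : volInt Lx Ly f ≤ volInt Lx Ly g :=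
  intervalIntegral.integral_mono_on zero_le_one hf.integrable hg.integrable fun z hz =>
    cellInt_mono hLx hLy (hf.slice hz) (hg.slice hz) fun x y => h x y z hz

lemma volInt_nonneg (hLx : 0 ≤ Lx) (hLy : 0 ≤ Ly)
    (h : ∀ x y, ∀ z ∈ Icc (0 : ℝ) 1, 0 ≤ f x y z) : 0 ≤ volInt Lx Ly f :=
  intervalIntegral.integral_nonneg zero_le_one fun z hz =>
    cellInt_nonneg hLx hLy fun x y => h x y z hz

end Vol

/-! ### Fields at a fixed time and Green's identity. -/

lemma ContOn.layer {I : Set ℝ} {f : Field} (hf : ContOn I f) {t : ℝ} (ht : t ∈ I) :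
    ContLayer (f t) :=
  ContinuousOn.comp (t := I ×ˢ (univ : Set ℝ) ×ˢ (univ : Set ℝ) ×ˢ Icc (0 : ℝ) 1)
    (f := fun q : ℝ × ℝ × ℝ => (t, q)) hf (by fun_prop) fun _ hq => ⟨ht, hq⟩

section Derivatives

variable {Lx Ly : ℝ} {f : Field} {t : ℝ}

lemma SpaceC1.hasDerivAt_x (hf : SpaceC1 f) (ht : 0 < t) (x y : ℝ) {z : ℝ}
    (hz : z ∈ Icc (0 : ℝ) 1) : HasDerivAt (fun s => f t s y z) (dx f t x y z) x :=
  (hf.diff_x t ht x y z hz).hasDerivAt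

lemma SpaceC1.hasDerivAt_y (hf : SpaceC1 f) (ht : 0 < t) (x y : ℝ) {z : ℝ}
    (hz : z ∈ Icc (0 : ℝ) 1) : HasDerivAt (fun s => f t x s z) (dy f t x y z) y :=
  (hf.diff_y t ht x y z hz).hasDerivAt

lemma SpaceC1.hasDerivWithinAt_z (hf : SpaceC1 f) (ht : 0 < t) (x y : ℝ) {z : ℝ}
    (hz : z ∈ Icc (0 : ℝ) 1) :
    HasDerivWithinAt (fun s => f t x y s) (dz f t x y z) (Icc 0 1) z :=
  (hf.diff_z t ht x y z hz).hasDerivWithinAt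

lemma ClassicalReg.hasDerivAt_t (hf : ClassicalReg f) (ht : 0 < t) (x y : ℝ) {z : ℝ}
    (hz : z ∈ Icc (0 : ℝ) 1) : HasDerivAt (fun s => f s x y z) (dt f t x y z) t :=
  (hf.diff_t t ht x y z hz).hasDerivAt

lemma SpaceC1.layer (hf : SpaceC1 f) (ht : 0 < t) : ContLayer (f t) := hf.cont.layer ht
lemma SpaceC1.layer_x (hf : SpaceC1 f) (ht : 0 < t) : ContLayer (dx f t) := hf.cont_dx.layer ht
lemma SpaceC1.layer_y (hf : SpaceC1 f) (ht : 0 < t) : ContLayer (dy f t) := hf.cont_dy.layer ht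
lemma SpaceC1.layer_z (hf : SpaceC1 f) (ht : 0 < t) : ContLayer (dz f t) := hf.cont_dz.layer ht
lemma ClassicalReg.layer_t (hf : ClassicalReg f) (ht : 0 < t) : ContLayer (dt f t) :=
  hf.cont_dt.layer ht

lemma ClassicalReg.layer_lap (hf : ClassicalReg f) (ht : 0 < t) : ContLayer (lap f t) :=
  ((hf.dx_spaceC1.layer_x ht).add (hf.dy_spaceC1.layer_y ht)).add (hf.dz_spaceC1.layer_z ht)

lemma HPeriodic.dx_periodic (hf : HPeriodic Lx Ly f) (ht : 0 < t) (x y : ℝ) {z : ℝ}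
    (hz : z ∈ Icc (0 : ℝ) 1) : dx f t (x + Lx) y z = dx f t x y z := by
  unfold dx
  rw [← deriv_comp_add_const (f := fun s => f t s y z)]
  congr 1; ext s
  exact (hf t ht s y z hz).1

lemma HPeriodic.dy_periodic (hf : HPeriodic Lx Ly f) (ht : 0 < t) (x y : ℝ) {z : ℝ}
    (hz : z ∈ Icc (0 : ℝ) 1) : dy f t x (y + Ly) z = dy f t x y z := by
  unfold dy
  rw [← deriv_comp_add_const (f := fun s => f t x s z)]
  congr 1; ext s
  exact (hf t ht x s z hz).2

/-- The squared length of the spatial gradient. -/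
def gradSq (f : Field) : Field := fun t x y z =>
  dx f t x y z ^ 2 + dy f t x y z ^ 2 + dz f t x y z ^ 2

lemma SpaceC1.layer_gradSq (hf : SpaceC1 f) (ht : 0 < t) : ContLayer (gradSq f t) :=
  (((hf.layer_x ht).pow 2).add ((hf.layer_y ht).pow 2)).add ((hf.layer_z ht).pow 2)

/-- Divergence theorem for the flux `f ∇f`: periodicity removes the horizontal fluxes. The plate
terms are kept because the temperature need not vanish there. -/
lemma volInt_mul_lap (hf : ClassicalReg f) (hp : HPeriodic Lx Ly f) (ht : 0 < t) :
    volInt Lx Ly (fun x y z => f t x y z * lap f t x y z) =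
      cellInt Lx Ly (fun x y => f t x y 1 * dz f t x y 1)
      - cellInt Lx Ly (fun x y => f t x y 0 * dz f t x y 0) - volInt Lx Ly (gradSq f t) := by
  have h0 := hf.spaceC1
  have c := h0.layer ht
  have cx := h0.layer_x ht
  have cy := h0.layer_y ht
  have cz := h0.layer_z ht
  have key := integral_cellInt_div (Lx := Lx) (Ly := Ly)
    (a := fun x y z => f t x y z * dx f t x y z) (b := fun x y z => f t x y z * dy f t x y z)
    (c := fun x y z => f t x y z * dz f t x y z)
    ((cx.mul cx).add (c.mul (hf.dx_spaceC1.layer_x ht)))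
    ((cy.mul cy).add (c.mul (hf.dy_spaceC1.layer_y ht)))
    (c.mul cz)
    ((cz.mul cz).add (c.mul (hf.dz_spaceC1.layer_z ht)))
    (fun x y z hz => (h0.hasDerivAt_x ht x y hz).fun_mul (hf.dx_spaceC1.hasDerivAt_x ht x y hz))
    (fun x y z hz => (h0.hasDerivAt_y ht x y hz).fun_mul (hf.dy_spaceC1.hasDerivAt_y ht x y hz))
    (fun x y z hz => (h0.hasDerivWithinAt_z ht x y hz).fun_mul
      (hf.dz_spaceC1.hasDerivWithinAt_z ht x y hz))
    (fun x y z hz => by simp only [(hp t ht x y z hz).1, hp.dx_periodic ht x y hz])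
    (fun x y z hz => by simp only [(hp t ht x y z hz).2, hp.dy_periodic ht x y hz])
    (z₀ := 0) (z₁ := 1) (by simp) (by simp) zero_le_one
  rw [← key, ← volInt_eq (Lx := Lx) (Ly := Ly) (f := fun x y z =>
    dx f t x y z * dx f t x y z + f t x y z * dx (dx f) t x y z
    + (dy f t x y z * dy f t x y z + f t x y z * dy (dy f) t x y z)
    + (dz f t x y z * dz f t x y z + f t x y z * dz (dz f) t x y z)), ← volInt_sub ?_
    (h0.layer_gradSq ht)]
  · refine volInt_congr fun x y z _ => ?_
    simp only [lap, gradSq]; ring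
  · exact (((cx.mul cx).add (c.mul (hf.dx_spaceC1.layer_x ht))).add
      ((cy.mul cy).add (c.mul (hf.dy_spaceC1.layer_y ht)))).add
      ((cz.mul cz).add (c.mul (hf.dz_spaceC1.layer_z ht)))

end Derivatives

/-! ### Balances of heat, temperature variance and kinetic energy at a fixed time. -/

namespace IsSolution

variable {Pr R Lx Ly : ℝ} {η : ℝ≥0∞} {F : Fields} {t : ℝ}

/-- Advection by the velocity, in divergence form. -/
lemma integral_advection (hF : IsSolution Pr R Lx Ly η F) {f : Field} (hf : SpaceC1 f)
    (hp : HPeriodic Lx Ly f) (ht : 0 < t) {a b : ℝ} (ha : a ∈ Icc (0 : ℝ) 1)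
    (hb : b ∈ Icc (0 : ℝ) 1) (hab : a ≤ b) :
    ∫ z in a..b, cellInt Lx Ly (fun x y => F.u t x y z * dx f t x y z
        + F.v t x y z * dy f t x y z + F.w t x y z * dz f t x y z) =
      cellInt Lx Ly (fun x y => F.w t x y b * f t x y b)
      - cellInt Lx Ly (fun x y => F.w t x y a * f t x y a) := by
  have hu := hF.reg_u.spaceC1
  have hv := hF.reg_v.spaceC1
  have hw := hF.reg_w.spaceC1
  have c := hf.layer ht
  rw [← integral_cellInt_div (Lx := Lx) (Ly := Ly)
    (a := fun x y z => F.u t x y z * f t x y z) (b := fun x y z => F.v t x y z * f t x y z)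
    (c := fun x y z => F.w t x y z * f t x y z)
    (((hu.layer_x ht).mul c).add ((hu.layer ht).mul (hf.layer_x ht)))
    (((hv.layer_y ht).mul c).add ((hv.layer ht).mul (hf.layer_y ht)))
    ((hw.layer ht).mul c)
    (((hw.layer_z ht).mul c).add ((hw.layer ht).mul (hf.layer_z ht)))
    (fun x y z hz => (hu.hasDerivAt_x ht x y hz).fun_mul (hf.hasDerivAt_x ht x y hz))
    (fun x y z hz => (hv.hasDerivAt_y ht x y hz).fun_mul (hf.hasDerivAt_y ht x y hz))
    (fun x y z hz => (hw.hasDerivWithinAt_z ht x y hz).fun_mul (hf.hasDerivWithinAt_z ht x y hz))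
    (fun x y z hz => by simp only [(hp t ht x y z hz).1, (hF.per_u t ht x y z hz).1])
    (fun x y z hz => by simp only [(hp t ht x y z hz).2, (hF.per_v t ht x y z hz).2])
    ha hb hab]
  refine intervalIntegral.integral_congr fun z hz => ?_
  rw [uIcc_of_le hab] at hz
  replace hz : z ∈ Icc (0 : ℝ) 1 := Icc_subset_Icc ha.1 hb.2 hz
  change cellInt _ _ _ = cellInt _ _ _
  congr 1; ext x y
  linear_combination -(f t x y z) * hF.incompressible t ht x y z hz

lemma volInt_advection (hF : IsSolution Pr R Lx Ly η F) {f : Field} (hf : SpaceC1 f)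
    (hp : HPeriodic Lx Ly f) (ht : 0 < t) :
    volInt Lx Ly (fun x y z => F.u t x y z * dx f t x y z
        + F.v t x y z * dy f t x y z + F.w t x y z * dz f t x y z) = 0 := by
  rw [volInt_eq, hF.integral_advection hf hp ht (by simp) (by simp) zero_le_one]
  simp [(hF.no_slip t ht _ _ 0 (by simp)).2.2, (hF.no_slip t ht _ _ 1 (by simp)).2.2,
    cellInt_const]

/-- Since `2 f u·∇f = u·∇(f²)`, this is `volInt_advection` for `f²`; most of the proof checks that
`f²` inherits the regularity. -/
lemma volInt_mul_advection (hF : IsSolution Pr R Lx Ly η F) {f : Field} (hf : SpaceC1 f)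
    (hp : HPeriodic Lx Ly f) (ht : 0 < t) :
    volInt Lx Ly (fun x y z => f t x y z * (F.u t x y z * dx f t x y z
        + F.v t x y z * dy f t x y z + F.w t x y z * dz f t x y z)) = 0 := by
  have dx2 : ∀ {t} (_ : 0 < t) (x y : ℝ) {z} (_ : z ∈ Icc (0 : ℝ) 1),
      HasDerivAt (fun s => f t s y z ^ 2) (2 * f t x y z * dx f t x y z) x :=
    fun ht x y z hz => ((hf.hasDerivAt_x ht x y hz).fun_pow 2).congr_deriv (by ring)
  have dy2 : ∀ {t} (_ : 0 < t) (x y : ℝ) {z} (_ : z ∈ Icc (0 : ℝ) 1),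
      HasDerivAt (fun s => f t x s z ^ 2) (2 * f t x y z * dy f t x y z) y :=
    fun ht x y z hz => ((hf.hasDerivAt_y ht x y hz).fun_pow 2).congr_deriv (by ring)
  have dz2 : ∀ {t} (_ : 0 < t) (x y : ℝ) {z} (_ : z ∈ Icc (0 : ℝ) 1),
      HasDerivWithinAt (fun s => f t x y s ^ 2) (2 * f t x y z * dz f t x y z) (Icc 0 1) z :=
    fun ht x y z hz => ((hf.hasDerivWithinAt_z ht x y hz).fun_pow 2).congr_deriv (by ring)
  have ex : ∀ {t} (_ : 0 < t) (x y : ℝ) {z} (_ : z ∈ Icc (0 : ℝ) 1),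
      dx (fun t x y z => f t x y z ^ 2) t x y z = 2 * f t x y z * dx f t x y z :=
    fun ht x y _ hz => (dx2 ht x y hz).deriv
  have ey : ∀ {t} (_ : 0 < t) (x y : ℝ) {z} (_ : z ∈ Icc (0 : ℝ) 1),
      dy (fun t x y z => f t x y z ^ 2) t x y z = 2 * f t x y z * dy f t x y z :=
    fun ht x y _ hz => (dy2 ht x y hz).deriv
  have ez : ∀ {t} (_ : 0 < t) (x y : ℝ) {z} (_ : z ∈ Icc (0 : ℝ) 1),
      dz (fun t x y z => f t x y z ^ 2) t x y z = 2 * f t x y z * dz f t x y z :=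
    fun ht x y z hz => (dz2 ht x y hz).derivWithin (uniqueDiffOn_Icc_zero_one z hz)
  have h2 : SpaceC1 (fun t x y z => f t x y z ^ 2) :=
    { cont := ContinuousOn.pow hf.cont 2
      diff_x := fun t ht x y z hz => (dx2 ht x y hz).differentiableAt
      diff_y := fun t ht x y z hz => (dy2 ht x y hz).differentiableAt
      diff_z := fun t ht x y z hz => (dz2 ht x y hz).differentiableWithinAt
      cont_dx := ContinuousOn.congr (ContinuousOn.mul (continuousOn_const.mul hf.cont) hf.cont_dx)
        fun q hq => ex hq.1 _ _ hq.2.2.2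
      cont_dy := ContinuousOn.congr (ContinuousOn.mul (continuousOn_const.mul hf.cont) hf.cont_dy)
        fun q hq => ey hq.1 _ _ hq.2.2.2
      cont_dz := ContinuousOn.congr (ContinuousOn.mul (continuousOn_const.mul hf.cont) hf.cont_dz)
        fun q hq => ez hq.1 _ _ hq.2.2.2 }
  have key := hF.volInt_advection h2 (fun t ht x y z hz => by
    simp only [(hp t ht x y z hz).1, (hp t ht x y z hz).2, and_self]) ht
  have : volInt Lx Ly (fun x y z => 2 * (f t x y z * (F.u t x y z * dx f t x y z
        + F.v t x y z * dy f t x y z + F.w t x y z * dz f t x y z))) = 0 := by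
    rw [← key]
    refine volInt_congr fun x y z hz => ?_
    rw [ex ht x y hz, ey ht x y hz, ez ht x y hz]; ring
  rw [volInt_const_mul] at this
  linarith

lemma layer_advection (hF : IsSolution Pr R Lx Ly η F) {f : Field} (hf : SpaceC1 f) (ht : 0 < t) :
    ContLayer fun x y z => F.u t x y z * dx f t x y z + F.v t x y z * dy f t x y z
      + F.w t x y z * dz f t x y z :=
  (((hF.reg_u.spaceC1.layer ht).mul (hf.layer_x ht)).add
    ((hF.reg_v.spaceC1.layer ht).mul (hf.layer_y ht))).add
    ((hF.reg_w.spaceC1.layer ht).mul (hf.layer_z ht))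

/-- The vertical heat flux through the cell at height `z`, with the opposite sign. -/
def _root_.RayleighBenard.Fields.fluxAt (F : Fields) (Lx Ly t z : ℝ) : ℝ :=
  cellInt Lx Ly (fun x y => dz F.T t x y z) - cellInt Lx Ly (fun x y => F.w t x y z * F.T t x y z)

/-- Advection and the Laplacian are both divergences, so over a periodic cell the heat equation
becomes a one-dimensional conservation law for `fluxAt`. This integrated form holds up to the
plates; `integral_linear_mul` extracts from it the derivative in the interior. -/
lemma integral_dt_T (hF : IsSolution Pr R Lx Ly η F) (ht : 0 < t) {a b : ℝ}
    (ha : a ∈ Icc (0 : ℝ) 1) (hb : b ∈ Icc (0 : ℝ) 1) (hab : a ≤ b) :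
    ∫ z in a..b, cellInt Lx Ly (fun x y => dt F.T t x y z) =
      F.fluxAt Lx Ly t b - F.fluxAt Lx Ly t a := by
  have hT := hF.reg_T
  have hd := integral_cellInt_div (Lx := Lx) (Ly := Ly)
    (a := dx F.T t) (b := dy F.T t) (c := dz F.T t)
    (hT.dx_spaceC1.layer_x ht) (hT.dy_spaceC1.layer_y ht) (hT.spaceC1.layer_z ht)
    (hT.dz_spaceC1.layer_z ht)
    (fun x y z hz => hT.dx_spaceC1.hasDerivAt_x ht x y hz)
    (fun x y z hz => hT.dy_spaceC1.hasDerivAt_y ht x y hz)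
    (fun x y z hz => hT.dz_spaceC1.hasDerivWithinAt_z ht x y hz)
    (fun x y z hz => hF.per_T.dx_periodic ht x y hz)
    (fun x y z hz => hF.per_T.dy_periodic ht x y hz) ha hb hab
  have hadv := hF.integral_advection hT.spaceC1 hF.per_T ht ha hb hab
  have hl : ContLayer (lap F.T t) := hT.layer_lap ht
  have hlad := hF.layer_advection hT.spaceC1 ht
  have : ∫ z in a..b, cellInt Lx Ly (fun x y => dt F.T t x y z) =
      (∫ z in a..b, cellInt Lx Ly (fun x y => lap F.T t x y z)) -
      ∫ z in a..b, cellInt Lx Ly (fun x y => F.u t x y z * dx F.T t x y z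
        + F.v t x y z * dy F.T t x y z + F.w t x y z * dz F.T t x y z) := by
    rw [← intervalIntegral.integral_sub
      (intervalIntegrable_of_continuousOn_unit hl.cellInt ha hb)
      (intervalIntegrable_of_continuousOn_unit hlad.cellInt ha hb)]
    refine intervalIntegral.integral_congr fun z hz => ?_
    rw [uIcc_of_le hab] at hz
    replace hz : z ∈ Icc (0 : ℝ) 1 := Icc_subset_Icc ha.1 hb.2 hz
    change cellInt _ _ _ = _
    rw [← cellInt_sub (hl.slice hz) (hlad.slice hz)]
    congr 1; ext x y
    have := hF.heat t ht x y z hz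
    unfold Fields.matDeriv at this
    linear_combination this
  rw [this, hadv]
  have : ∫ z in a..b, cellInt Lx Ly (fun x y => lap F.T t x y z) = _ := hd
  rw [this]
  unfold Fields.fluxAt
  ring

/-- The balance of the temperature variance. -/
lemma volInt_T_mul_dt (hF : IsSolution Pr R Lx Ly η F) (ht : 0 < t) :
    volInt Lx Ly (fun x y z => F.T t x y z * dt F.T t x y z) =
      cellInt Lx Ly (fun x y => F.T t x y 1 * dz F.T t x y 1)
      - cellInt Lx Ly (fun x y => F.T t x y 0 * dz F.T t x y 0) - volInt Lx Ly (gradSq F.T t) := by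
  have hT := hF.reg_T
  rw [← volInt_mul_lap hT hF.per_T ht, ← sub_zero (volInt Lx Ly fun x y z => _ * lap _ _ _ _ _),
    ← hF.volInt_mul_advection hT.spaceC1 hF.per_T ht, ← volInt_sub
      ((hT.spaceC1.layer ht).mul (hT.layer_lap ht))
      ((hT.spaceC1.layer ht).mul (hF.layer_advection hT.spaceC1 ht))]
  refine volInt_congr fun x y z hz => ?_
  have := hF.heat t ht x y z hz
  unfold Fields.matDeriv at this
  linear_combination F.T t x y z * this

/-- One computation serves all three velocity components; `g` collects the pressure gradient and the
buoyancy. -/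
lemma volInt_velocity_component (hF : IsSolution Pr R Lx Ly η F) {f g : Field}
    (hf : ClassicalReg f) (hp : HPeriodic Lx Ly f) (ht : 0 < t)
    (h0 : ∀ x y, f t x y 0 = 0) (h1 : ∀ x y, f t x y 1 = 0) (hg : ContLayer (g t))
    (hm : ∀ x y, ∀ z ∈ Icc (0 : ℝ) 1,
      Pr⁻¹ * F.matDeriv f t x y z = lap f t x y z + g t x y z) :
    volInt Lx Ly (fun x y z => Pr⁻¹ * (f t x y z * dt f t x y z)) =
      volInt Lx Ly (fun x y z => f t x y z * g t x y z) - volInt Lx Ly (gradSq f t) := by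
  have hlap := volInt_mul_lap hf hp ht
  simp only [h0, h1, zero_mul, cellInt_const, mul_zero, sub_zero, zero_sub] at hlap
  have hadv := hF.volInt_mul_advection hf.spaceC1 hp ht
  have c := hf.spaceC1.layer ht
  have e : volInt Lx Ly (fun x y z => Pr⁻¹ * (f t x y z * dt f t x y z)) =
      volInt Lx Ly (fun x y z => (f t x y z * lap f t x y z + f t x y z * g t x y z)
        - Pr⁻¹ * (f t x y z * (F.u t x y z * dx f t x y z
        + F.v t x y z * dy f t x y z + F.w t x y z * dz f t x y z))) := by
    refine volInt_congr fun x y z hz => ?_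
    have := hm x y z hz
    unfold Fields.matDeriv at this
    linear_combination f t x y z * this
  rw [e, volInt_sub ((c.mul (hf.layer_lap ht)).add (c.mul hg))
    ((c.mul (hF.layer_advection hf.spaceC1 ht)).const_mul _), volInt_const_mul, hadv,
    volInt_add (c.mul (hf.layer_lap ht)) (c.mul hg), hlap]
  ring

/-- The balance of the kinetic energy. -/
lemma volInt_velocity_mul_dt (hF : IsSolution Pr R Lx Ly η F) (ht : 0 < t) :
    volInt Lx Ly (fun x y z => Pr⁻¹ * (F.u t x y z * dt F.u t x y z
        + F.v t x y z * dt F.v t x y z + F.w t x y z * dt F.w t x y z)) =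
      R * F.convTransport Lx Ly t - (volInt Lx Ly (gradSq F.u t) + volInt Lx Ly (gradSq F.v t)
        + volInt Lx Ly (gradSq F.w t)) := by
  have cu := hF.reg_u.spaceC1.layer ht
  have cv := hF.reg_v.spaceC1.layer ht
  have cw := hF.reg_w.spaceC1.layer ht
  have cT := hF.reg_T.spaceC1.layer ht
  have cpx := hF.reg_p.layer_x ht
  have cpy := hF.reg_p.layer_y ht
  have cpz := hF.reg_p.layer_z ht
  have n0 := fun x y => hF.no_slip t ht x y 0 (by simp)
  have n1 := fun x y => hF.no_slip t ht x y 1 (by simp)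
  have eu := hF.volInt_velocity_component (g := fun t x y z => -dx F.p t x y z) hF.reg_u hF.per_u ht
    (fun x y => (n0 x y).1) (fun x y => (n1 x y).1) cpx.neg
    (fun x y z hz => by linear_combination hF.momentum_x t ht x y z hz)
  have ev := hF.volInt_velocity_component (g := fun t x y z => -dy F.p t x y z) hF.reg_v hF.per_v ht
    (fun x y => (n0 x y).2.1) (fun x y => (n1 x y).2.1) cpy.neg
    (fun x y z hz => by linear_combination hF.momentum_y t ht x y z hz)
  have ew := hF.volInt_velocity_component (g := fun t x y z => R * F.T t x y z - dz F.p t x y z)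
    hF.reg_w hF.per_w ht
    (fun x y => (n0 x y).2.2) (fun x y => (n1 x y).2.2) ((cT.const_mul R).sub cpz)
    (fun x y z hz => by linear_combination hF.momentum_z t ht x y z hz)
  -- The pressure does no work: the sum of its three contributions is the advection of `p` by the
  -- velocity.
  have ep := hF.volInt_advection hF.reg_p hF.per_p ht
  have du := (cu.mul (hF.reg_u.layer_t ht)).const_mul Pr⁻¹
  have dv := (cv.mul (hF.reg_v.layer_t ht)).const_mul Pr⁻¹
  have dw := (cw.mul (hF.reg_w.layer_t ht)).const_mul Pr⁻¹
  have s1 : volInt Lx Ly (fun x y z => Pr⁻¹ * (F.u t x y z * dt F.u t x y z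
        + F.v t x y z * dt F.v t x y z + F.w t x y z * dt F.w t x y z)) = _ :=
    (volInt_congr fun x y z _ => by ring).trans
      ((volInt_add (Lx := Lx) (Ly := Ly) (du.add dv) dw).trans
        (congrArg₂ _ (volInt_add (Lx := Lx) (Ly := Ly) du dv) rfl))
  rw [volInt_add ((cu.mul cpx).add (cv.mul cpy)) (cw.mul cpz), volInt_add (cu.mul cpx)
    (cv.mul cpy)] at ep
  have e1 : volInt Lx Ly (fun x y z => F.u t x y z * -dx F.p t x y z)
      = - volInt Lx Ly (fun x y z => F.u t x y z * dx F.p t x y z) := by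
    rw [← volInt_neg]; exact volInt_congr fun x y z _ => by ring
  have e2 : volInt Lx Ly (fun x y z => F.v t x y z * -dy F.p t x y z)
      = - volInt Lx Ly (fun x y z => F.v t x y z * dy F.p t x y z) := by
    rw [← volInt_neg]; exact volInt_congr fun x y z _ => by ring
  have e3 : volInt Lx Ly (fun x y z => F.w t x y z * (R * F.T t x y z - dz F.p t x y z))
      = R * F.convTransport Lx Ly t - volInt Lx Ly (fun x y z => F.w t x y z * dz F.p t x y z) := by
    rw [Fields.convTransport, ← volInt_const_mul,
      ← volInt_sub ((cw.mul cT).const_mul R) (cw.mul cpz)]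
    exact volInt_congr fun x y z _ => by ring
  rw [s1, eu, ev, ew, e1, e2, e3]
  linear_combination -ep

end IsSolution

/-! ### Convective transport next to a no-slip plate. -/

/-- Cauchy-Schwarz for `f z = ∫ f'`, obtained by expanding `0 ≤ ∫ (z f' - f z)²` over `[0, z]`;
afterwards `z` is enlarged to `δ`. -/
lemma sq_le_mul_integral_deriv_sq {f f' : ℝ → ℝ} {δ z : ℝ} (hz : z ∈ Icc 0 δ) (h0 : f 0 = 0)
    (hf' : ContinuousOn f' (Icc 0 δ)) (hf : ContinuousOn f (Icc 0 δ))
    (hd : ∀ s ∈ Ioo 0 δ, HasDerivAt f (f' s) s) :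
    f z ^ 2 ≤ δ * ∫ s in (0 : ℝ)..δ, f' s ^ 2 := by
  have hδ : 0 ≤ δ := hz.1.trans hz.2
  have hsub : Icc 0 z ⊆ Icc 0 δ := Icc_subset_Icc le_rfl hz.2
  have hint : IntervalIntegrable f' volume 0 z :=
    ContinuousOn.intervalIntegrable (by rw [uIcc_of_le hz.1]; exact hf'.mono hsub)
  have hint2 : ∀ {w}, w ∈ Icc 0 δ → IntervalIntegrable (fun s => f' s ^ 2) volume 0 w := fun hw =>
    ContinuousOn.intervalIntegrable (by
      rw [uIcc_of_le hw.1]; exact (hf'.mono (Icc_subset_Icc le_rfl hw.2)).pow 2)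
  have hz1 : f z = ∫ s in (0 : ℝ)..z, f' s := by
    rw [intervalIntegral.integral_eq_sub_of_hasDerivAt_of_le hz.1 (hf.mono hsub)
      (fun s hs => hd s ⟨hs.1, hs.2.trans_le hz.2⟩) hint, h0, sub_zero]
  have hmono : ∫ s in (0 : ℝ)..z, f' s ^ 2 ≤ ∫ s in (0 : ℝ)..δ, f' s ^ 2 :=
    intervalIntegral.integral_mono_interval le_rfl hz.1 hz.2 (ae_of_all _ fun s => sq_nonneg _)
      (hint2 ⟨hδ, le_rfl⟩)
  have hsq : 0 ≤ ∫ s in (0 : ℝ)..z, (z * f' s - f z) ^ 2 :=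
    intervalIntegral.integral_nonneg hz.1 fun s _ => sq_nonneg _
  have hexp : ∫ s in (0 : ℝ)..z, (z * f' s - f z) ^ 2 =
      z * (z * (∫ s in (0 : ℝ)..z, f' s ^ 2) - f z ^ 2) := by
    have : ∀ s, (z * f' s - f z) ^ 2 = z ^ 2 * f' s ^ 2 - (2 * z * f z) * f' s + f z ^ 2 := by
      intro s; ring
    simp only [this]
    rw [intervalIntegral.integral_add (((hint2 hz).const_mul _).sub (hint.const_mul _)) (by simp),
      intervalIntegral.integral_sub ((hint2 hz).const_mul _) (hint.const_mul _),
      intervalIntegral.integral_const_mul, intervalIntegral.integral_const_mul, ← hz1]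
    simp; ring
  have hI : 0 ≤ ∫ s in (0 : ℝ)..δ, f' s ^ 2 :=
    intervalIntegral.integral_nonneg hδ fun s _ => sq_nonneg _
  rcases hz.1.eq_or_lt with rfl | hpos
  · rw [h0]; simpa using mul_nonneg hδ hI
  · rw [hexp] at hsq
    have h1 := nonneg_of_mul_nonneg_right hsq hpos
    have h2 := mul_le_mul hz.2 hmono
      (intervalIntegral.integral_nonneg hz.1 fun s _ => sq_nonneg (f' s)) hδ
    linarith

/-- A velocity field in the layer at a fixed time, with the derivatives that enter the estimate
of the convective transport next to a plate, and a temperature field. -/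
structure LayerData (Lx Ly : ℝ) where
  (u v w T ux vy uz vz wz Tx Ty : ℝ → ℝ → ℝ → ℝ)
  cont_u : ContLayer u
  cont_v : ContLayer v
  cont_w : ContLayer w
  cont_T : ContLayer T
  cont_ux : ContLayer ux
  cont_vy : ContLayer vy
  cont_uz : ContLayer uz
  cont_vz : ContLayer vz
  cont_wz : ContLayer wz
  cont_Tx : ContLayer Tx
  cont_Ty : ContLayer Ty
  deriv_ux : ∀ x y, ∀ z ∈ Icc (0 : ℝ) 1, HasDerivAt (fun s => u s y z) (ux x y z) x
  deriv_vy : ∀ x y, ∀ z ∈ Icc (0 : ℝ) 1, HasDerivAt (fun s => v x s z) (vy x y z) y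
  deriv_Tx : ∀ x y, ∀ z ∈ Icc (0 : ℝ) 1, HasDerivAt (fun s => T s y z) (Tx x y z) x
  deriv_Ty : ∀ x y, ∀ z ∈ Icc (0 : ℝ) 1, HasDerivAt (fun s => T x s z) (Ty x y z) y
  deriv_uz : ∀ x y, ∀ z ∈ Icc (0 : ℝ) 1,
    HasDerivWithinAt (fun s => u x y s) (uz x y z) (Icc 0 1) z
  deriv_vz : ∀ x y, ∀ z ∈ Icc (0 : ℝ) 1,
    HasDerivWithinAt (fun s => v x y s) (vz x y z) (Icc 0 1) z
  deriv_wz : ∀ x y, ∀ z ∈ Icc (0 : ℝ) 1,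
    HasDerivWithinAt (fun s => w x y s) (wz x y z) (Icc 0 1) z
  per_u : ∀ x y, ∀ z ∈ Icc (0 : ℝ) 1, u (x + Lx) y z = u x y z
  per_v : ∀ x y, ∀ z ∈ Icc (0 : ℝ) 1, v x (y + Ly) z = v x y z
  per_Tx : ∀ x y, ∀ z ∈ Icc (0 : ℝ) 1, T (x + Lx) y z = T x y z
  per_Ty : ∀ x y, ∀ z ∈ Icc (0 : ℝ) 1, T x (y + Ly) z = T x y z
  div_free : ∀ x y, ∀ z ∈ Icc (0 : ℝ) 1, ux x y z + vy x y z + wz x y z = 0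
  u_bottom : ∀ x y, u x y 0 = 0
  v_bottom : ∀ x y, v x y 0 = 0
  w_bottom : ∀ x y, w x y 0 = 0

lemma cellInt_sq_le {Lx Ly : ℝ} (hLx : 0 ≤ Lx) (hLy : 0 ≤ Ly) {f f' : ℝ → ℝ → ℝ → ℝ}
    (hf : ContLayer f) (hf' : ContLayer f')
    (hd : ∀ x y, ∀ z ∈ Icc (0 : ℝ) 1,
      HasDerivWithinAt (fun s => f x y s) (f' x y z) (Icc 0 1) z)
    (h0 : ∀ x y, f x y 0 = 0) {δ z : ℝ} (hδ : δ ≤ 1) (hz : z ∈ Icc 0 δ) :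
    cellInt Lx Ly (fun x y => f x y z ^ 2) ≤
      δ * ∫ s in (0 : ℝ)..δ, cellInt Lx Ly fun x y => f' x y s ^ 2 := by
  have hδ0 : 0 ≤ δ := hz.1.trans hz.2
  have hsub : Icc 0 δ ⊆ Icc (0 : ℝ) 1 := Icc_subset_Icc le_rfl hδ
  have hcl : ∀ g : ℝ → ℝ, ∫ s in (0 : ℝ)..δ, g (clampUnit s) = ∫ s in (0 : ℝ)..δ, g s := by
    intro g
    refine intervalIntegral.integral_congr fun s hs => ?_
    rw [uIcc_of_le hδ0] at hs
    simp only [clampUnit_of_mem (hsub hs)]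
  have hc : Continuous fun q : ℝ × ℝ × ℝ => f' q.2.1 q.2.2 (clampUnit q.1) ^ 2 := hf'.clamp.pow 2
  rw [← hcl (fun s => cellInt Lx Ly fun x y => f' x y s ^ 2),
    integral_cellInt_swap (h := fun s x y => f' x y (clampUnit s) ^ 2) hc, ← cellInt_const_mul]
  refine cellInt_mono hLx hLy ((hf.pow 2).slice (hsub hz)) ?_ fun x y => ?_
  · refine Continuous.mul continuous_const ?_
    refine intervalIntegral.continuous_parametric_intervalIntegral_of_continuous'
      (f := fun (q : ℝ × ℝ) s => f' q.1 q.2 (clampUnit s) ^ 2) ?_ _ _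
    exact hc.comp (by fun_prop : Continuous fun r : (ℝ × ℝ) × ℝ => (r.2, r.1.1, r.1.2))
  · rw [hcl fun s => f' x y s ^ 2]
    refine sq_le_mul_integral_deriv_sq hz (h0 x y) ((hf'.vertical x y).mono hsub)
      ((hf.vertical x y).mono hsub) fun s hs => ?_
    have hs' : s ∈ Ioo (0 : ℝ) 1 := ⟨hs.1, hs.2.trans_le hδ⟩
    exact (hd x y s (Ioo_subset_Icc_self hs')).hasDerivAt (Icc_mem_nhds hs'.1 hs'.2)

namespace LayerData

variable {Lx Ly : ℝ} (S : LayerData Lx Ly)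

/-- The heart of the convective estimate: incompressibility replaces `w_z` by `-(u_x + v_y)`, and
periodicity moves the horizontal derivatives onto `T`. No vertical derivative is integrated by
parts, so the two heights may differ and no thermal boundary condition is needed. -/
lemma cellInt_wz_mul {z z' : ℝ} (hz : z ∈ Icc (0 : ℝ) 1) (hz' : z' ∈ Icc (0 : ℝ) 1) :
    cellInt Lx Ly (fun x y => S.wz x y z' * S.T x y z) =
      cellInt Lx Ly fun x y => S.u x y z' * S.Tx x y z + S.v x y z' * S.Ty x y z := by
  have s := fun {f} (hf : ContLayer f) => hf.slice hz
  have s' := fun {f} (hf : ContLayer f) => hf.slice hz'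
  have c1 : Cont2 fun x y => S.ux x y z' * S.T x y z + S.u x y z' * S.Tx x y z :=
    ((s' S.cont_ux).mul (s S.cont_T)).add ((s' S.cont_u).mul (s S.cont_Tx))
  have c2 : Cont2 fun x y => S.vy x y z' * S.T x y z + S.v x y z' * S.Ty x y z :=
    ((s' S.cont_vy).mul (s S.cont_T)).add ((s' S.cont_v).mul (s S.cont_Ty))
  have c3 : Cont2 fun x y => S.wz x y z' * S.T x y z := (s' S.cont_wz).mul (s S.cont_T)
  have e1 := cellInt_deriv_left (Lx := Lx) (Ly := Ly) c1
    (fun x y => (S.deriv_ux x y z' hz').fun_mul (S.deriv_Tx x y z hz))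
    (fun y => by simp only [S.per_u 0 y z' hz', S.per_Tx 0 y z hz])
  have e2 := cellInt_deriv_right (Lx := Lx) (Ly := Ly) c2
    (fun x y => (S.deriv_vy x y z' hz').fun_mul (S.deriv_Ty x y z hz))
    (fun x => by simp only [S.per_v x 0 z' hz', S.per_Ty x 0 z hz])
  rw [← add_zero (cellInt Lx Ly fun x y => S.wz x y z' * S.T x y z), ← e2, ← add_zero (_ + _),
    ← e1, ← cellInt_add c3 c2, ← cellInt_add (c3.add c2) c1]
  congr 1; ext x y
  linear_combination S.T x y z * S.div_free x y z' hz'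

/-- The squared horizontal temperature gradient, integrated over the cell at height `z`. -/
def gradT (z : ℝ) : ℝ := cellInt Lx Ly fun x y => S.Tx x y z ^ 2 + S.Ty x y z ^ 2

/-- The squared vertical shear, integrated over the cell at height `z`. -/
def shear (z : ℝ) : ℝ := cellInt Lx Ly fun x y => S.uz x y z ^ 2 + S.vz x y z ^ 2

lemma continuousOn_gradT : ContinuousOn S.gradT (Icc 0 1) :=
  ((S.cont_Tx.pow 2).add (S.cont_Ty.pow 2)).cellInt

lemma continuousOn_shear : ContinuousOn S.shear (Icc 0 1) :=
  ((S.cont_uz.pow 2).add (S.cont_vz.pow 2)).cellInt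

lemma cellInt_velocity_sq_le (hLx : 0 ≤ Lx) (hLy : 0 ≤ Ly) {δ z : ℝ} (hδ : δ ≤ 1)
    (hz : z ∈ Icc 0 δ) :
    cellInt Lx Ly (fun x y => S.u x y z ^ 2 + S.v x y z ^ 2) ≤
      δ * ∫ s in (0 : ℝ)..δ, S.shear s := by
  have hδm : δ ∈ Icc (0 : ℝ) 1 := ⟨hz.1.trans hz.2, hδ⟩
  have hzm : z ∈ Icc (0 : ℝ) 1 := ⟨hz.1, hz.2.trans hδ⟩
  have h1 := cellInt_sq_le hLx hLy S.cont_u S.cont_uz S.deriv_uz S.u_bottom hδ hz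
  have h2 := cellInt_sq_le hLx hLy S.cont_v S.cont_vz S.deriv_vz S.v_bottom hδ hz
  rw [cellInt_add ((S.cont_u.pow 2).slice hzm) ((S.cont_v.pow 2).slice hzm)]
  have : ∫ s in (0 : ℝ)..δ, S.shear s =
      (∫ s in (0 : ℝ)..δ, cellInt Lx Ly fun x y => S.uz x y s ^ 2) +
      ∫ s in (0 : ℝ)..δ, cellInt Lx Ly fun x y => S.vz x y s ^ 2 := by
    rw [← intervalIntegral.integral_add
      (intervalIntegrable_of_continuousOn_unit (S.cont_uz.pow 2).cellInt (by simp) hδm)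
      (intervalIntegrable_of_continuousOn_unit (S.cont_vz.pow 2).cellInt (by simp) hδm)]
    refine intervalIntegral.integral_congr fun s hs => ?_
    rw [uIcc_of_le hδm.1] at hs
    have hs' : s ∈ Icc (0 : ℝ) 1 := ⟨hs.1, hs.2.trans hδ⟩
    exact cellInt_add ((S.cont_uz.pow 2).slice hs') ((S.cont_vz.pow 2).slice hs')
  rw [this]
  linarith

/-- Here `w` is the integral of `w_z` from the plate up to `z`, while `T` stays frozen at height
`z`. Each slice is rewritten by `cellInt_wz_mul` and split by Young's inequality with a free weight
`ε`; no-slip turns the velocity into shear at the price of one more factor `δ`. -/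
lemma cellInt_w_mul_T_le (hLx : 0 ≤ Lx) (hLy : 0 ≤ Ly) {δ ε z : ℝ} (hδ : δ ≤ 1) (hε : 0 < ε)
    (hz : z ∈ Icc 0 δ) :
    cellInt Lx Ly (fun x y => S.w x y z * S.T x y z) ≤
      δ * (ε / 2) * S.gradT z + δ ^ 2 / (2 * ε) * ∫ s in (0 : ℝ)..δ, S.shear s := by
  have hδ0 : 0 ≤ δ := hz.1.trans hz.2
  have hzm : z ∈ Icc (0 : ℝ) 1 := ⟨hz.1, hz.2.trans hδ⟩
  have hTz : ContLayer fun x y (_ : ℝ) => S.T x y z :=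
    (Continuous.comp (g := fun q : ℝ × ℝ => S.T q.1 q.2 z) (S.cont_T.slice hzm)
      (by fun_prop : Continuous fun q : ℝ × ℝ × ℝ => (q.1, q.2.1))).continuousOn
  have key := integral_cellInt_deriv (Lx := Lx) (Ly := Ly) (S.cont_w.mul hTz) (S.cont_wz.mul hTz)
    (fun x y s hs => (S.deriv_wz x y s hs).mul_const (S.T x y z)) (a := 0) (b := z) (by simp) hzm
    hz.1
  simp only [S.w_bottom, zero_mul, cellInt_const, mul_zero, sub_zero] at key
  rw [← key]
  set Y := ∫ s in (0 : ℝ)..δ, S.shear s with hY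
  have hY0 : 0 ≤ Y := intervalIntegral.integral_nonneg hδ0 fun s _ =>
    cellInt_nonneg hLx hLy fun x y => by positivity
  have hG0 : 0 ≤ S.gradT z := cellInt_nonneg hLx hLy fun x y => by positivity
  have bound : ∀ s ∈ Icc 0 z, cellInt Lx Ly (fun x y => S.wz x y s * S.T x y z) ≤
      ε / 2 * S.gradT z + δ / (2 * ε) * Y := by
    intro s hs
    have hsm : s ∈ Icc (0 : ℝ) 1 := ⟨hs.1, hs.2.trans hzm.2⟩
    have hv := S.cellInt_velocity_sq_le hLx hLy hδ (z := s) ⟨hs.1, hs.2.trans hz.2⟩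
    rw [S.cellInt_wz_mul hzm hsm]
    have c1 : Cont2 fun x y => S.Tx x y z ^ 2 + S.Ty x y z ^ 2 :=
      ((S.cont_Tx.pow 2).add (S.cont_Ty.pow 2)).slice hzm
    have c2 : Cont2 fun x y => S.u x y s ^ 2 + S.v x y s ^ 2 :=
      ((S.cont_u.pow 2).add (S.cont_v.pow 2)).slice hsm
    calc _ ≤ cellInt Lx Ly (fun x y => ε / 2 * (S.Tx x y z ^ 2 + S.Ty x y z ^ 2)
          + 1 / (2 * ε) * (S.u x y s ^ 2 + S.v x y s ^ 2)) := by
          refine cellInt_mono hLx hLy ?_ ((c1.const_mul _).add (c2.const_mul _))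
            fun x y => ?_
          · exact ((S.cont_u.slice hsm).mul (S.cont_Tx.slice hzm)).add
              ((S.cont_v.slice hsm).mul (S.cont_Ty.slice hzm))
          · have : ε / 2 * (S.Tx x y z ^ 2 + S.Ty x y z ^ 2)
                + 1 / (2 * ε) * (S.u x y s ^ 2 + S.v x y s ^ 2)
                - (S.u x y s * S.Tx x y z + S.v x y s * S.Ty x y z) =
                1 / (2 * ε) * ((ε * S.Tx x y z - S.u x y s) ^ 2
                  + (ε * S.Ty x y z - S.v x y s) ^ 2) := by
              field_simp; ring
            have h2 : 0 ≤ 1 / (2 * ε) * ((ε * S.Tx x y z - S.u x y s) ^ 2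
                  + (ε * S.Ty x y z - S.v x y s) ^ 2) := by positivity
            linarith
      _ = ε / 2 * S.gradT z
          + 1 / (2 * ε) * cellInt Lx Ly (fun x y => S.u x y s ^ 2 + S.v x y s ^ 2) := by
          rw [cellInt_add (c1.const_mul _) (c2.const_mul _), cellInt_const_mul,
            cellInt_const_mul, gradT]
      _ ≤ ε / 2 * S.gradT z + 1 / (2 * ε) * (δ * Y) := by gcongr
      _ = _ := by ring
  calc _ ≤ ∫ _ in (0 : ℝ)..z, (ε / 2 * S.gradT z + δ / (2 * ε) * Y) :=
        intervalIntegral.integral_mono_on hz.1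
          (intervalIntegrable_of_continuousOn_unit (S.cont_wz.mul hTz).cellInt (by simp) hzm)
          (by simp) bound
    _ = z * (ε / 2 * S.gradT z + δ / (2 * ε) * Y) := by simp; ring
    _ ≤ δ * (ε / 2 * S.gradT z + δ / (2 * ε) * Y) := by
        have := hz.2
        gcongr
    _ = _ := by ring

/-- The convective transport next to a no-slip plate is controlled by the horizontal temperature
gradient and the vertical shear. -/
lemma integral_w_mul_T_le (hLx : 0 ≤ Lx) (hLy : 0 ≤ Ly) {δ ε : ℝ} (hδ0 : 0 ≤ δ) (hδ : δ ≤ 1)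
    (hε : 0 < ε) :
    ∫ z in (0 : ℝ)..δ, cellInt Lx Ly (fun x y => S.w x y z * S.T x y z) ≤
      δ * (ε / 2) * (∫ z in (0 : ℝ)..δ, S.gradT z)
        + δ ^ 3 / (2 * ε) * ∫ s in (0 : ℝ)..δ, S.shear s := by
  have hδm : δ ∈ Icc (0 : ℝ) 1 := ⟨hδ0, hδ⟩
  have hi : IntervalIntegrable (fun z => δ * (ε / 2) * S.gradT z) volume 0 δ :=
    (intervalIntegrable_of_continuousOn_unit S.continuousOn_gradT (by simp) hδm).const_mul _
  calc _ ≤ ∫ z in (0 : ℝ)..δ, (δ * (ε / 2) * S.gradT z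
        + δ ^ 2 / (2 * ε) * ∫ s in (0 : ℝ)..δ, S.shear s) :=
        intervalIntegral.integral_mono_on hδ0
          (intervalIntegrable_of_continuousOn_unit (S.cont_w.mul S.cont_T).cellInt (by simp) hδm)
          (hi.add (by simp)) fun z hz => S.cellInt_w_mul_T_le hLx hLy hδ hε hz
    _ = _ := by
        rw [intervalIntegral.integral_add hi (by simp), intervalIntegral.integral_const_mul]
        simp only [intervalIntegral.integral_const, sub_zero, smul_eq_mul]
        ring

end LayerData

/-! ### Reflection in the midplane, and the two plates as instances of one situation. -/

lemma one_sub_mem {z : ℝ} (hz : z ∈ Icc (0 : ℝ) 1) : 1 - z ∈ Icc (0 : ℝ) 1 :=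
  ⟨by linarith [hz.2], by linarith [hz.1]⟩

lemma ContLayer.reflect {f : ℝ → ℝ → ℝ → ℝ} (hf : ContLayer f) :
    ContLayer fun x y z => f x y (1 - z) :=
  ContinuousOn.comp (t := (univ : Set ℝ) ×ˢ (univ : Set ℝ) ×ˢ Icc (0 : ℝ) 1)
    (f := fun q : ℝ × ℝ × ℝ => (q.1, q.2.1, 1 - q.2.2)) hf (by fun_prop)
    fun _ hq => ⟨mem_univ _, mem_univ _, one_sub_mem hq.2.2⟩

lemma hasDerivWithinAt_reflect {f : ℝ → ℝ} {f' z : ℝ}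
    (hf : HasDerivWithinAt f f' (Icc 0 1) (1 - z)) :
    HasDerivWithinAt (fun s => f (1 - s)) (-f') (Icc 0 1) z := by
  have h1 : HasDerivWithinAt (fun s : ℝ => 1 - s) (-1) (Icc 0 1) z :=
    (hasDerivWithinAt_id z _).const_sub 1
  have := HasDerivWithinAt.comp (h₂ := f) (h := fun s : ℝ => 1 - s) z hf h1
    fun s hs => one_sub_mem hs
  exact this.congr_deriv (by ring)

namespace IsSolution

variable {Pr R Lx Ly : ℝ} {η : ℝ≥0∞} {F : Fields} {t : ℝ}

/-- The solution at a fixed time, seen from the bottom plate. -/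
def bottomData (hF : IsSolution Pr R Lx Ly η F) (ht : 0 < t) : LayerData Lx Ly where
  u := F.u t
  v := F.v t
  w := F.w t
  T := F.T t
  ux := dx F.u t
  vy := dy F.v t
  uz := dz F.u t
  vz := dz F.v t
  wz := dz F.w t
  Tx := dx F.T t
  Ty := dy F.T t
  cont_u := hF.reg_u.spaceC1.layer ht
  cont_v := hF.reg_v.spaceC1.layer ht
  cont_w := hF.reg_w.spaceC1.layer ht
  cont_T := hF.reg_T.spaceC1.layer ht
  cont_ux := hF.reg_u.spaceC1.layer_x ht
  cont_vy := hF.reg_v.spaceC1.layer_y ht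
  cont_uz := hF.reg_u.spaceC1.layer_z ht
  cont_vz := hF.reg_v.spaceC1.layer_z ht
  cont_wz := hF.reg_w.spaceC1.layer_z ht
  cont_Tx := hF.reg_T.spaceC1.layer_x ht
  cont_Ty := hF.reg_T.spaceC1.layer_y ht
  deriv_ux := fun x y _ hz => hF.reg_u.spaceC1.hasDerivAt_x ht x y hz
  deriv_vy := fun x y _ hz => hF.reg_v.spaceC1.hasDerivAt_y ht x y hz
  deriv_Tx := fun x y _ hz => hF.reg_T.spaceC1.hasDerivAt_x ht x y hz
  deriv_Ty := fun x y _ hz => hF.reg_T.spaceC1.hasDerivAt_y ht x y hz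
  deriv_uz := fun x y _ hz => hF.reg_u.spaceC1.hasDerivWithinAt_z ht x y hz
  deriv_vz := fun x y _ hz => hF.reg_v.spaceC1.hasDerivWithinAt_z ht x y hz
  deriv_wz := fun x y _ hz => hF.reg_w.spaceC1.hasDerivWithinAt_z ht x y hz
  per_u := fun x y z hz => (hF.per_u t ht x y z hz).1
  per_v := fun x y z hz => (hF.per_v t ht x y z hz).2
  per_Tx := fun x y z hz => (hF.per_T t ht x y z hz).1
  per_Ty := fun x y z hz => (hF.per_T t ht x y z hz).2
  div_free := fun x y z hz => hF.incompressible t ht x y z hz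
  u_bottom := fun x y => (hF.no_slip t ht x y 0 (by simp)).1
  v_bottom := fun x y => (hF.no_slip t ht x y 0 (by simp)).2.1
  w_bottom := fun x y => (hF.no_slip t ht x y 0 (by simp)).2.2

/-- The solution at a fixed time, seen from the top plate. -/
def topData (hF : IsSolution Pr R Lx Ly η F) (ht : 0 < t) : LayerData Lx Ly where
  u := fun x y z => F.u t x y (1 - z)
  v := fun x y z => F.v t x y (1 - z)
  -- Under `z ↦ 1 - z` the sign of `w` must flip to keep the velocity divergence-free; flipping `T`
  -- as well leaves the product `w T` unchanged.
  w := fun x y z => -F.w t x y (1 - z)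
  T := fun x y z => -F.T t x y (1 - z)
  ux := fun x y z => dx F.u t x y (1 - z)
  vy := fun x y z => dy F.v t x y (1 - z)
  uz := fun x y z => -dz F.u t x y (1 - z)
  vz := fun x y z => -dz F.v t x y (1 - z)
  wz := fun x y z => - -dz F.w t x y (1 - z)
  Tx := fun x y z => -dx F.T t x y (1 - z)
  Ty := fun x y z => -dy F.T t x y (1 - z)
  cont_u := (hF.reg_u.spaceC1.layer ht).reflect
  cont_v := (hF.reg_v.spaceC1.layer ht).reflect
  cont_w := (hF.reg_w.spaceC1.layer ht).reflect.neg
  cont_T := (hF.reg_T.spaceC1.layer ht).reflect.neg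
  cont_ux := (hF.reg_u.spaceC1.layer_x ht).reflect
  cont_vy := (hF.reg_v.spaceC1.layer_y ht).reflect
  cont_uz := (hF.reg_u.spaceC1.layer_z ht).reflect.neg
  cont_vz := (hF.reg_v.spaceC1.layer_z ht).reflect.neg
  cont_wz := (hF.reg_w.spaceC1.layer_z ht).reflect.neg.neg
  cont_Tx := (hF.reg_T.spaceC1.layer_x ht).reflect.neg
  cont_Ty := (hF.reg_T.spaceC1.layer_y ht).reflect.neg
  deriv_ux := fun x y _ hz => hF.reg_u.spaceC1.hasDerivAt_x ht x y (one_sub_mem hz)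
  deriv_vy := fun x y _ hz => hF.reg_v.spaceC1.hasDerivAt_y ht x y (one_sub_mem hz)
  deriv_Tx := fun x y _ hz => (hF.reg_T.spaceC1.hasDerivAt_x ht x y (one_sub_mem hz)).fun_neg
  deriv_Ty := fun x y _ hz => (hF.reg_T.spaceC1.hasDerivAt_y ht x y (one_sub_mem hz)).fun_neg
  deriv_uz := fun x y _ hz =>
    hasDerivWithinAt_reflect (hF.reg_u.spaceC1.hasDerivWithinAt_z ht x y (one_sub_mem hz))
  deriv_vz := fun x y _ hz =>
    hasDerivWithinAt_reflect (hF.reg_v.spaceC1.hasDerivWithinAt_z ht x y (one_sub_mem hz))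
  deriv_wz := fun x y _ hz =>
    (hasDerivWithinAt_reflect
      (hF.reg_w.spaceC1.hasDerivWithinAt_z ht x y (one_sub_mem hz))).fun_neg
  per_u := fun x y z hz => (hF.per_u t ht x y _ (one_sub_mem hz)).1
  per_v := fun x y z hz => (hF.per_v t ht x y _ (one_sub_mem hz)).2
  per_Tx := fun x y z hz => by rw [(hF.per_T t ht x y _ (one_sub_mem hz)).1]
  per_Ty := fun x y z hz => by rw [(hF.per_T t ht x y _ (one_sub_mem hz)).2]
  div_free := fun x y z hz => by
    rw [neg_neg]; exact hF.incompressible t ht x y _ (one_sub_mem hz)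
  u_bottom := fun x y => by rw [sub_zero]; exact (hF.no_slip t ht x y 1 (by simp)).1
  v_bottom := fun x y => by rw [sub_zero]; exact (hF.no_slip t ht x y 1 (by simp)).2.1
  w_bottom := fun x y => by rw [sub_zero, (hF.no_slip t ht x y 1 (by simp)).2.2, neg_zero]

end IsSolution

/-! ### The background profile and one-dimensional integration by parts. -/

/-- The piecewise linear background profile: slope `-σ` in the layers of width `δ` next to the
plates, constant in between. -/
def profile (σ δ z : ℝ) : ℝ := 1 / 2 + σ * max (δ - z) 0 - σ * max (z - (1 - δ)) 0

lemma continuous_profile (σ δ : ℝ) : Continuous (profile σ δ) := by unfold profile; fun_prop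

section OneDim

variable {h H : ℝ → ℝ}

/-- Integration by parts where `H' = h` is given only in integrated form; the fundamental theorem of
calculus restores the derivative at interior points. -/
lemma integral_linear_mul (hh : ContinuousOn h (Icc 0 1)) (hH : ContinuousOn H (Icc 0 1))
    (hd : ∀ a ∈ Icc (0 : ℝ) 1, ∀ b ∈ Icc (0 : ℝ) 1, a ≤ b → ∫ z in a..b, h z = H b - H a)
    (p q : ℝ) {a b : ℝ} (ha : a ∈ Icc (0 : ℝ) 1) (hb : b ∈ Icc (0 : ℝ) 1) (hab : a ≤ b) :
    ∫ z in a..b, (p + q * z) * h z =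
      (p + q * b) * H b - (p + q * a) * H a - q * ∫ z in a..b, H z := by
  have hsub : Icc a b ⊆ Icc 0 1 := Icc_subset_Icc ha.1 hb.2
  rw [← intervalIntegral.integral_const_mul]
  refine intervalIntegral.integral_mul_deriv_eq_deriv_mul_of_hasDerivAt
    (u := fun z => p + q * z) (u' := fun _ => q) (v := H) (v' := h) (by fun_prop)
    (by rw [uIcc_of_le hab]; exact hH.mono hsub) (fun z _ => ?_) (fun z hz => ?_) (by simp)
    (intervalIntegrable_of_continuousOn_unit hh ha hb)
  · simpa using ((hasDerivAt_id z).const_mul q).const_add p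
  · rw [min_eq_left hab, max_eq_right hab] at hz
    have hz0 : z ∈ Ioo (0 : ℝ) 1 := ⟨ha.1.trans_lt hz.1, hz.2.trans_le hb.2⟩
    have hnhds : Icc (0 : ℝ) 1 ∈ 𝓝 z := Icc_mem_nhds hz0.1 hz0.2
    have h1 : HasDerivAt (fun s => ∫ x in (0 : ℝ)..s, h x) (h z) z :=
      intervalIntegral.integral_hasDerivAt_right
        (intervalIntegrable_of_continuousOn_unit hh (by simp) (Ioo_subset_Icc_self hz0))
        (hh.stronglyMeasurableAtFilter_nhdsWithin measurableSet_Icc z |>.filter_mono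
          (nhdsWithin_eq_nhds.2 hnhds).ge) (hh.continuousAt hnhds)
    refine (h1.const_add (H 0)).congr_of_eventuallyEq ?_
    filter_upwards [hnhds] with s hs
    rw [hd 0 (by simp) s hs hs.1]; ring

/-- The profile is linear on three pieces and flat on the middle one, so after integration by parts
`H` survives only at the plates and in the two layers. -/
lemma integral_profile_mul (hh : ContinuousOn h (Icc 0 1)) (hH : ContinuousOn H (Icc 0 1))
    (hd : ∀ a ∈ Icc (0 : ℝ) 1, ∀ b ∈ Icc (0 : ℝ) 1, a ≤ b → ∫ z in a..b, h z = H b - H a)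
    (σ : ℝ) {δ : ℝ} (hδ0 : 0 ≤ δ) (hδ : δ ≤ 1 / 2) :
    ∫ z in (0 : ℝ)..1, profile σ δ z * h z =
      (1 / 2 - σ * δ) * H 1 - (1 / 2 + σ * δ) * H 0
        + σ * ((∫ z in (0 : ℝ)..δ, H z) + ∫ z in (1 - δ)..1, H z) := by
  have m0 : (0 : ℝ) ∈ Icc (0 : ℝ) 1 := by simp
  have m1 : (1 : ℝ) ∈ Icc (0 : ℝ) 1 := by simp
  have md : δ ∈ Icc (0 : ℝ) 1 := ⟨hδ0, by linarith⟩
  have md' : 1 - δ ∈ Icc (0 : ℝ) 1 := one_sub_mem md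
  have hi : ∀ a ∈ Icc (0 : ℝ) 1, ∀ b ∈ Icc (0 : ℝ) 1,
      IntervalIntegrable (fun z => profile σ δ z * h z) volume a b := fun a ha b hb =>
    intervalIntegrable_of_continuousOn_unit ((continuous_profile σ δ).continuousOn.mul hh) ha hb
  have piece : ∀ a ∈ Icc (0 : ℝ) 1, ∀ b ∈ Icc (0 : ℝ) 1, a ≤ b → ∀ p q : ℝ,
      (∀ z ∈ Icc a b, profile σ δ z = p + q * z) → ∫ z in a..b, profile σ δ z * h z =
      (p + q * b) * H b - (p + q * a) * H a - q * ∫ z in a..b, H z := by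
    intro a ha b hb hab p q hpq
    rw [← integral_linear_mul hh hH hd p q ha hb hab]
    refine intervalIntegral.integral_congr fun z hz => ?_
    rw [uIcc_of_le hab] at hz
    simp only [hpq z hz]
  rw [← intervalIntegral.integral_add_adjacent_intervals (hi 0 m0 δ md) (hi δ md 1 m1),
    ← intervalIntegral.integral_add_adjacent_intervals (hi δ md _ md') (hi _ md' 1 m1),
    piece 0 m0 δ md hδ0 (1 / 2 + σ * δ) (-σ) (fun z hz => ?_),
    piece δ md _ md' (by linarith) (1 / 2) 0 (fun z hz => ?_),
    piece _ md' 1 m1 md'.2 (1 / 2 + σ * (1 - δ)) (-σ) (fun z hz => ?_)]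
  · ring
  · rw [profile, max_eq_right (by linarith [hz.1]), max_eq_left (by linarith [hz.1])]; ring
  · rw [profile, max_eq_right (by linarith [hz.1]), max_eq_right (by linarith [hz.2])]; ring
  · rw [profile, max_eq_left (by linarith [hz.2]), max_eq_right (by linarith [hz.2])]; ring

lemma integral_layers_le (hh : ContinuousOn h (Icc 0 1)) (h0 : ∀ z, 0 ≤ h z)
    {δ : ℝ} (hδ0 : 0 ≤ δ) (hδ : δ ≤ 1 / 2) :
    (∫ z in (0 : ℝ)..δ, h z) + ∫ z in (1 - δ)..1, h z ≤ ∫ z in (0 : ℝ)..1, h z := by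
  have m0 : (0 : ℝ) ∈ Icc (0 : ℝ) 1 := by simp
  have m1 : (1 : ℝ) ∈ Icc (0 : ℝ) 1 := by simp
  have md : δ ∈ Icc (0 : ℝ) 1 := ⟨hδ0, by linarith⟩
  have md' : 1 - δ ∈ Icc (0 : ℝ) 1 := one_sub_mem md
  have hi : ∀ a ∈ Icc (0 : ℝ) 1, ∀ b ∈ Icc (0 : ℝ) 1, IntervalIntegrable h volume a b :=
    fun a ha b hb => intervalIntegrable_of_continuousOn_unit hh ha hb
  rw [← intervalIntegral.integral_add_adjacent_intervals (hi 0 m0 δ md) (hi δ md 1 m1),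
    ← intervalIntegral.integral_add_adjacent_intervals (hi δ md _ md') (hi _ md' 1 m1)]
  have : 0 ≤ ∫ z in δ..(1 - δ), h z :=
    intervalIntegral.integral_nonneg (by linarith) fun z _ => h0 z
  linarith

end OneDim

/-! ### The background estimate at a fixed time. -/

namespace Fields

/-- The mean over the two plates of the conductive heat flux through a cell. -/
def plateFlux (F : Fields) (Lx Ly t : ℝ) : ℝ :=
  -(cellInt Lx Ly (fun x y => dz F.T t x y 0) + cellInt Lx Ly (fun x y => dz F.T t x y 1)) / 2

end Fields

namespace IsSolution

variable {Pr R Lx Ly : ℝ} {η : ℝ≥0∞} {F : Fields} {t : ℝ}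

lemma condTransport_eq (hF : IsSolution Pr R Lx Ly η F) (hLx : 0 < Lx) (hLy : 0 < Ly)
    (ht : 0 < t) : F.condTransport Lx Ly t = Lx * Ly * F.drop Lx Ly t := by
  have hT := hF.reg_T.spaceC1
  rw [Fields.condTransport, volInt_neg, volInt_eq, integral_cellInt_deriv (hT.layer ht)
    (hT.layer_z ht) (fun x y z hz => hT.hasDerivWithinAt_z ht x y hz) (by simp) (by simp)
    zero_le_one]
  change _ = Lx * Ly * (1 / (Lx * Ly) * cellInt Lx Ly (fun x y => F.T t x y 0)
    - 1 / (Lx * Ly) * cellInt Lx Ly (fun x y => F.T t x y 1))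
  field_simp
  ring

lemma fluxAt_zero (hF : IsSolution Pr R Lx Ly η F) (ht : 0 < t) :
    F.fluxAt Lx Ly t 0 = cellInt Lx Ly (fun x y => dz F.T t x y 0) := by
  simp [Fields.fluxAt, (hF.no_slip t ht _ _ 0 (by simp)).2.2, cellInt_const]

lemma fluxAt_one (hF : IsSolution Pr R Lx Ly η F) (ht : 0 < t) :
    F.fluxAt Lx Ly t 1 = cellInt Lx Ly (fun x y => dz F.T t x y 1) := by
  simp [Fields.fluxAt, (hF.no_slip t ht _ _ 1 (by simp)).2.2, cellInt_const]

lemma continuousOn_fluxAt (hF : IsSolution Pr R Lx Ly η F) (ht : 0 < t) :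
    ContinuousOn (F.fluxAt Lx Ly t) (Icc 0 1) :=
  (hF.reg_T.spaceC1.layer_z ht).cellInt.sub
    ((hF.reg_w.spaceC1.layer ht).mul (hF.reg_T.spaceC1.layer ht)).cellInt

/-- The heat equation tested with `z - 1/2`. It gives the total transport and the plate flux the
same long-time mean, provided the first moment of the temperature grows sublinearly. -/
lemma volInt_sub_half_mul_dt (hF : IsSolution Pr R Lx Ly η F) (ht : 0 < t) :
    volInt Lx Ly (fun x y z => (z - 1 / 2) * dt F.T t x y z) =
      F.totalTransport Lx Ly t - F.plateFlux Lx Ly t := by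
  have key := integral_linear_mul (hF.reg_T.layer_t ht).cellInt
    (hF.continuousOn_fluxAt (Lx := Lx) (Ly := Ly) ht)
    (fun a ha b hb hab => hF.integral_dt_T ht ha hb hab) (-1 / 2) 1 (a := 0) (b := 1)
    (by simp) (by simp) zero_le_one
  have e : volInt Lx Ly (fun x y z => (z - 1 / 2) * dt F.T t x y z) =
      ∫ z in (0 : ℝ)..1, (-1 / 2 + 1 * z) * cellInt Lx Ly (fun x y => dt F.T t x y z) := by
    rw [volInt_eq]
    refine intervalIntegral.integral_congr fun z _ => ?_
    simp only [cellInt_const_mul]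
    ring
  have e2 : ∫ z in (0 : ℝ)..1, F.fluxAt Lx Ly t z = -F.totalTransport Lx Ly t := by
    unfold Fields.fluxAt
    rw [intervalIntegral.integral_sub (hF.reg_T.spaceC1.layer_z ht).integrable
      ((hF.reg_w.spaceC1.layer ht).mul (hF.reg_T.spaceC1.layer ht)).integrable,
      Fields.totalTransport, Fields.condTransport, volInt_neg, Fields.convTransport]
    simp only [volInt_eq]
    ring
  rw [e, key, e2, hF.fluxAt_zero ht, hF.fluxAt_one ht, Fields.plateFlux]
  ring

lemma volInt_profile_mul_dt (hF : IsSolution Pr R Lx Ly η F) (ht : 0 < t) (σ : ℝ) {δ : ℝ}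
    (hδ0 : 0 ≤ δ) (hδ : δ ≤ 1 / 2) :
    volInt Lx Ly (fun x y z => profile σ δ z * dt F.T t x y z) =
      (1 / 2 - σ * δ) * cellInt Lx Ly (fun x y => dz F.T t x y 1)
        - (1 / 2 + σ * δ) * cellInt Lx Ly (fun x y => dz F.T t x y 0)
        + σ * ((∫ z in (0 : ℝ)..δ, F.fluxAt Lx Ly t z)
          + ∫ z in (1 - δ)..1, F.fluxAt Lx Ly t z) := by
  rw [← hF.fluxAt_zero ht, ← hF.fluxAt_one ht, ← integral_profile_mul
    (hF.reg_T.layer_t ht).cellInt (hF.continuousOn_fluxAt ht)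
    (fun a ha b hb hab => hF.integral_dt_T ht ha hb hab) σ hδ0 hδ, volInt_eq]
  exact intervalIntegral.integral_congr fun z _ => cellInt_const_mul _ _

lemma drop_eq (hF : IsSolution Pr R Lx Ly η F) (hLx : 0 < Lx) (hLy : 0 < Ly) (hη : η ≠ ⊤)
    (ht : 0 < t) : Lx * Ly * F.drop Lx Ly t =
      Lx * Ly * (1 + 2 * η.toReal) - 2 * η.toReal * F.plateFlux Lx Ly t := by
  have hb := hF.thermal t ht
  simp only [if_neg hη] at hb
  have c0 := (hF.reg_T.spaceC1.layer_z ht).slice (z := 0) (by simp)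
  have c1 := (hF.reg_T.spaceC1.layer_z ht).slice (z := 1) (by simp)
  have e0 : cellInt Lx Ly (fun x y => F.T t x y 0) =
      Lx * Ly * (1 + η.toReal) + η.toReal * cellInt Lx Ly (fun x y => dz F.T t x y 0) := by
    rw [← cellInt_const, ← cellInt_const_mul, ← cellInt_add (cont2_const _) (c0.const_mul _)]
    congr 1; ext x y; linear_combination (hb x y).1
  have e1 : cellInt Lx Ly (fun x y => F.T t x y 1) =
      Lx * Ly * (-η.toReal) + (-η.toReal) * cellInt Lx Ly (fun x y => dz F.T t x y 1) := by
    rw [← cellInt_const, ← cellInt_const_mul, ← cellInt_add (cont2_const _) (c1.const_mul _)]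
    congr 1; ext x y; linear_combination (hb x y).2
  change Lx * Ly * (1 / (Lx * Ly) * cellInt Lx Ly (fun x y => F.T t x y 0)
    - 1 / (Lx * Ly) * cellInt Lx Ly (fun x y => F.T t x y 1)) = _
  rw [e0, e1, Fields.plateFlux]
  field_simp
  ring

lemma plateFlux_eq (hF : IsSolution Pr R Lx Ly η F) (hη : η = ⊤) (ht : 0 < t) :
    F.plateFlux Lx Ly t = Lx * Ly := by
  have hb := hF.thermal t ht
  simp only [if_pos hη] at hb
  simp only [Fields.plateFlux, (hb _ _).1, (hb _ _).2, cellInt_const]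
  ring

/-- The boundary terms of the background method. -/
lemma boundary_le (hF : IsSolution Pr R Lx Ly η F) (hLx : 0 < Lx) (hLy : 0 < Ly)
    {m d : ℝ} (hm : η = ⊤ → m = 1) (hd : η ≠ ⊤ → d = 1 + 2 * η.toReal - 2 * η.toReal * m)
    (s : ℝ) (ht : 0 < t) :
    cellInt Lx Ly (fun x y => F.T t x y 1 * dz F.T t x y 1)
      - cellInt Lx Ly (fun x y => F.T t x y 0 * dz F.T t x y 0)
      - (1 / 2 - s) * cellInt Lx Ly (fun x y => dz F.T t x y 1)
      + (1 / 2 + s) * cellInt Lx Ly (fun x y => dz F.T t x y 0) ≤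
    m * (Lx * Ly * F.drop Lx Ly t) - 2 * s * F.plateFlux Lx Ly t
      + d * (F.plateFlux Lx Ly t - m * (Lx * Ly)) := by
  by_cases hη : η = ⊤
  · have hb := hF.thermal t ht
    simp only [if_pos hη] at hb
    -- For fixed flux the last term of the bound vanishes, whatever `d` is.
    rw [hF.plateFlux_eq hη ht, hm hη]
    have hD : Lx * Ly * F.drop Lx Ly t = cellInt Lx Ly (fun x y => F.T t x y 0)
        - cellInt Lx Ly (fun x y => F.T t x y 1) := by
      change Lx * Ly * (1 / (Lx * Ly) * cellInt Lx Ly (fun x y => F.T t x y 0)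
        - 1 / (Lx * Ly) * cellInt Lx Ly (fun x y => F.T t x y 1)) = _
      field_simp
    rw [hD]
    simp only [(hb _ _).1, (hb _ _).2, cellInt_const, mul_neg, mul_one, cellInt_neg]
    linarith
  · have hb := hF.thermal t ht
    simp only [if_neg hη] at hb
    rw [hF.drop_eq hLx hLy hη ht, hd hη]
    set e := η.toReal
    have he : 0 ≤ e := ENNReal.toReal_nonneg
    have cT := hF.reg_T.spaceC1.layer ht
    have cz := hF.reg_T.spaceC1.layer_z ht
    have c0 := cz.slice (z := 0) (by simp)
    have c1 := cz.slice (z := 1) (by simp)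
    -- By the Robin condition the plate term is a concave quadratic in `q = T_z`; `-q² ≤ 2 m q + m²`
    -- replaces it by its tangent at `q = -m`. The number `d` is the drop that the Robin conditions
    -- pair with the flux `m`.
    have b1 : cellInt Lx Ly (fun x y => F.T t x y 1 * dz F.T t x y 1) ≤
        (-e + 2 * e * m) * cellInt Lx Ly (fun x y => dz F.T t x y 1) + Lx * Ly * (e * m ^ 2) := by
      rw [← cellInt_const (e * m ^ 2), ← cellInt_const_mul, ← cellInt_add (c1.const_mul _) (cont2_const _)]
      refine cellInt_mono hLx.le hLy.le ((cT.mul cz).slice (by simp))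
        ((c1.const_mul _).add (cont2_const _)) fun x y => ?_
      have h1 : F.T t x y 1 = -e - e * dz F.T t x y 1 := by linarith [(hb x y).2]
      have h2 := mul_nonneg he (sq_nonneg (dz F.T t x y 1 + m))
      rw [h1]; linarith
    have b0 : -cellInt Lx Ly (fun x y => F.T t x y 0 * dz F.T t x y 0) ≤
        (-(1 + e) + 2 * e * m) * cellInt Lx Ly (fun x y => dz F.T t x y 0)
          + Lx * Ly * (e * m ^ 2) := by
      rw [← cellInt_const (e * m ^ 2), ← cellInt_const_mul, ← cellInt_add (c0.const_mul _) (cont2_const _),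
        ← cellInt_neg]
      refine cellInt_mono hLx.le hLy.le ((cT.mul cz).neg.slice (by simp))
        ((c0.const_mul _).add (cont2_const _)) fun x y => ?_
      have h1 : F.T t x y 0 = 1 + e + e * dz F.T t x y 0 := by linarith [(hb x y).1]
      have h2 := mul_nonneg he (sq_nonneg (dz F.T t x y 0 + m))
      rw [h1]; linarith
    rw [Fields.plateFlux]
    linarith

/-- The convective transport next to the plates is controlled by the dissipation. -/
lemma layers_conv_le (hF : IsSolution Pr R Lx Ly η F) (hLx : 0 < Lx) (hLy : 0 < Ly) {δ ε : ℝ}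
    (hδ0 : 0 ≤ δ) (hδ : δ ≤ 1 / 2) (hε : 0 < ε) (ht : 0 < t) :
    (∫ z in (0 : ℝ)..δ, cellInt Lx Ly (fun x y => F.w t x y z * F.T t x y z))
      + (∫ z in (1 - δ)..1, cellInt Lx Ly (fun x y => F.w t x y z * F.T t x y z)) ≤
    δ * (ε / 2) * (∫ z in (0 : ℝ)..1, (hF.bottomData ht).gradT z)
      + δ ^ 3 / (2 * ε) * ∫ z in (0 : ℝ)..1, (hF.bottomData ht).shear z := by
  have h1 := (hF.bottomData ht).integral_w_mul_T_le hLx.le hLy.le hδ0 (by linarith) hε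
  have h2 := (hF.topData ht).integral_w_mul_T_le hLx.le hLy.le hδ0 (by linarith) hε
  have e1 : (hF.topData ht).gradT = fun z => (hF.bottomData ht).gradT (1 - z) := by
    ext z; simp [LayerData.gradT, topData, bottomData]
  have e2 : (hF.topData ht).shear = fun z => (hF.bottomData ht).shear (1 - z) := by
    ext z; simp [LayerData.shear, topData, bottomData]
  have e3 : (fun z => cellInt Lx Ly fun x y => (hF.topData ht).w x y z * (hF.topData ht).T x y z) =
      fun z => (fun z => cellInt Lx Ly fun x y => F.w t x y z * F.T t x y z) (1 - z) := by
    ext z; simp [topData]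
  rw [e1, e2, e3, intervalIntegral.integral_comp_sub_left, intervalIntegral.integral_comp_sub_left,
    intervalIntegral.integral_comp_sub_left
      (fun z => cellInt Lx Ly fun x y => F.w t x y z * F.T t x y z) 1, sub_zero] at h2
  have g1 := integral_layers_le (hF.bottomData ht).continuousOn_gradT
    (fun z => cellInt_nonneg hLx.le hLy.le fun x y => by positivity) hδ0 hδ
  have g2 := integral_layers_le (hF.bottomData ht).continuousOn_shear
    (fun z => cellInt_nonneg hLx.le hLy.le fun x y => by positivity) hδ0 hδ
  have k1 := mul_le_mul_of_nonneg_left g1 (by positivity : 0 ≤ δ * (ε / 2))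
  have k2 := mul_le_mul_of_nonneg_left g2 (by positivity : 0 ≤ δ ^ 3 / (2 * ε))
  have h1' : (∫ z in (0 : ℝ)..δ, cellInt Lx Ly (fun x y => F.w t x y z * F.T t x y z)) ≤ _ := h1
  linarith

/-- The conductive terms of the background method. -/
lemma layers_cond_le (hF : IsSolution Pr R Lx Ly η F) (hLx : 0 < Lx) (hLy : 0 < Ly) (σ : ℝ) {δ : ℝ}
    (hδ0 : 0 ≤ δ) (hδ : δ ≤ 1 / 2) (ht : 0 < t) :
    -(∫ z in (0 : ℝ)..1, cellInt Lx Ly (fun x y => dz F.T t x y z ^ 2))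
      - σ * ((∫ z in (0 : ℝ)..δ, cellInt Lx Ly (fun x y => dz F.T t x y z))
        + ∫ z in (1 - δ)..1, cellInt Lx Ly (fun x y => dz F.T t x y z)) ≤
    Lx * Ly * (σ ^ 2 * δ / 2) := by
  have cz := hF.reg_T.spaceC1.layer_z ht
  have m0 : (0 : ℝ) ∈ Icc (0 : ℝ) 1 := by simp
  have m1 : (1 : ℝ) ∈ Icc (0 : ℝ) 1 := by simp
  have md : δ ∈ Icc (0 : ℝ) 1 := ⟨hδ0, by linarith⟩
  have md' : 1 - δ ∈ Icc (0 : ℝ) 1 := one_sub_mem md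
  -- The vertical dissipation outside the layers is discarded; inside, `-q² - σ q ≤ σ² / 4`.
  have g := integral_layers_le (cz.pow 2).cellInt
    (fun z => cellInt_nonneg hLx.le hLy.le fun x y => by positivity) hδ0 hδ
  have piece : ∀ a ∈ Icc (0 : ℝ) 1, ∀ b ∈ Icc (0 : ℝ) 1, a ≤ b →
      -(∫ z in a..b, cellInt Lx Ly (fun x y => dz F.T t x y z ^ 2))
        - σ * (∫ z in a..b, cellInt Lx Ly (fun x y => dz F.T t x y z)) ≤
      (b - a) * (Lx * Ly * (σ ^ 2 / 4)) := by
    intro a ha b hb hab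
    have i1 := intervalIntegrable_of_continuousOn_unit
      (cz.cellInt (Lx := Lx) (Ly := Ly)) ha hb
    have i2 := intervalIntegrable_of_continuousOn_unit
      ((cz.pow 2).cellInt (Lx := Lx) (Ly := Ly)) ha hb
    have i2n : IntervalIntegrable (fun z => -cellInt Lx Ly fun x y => dz F.T t x y z ^ 2)
      volume a b := i2.neg
    rw [← intervalIntegral.integral_neg, ← intervalIntegral.integral_const_mul,
      ← intervalIntegral.integral_sub i2n (i1.const_mul σ)]
    have : (b - a) * (Lx * Ly * (σ ^ 2 / 4)) = ∫ _ in a..b, Lx * Ly * (σ ^ 2 / 4) := by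
      simp; ring
    rw [this]
    refine intervalIntegral.integral_mono_on hab (i2n.sub (i1.const_mul σ)) (by simp)
      fun z hz => ?_
    have hz' : z ∈ Icc (0 : ℝ) 1 := Icc_subset_Icc ha.1 hb.2 hz
    rw [← cellInt_neg, ← cellInt_const_mul, ← cellInt_sub ((cz.pow 2).neg.slice hz')
      ((cz.const_mul σ).slice hz'), ← cellInt_const]
    refine cellInt_mono hLx.le hLy.le (((cz.pow 2).neg.sub (cz.const_mul σ)).slice hz')
      continuous_const fun x y => ?_
    nlinarith [sq_nonneg (dz F.T t x y z + σ / 2)]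
  have p1 := piece 0 m0 δ md hδ0
  have p2 := piece _ md' 1 m1 md'.2
  nlinarith

lemma volInt_gradSq_eq {f : Field} (hf : SpaceC1 f) (ht : 0 < t) :
    volInt Lx Ly (gradSq f t) = volInt Lx Ly (fun x y z => dx f t x y z ^ 2 + dy f t x y z ^ 2)
      + volInt Lx Ly (fun x y z => dz f t x y z ^ 2) :=
  volInt_add (((hf.layer_x ht).pow 2).add ((hf.layer_y ht).pow 2)) ((hf.layer_z ht).pow 2)

lemma shear_le (hF : IsSolution Pr R Lx Ly η F) (hLx : 0 < Lx) (hLy : 0 < Ly) (ht : 0 < t) :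
    ∫ z in (0 : ℝ)..1, (hF.bottomData ht).shear z ≤
      volInt Lx Ly (gradSq F.u t) + volInt Lx Ly (gradSq F.v t) + volInt Lx Ly (gradSq F.w t) := by
  have e : ∫ z in (0 : ℝ)..1, (hF.bottomData ht).shear z =
      volInt Lx Ly (fun x y z => dz F.u t x y z ^ 2 + dz F.v t x y z ^ 2) := rfl
  rw [e, volInt_add ((hF.reg_u.spaceC1.layer_z ht).pow 2) ((hF.reg_v.spaceC1.layer_z ht).pow 2),
    volInt_gradSq_eq hF.reg_u.spaceC1 ht, volInt_gradSq_eq hF.reg_v.spaceC1 ht]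
  have h1 : 0 ≤ volInt Lx Ly (fun x y z => dx F.u t x y z ^ 2 + dy F.u t x y z ^ 2) :=
    volInt_nonneg hLx.le hLy.le fun x y z _ => by positivity
  have h2 : 0 ≤ volInt Lx Ly (fun x y z => dx F.v t x y z ^ 2 + dy F.v t x y z ^ 2) :=
    volInt_nonneg hLx.le hLy.le fun x y z _ => by positivity
  have h3 : 0 ≤ volInt Lx Ly (gradSq F.w t) :=
    volInt_nonneg hLx.le hLy.le fun x y z _ => by unfold gradSq; positivity
  linarith

/-- The time derivative of `energyDensity`. -/
def _root_.RayleighBenard.Fields.energyRateDensity (F : Fields) (Pr R α σ δ : ℝ) : Field :=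
  fun t x y z => α / R * (Pr⁻¹ * (F.u t x y z * dt F.u t x y z
        + F.v t x y z * dt F.v t x y z + F.w t x y z * dt F.w t x y z))
    + (F.T t x y z - profile σ δ z) * dt F.T t x y z

/-- The dissipation inequality of the background method. -/
lemma energyRate_le (hF : IsSolution Pr R Lx Ly η F) (hLx : 0 < Lx) (hLy : 0 < Ly) (hR : 0 < R)
    {m d : ℝ} (hm : η = ⊤ → m = 1) (hd : η ≠ ⊤ → d = 1 + 2 * η.toReal - 2 * η.toReal * m)
    {α σ δ : ℝ} (hσ : 0 < σ) (hδ0 : 0 < δ) (hδ : δ ≤ 1 / 2)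
    (hα : (σ * δ) ^ 2 * δ ^ 2 * R ≤ 4 * α) (ht : 0 < t) :
    volInt Lx Ly (F.energyRateDensity Pr R α σ δ t) ≤
      Lx * Ly * (σ ^ 2 * δ / 2) + α * F.convTransport Lx Ly t
      + (m * (Lx * Ly * F.drop Lx Ly t) - 2 * (σ * δ) * F.plateFlux Lx Ly t
        + d * (F.plateFlux Lx Ly t - m * (Lx * Ly))) := by
  have cT := hF.reg_T.spaceC1.layer ht
  have cTt := hF.reg_T.layer_t ht
  have cz := hF.reg_T.spaceC1.layer_z ht
  have cw := hF.reg_w.spaceC1.layer ht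
  have cτ : ContLayer fun _ _ z => profile σ δ z := contLayer_vertical (continuous_profile σ δ)
  have ck : ContLayer fun x y z => Pr⁻¹ * (F.u t x y z * dt F.u t x y z
        + F.v t x y z * dt F.v t x y z + F.w t x y z * dt F.w t x y z) :=
    ((((hF.reg_u.spaceC1.layer ht).mul (hF.reg_u.layer_t ht)).add
      ((hF.reg_v.spaceC1.layer ht).mul (hF.reg_v.layer_t ht))).add
      (cw.mul (hF.reg_w.layer_t ht))).const_mul _
  have split : volInt Lx Ly (F.energyRateDensity Pr R α σ δ t) =
      α / R * volInt Lx Ly (fun x y z => Pr⁻¹ * (F.u t x y z * dt F.u t x y z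
        + F.v t x y z * dt F.v t x y z + F.w t x y z * dt F.w t x y z))
      + (volInt Lx Ly (fun x y z => F.T t x y z * dt F.T t x y z)
        - volInt Lx Ly (fun x y z => profile σ δ z * dt F.T t x y z)) := by
    rw [← volInt_const_mul, ← volInt_sub (cT.mul cTt) (cτ.mul cTt),
      ← volInt_add (ck.const_mul _) ((cT.mul cTt).sub (cτ.mul cTt))]
    refine volInt_congr fun x y z _ => ?_
    unfold Fields.energyRateDensity; ring
  have mδ : δ ∈ Icc (0 : ℝ) 1 := ⟨hδ0.le, by linarith⟩
  have hflux : ∀ a ∈ Icc (0 : ℝ) 1, ∀ b ∈ Icc (0 : ℝ) 1, ∫ z in a..b, F.fluxAt Lx Ly t z =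
      (∫ z in a..b, cellInt Lx Ly (fun x y => dz F.T t x y z))
      - ∫ z in a..b, cellInt Lx Ly (fun x y => F.w t x y z * F.T t x y z) := fun a ha b hb =>
    intervalIntegral.integral_sub (intervalIntegrable_of_continuousOn_unit cz.cellInt ha hb)
      (intervalIntegrable_of_continuousOn_unit (cw.mul cT).cellInt ha hb)
  rw [split, hF.volInt_velocity_mul_dt ht, hF.volInt_T_mul_dt ht,
    hF.volInt_profile_mul_dt ht σ hδ0.le hδ, volInt_gradSq_eq hF.reg_T.spaceC1 ht,
    hflux 0 (by simp) δ mδ, hflux _ (one_sub_mem mδ) 1 (by simp)]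
  have hs : 0 < σ * δ := mul_pos hσ hδ0
  have hb := hF.boundary_le hLx hLy hm hd (σ * δ) ht
  have hc := hF.layers_cond_le hLx hLy σ hδ0.le hδ ht
  -- This weight `ε` makes the coefficient of the horizontal temperature gradient exactly `1`, so
  -- the thermal dissipation absorbs it. The resulting coefficient of the shear is what `hα`
  -- compares with `α / R`.
  have hv := mul_le_mul_of_nonneg_left
    (hF.layers_conv_le hLx hLy hδ0.le hδ (ε := 2 / (σ * δ)) (by positivity) ht) hσ.le
  have hg : ∫ z in (0 : ℝ)..1, (hF.bottomData ht).gradT z =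
      volInt Lx Ly (fun x y z => dx F.T t x y z ^ 2 + dy F.T t x y z ^ 2) := rfl
  have hz : ∫ z in (0 : ℝ)..1, cellInt Lx Ly (fun x y => dz F.T t x y z ^ 2) =
      volInt Lx Ly (fun x y z => dz F.T t x y z ^ 2) := rfl
  have hsh := hF.shear_le hLx hLy ht
  set X := volInt Lx Ly (fun x y z => dx F.T t x y z ^ 2 + dy F.T t x y z ^ 2)
  set V := volInt Lx Ly (gradSq F.u t) + volInt Lx Ly (gradSq F.v t) + volInt Lx Ly (gradSq F.w t)
  set Y := ∫ z in (0 : ℝ)..1, (hF.bottomData ht).shear z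
  have hY0 : 0 ≤ Y := intervalIntegral.integral_nonneg zero_le_one fun z _ =>
    cellInt_nonneg hLx.le hLy.le fun x y => by positivity
  rw [hg] at hv
  rw [hz] at hc
  have e1 : σ * (δ * (2 / (σ * δ) / 2) * X + δ ^ 3 / (2 * (2 / (σ * δ))) * Y) =
      X + (σ * δ) ^ 2 * δ ^ 2 / 4 * Y := by
    field_simp; ring
  rw [e1] at hv
  have h4 : (σ * δ) ^ 2 * δ ^ 2 / 4 ≤ α / R := by
    rw [le_div_iff₀ hR]; linarith
  have hα0 : 0 ≤ α / R := le_trans (by positivity) h4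
  have h5 : (σ * δ) ^ 2 * δ ^ 2 / 4 * Y ≤ α / R * V := mul_le_mul h4 hsh hY0 hα0
  have e2 : α / R * (R * F.convTransport Lx Ly t - V) =
      α * F.convTransport Lx Ly t - α / R * V := by
    field_simp
  rw [e2]
  linarith

end IsSolution

/-! ### Continuity in time and integration of the balances over time. -/

namespace ContOn

variable {I : Set ℝ} {f g : Field}

lemma add (hf : ContOn I f) (hg : ContOn I g) :
    ContOn I fun t x y z => f t x y z + g t x y z := ContinuousOn.add hf hg

lemma sub (hf : ContOn I f) (hg : ContOn I g) :
    ContOn I fun t x y z => f t x y z - g t x y z := ContinuousOn.sub hf hg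

lemma mul (hf : ContOn I f) (hg : ContOn I g) :
    ContOn I fun t x y z => f t x y z * g t x y z := ContinuousOn.mul hf hg

lemma pow (hf : ContOn I f) (n : ℕ) : ContOn I fun t x y z => f t x y z ^ n :=
  ContinuousOn.pow hf n

lemma const_mul (hf : ContOn I f) (c : ℝ) : ContOn I fun t x y z => c * f t x y z :=
  ContinuousOn.mul continuousOn_const hf

lemma div_const (hf : ContOn I f) (c : ℝ) : ContOn I fun t x y z => f t x y z / c :=
  ContinuousOn.div_const hf c

lemma vertical {φ : ℝ → ℝ} (hφ : Continuous φ) : ContOn I fun _ _ _ z => φ z :=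
  (hφ.comp (by fun_prop : Continuous fun q : ℝ × ℝ × ℝ × ℝ => q.2.2.2)).continuousOn

/-- Composition with a retraction onto the time interval and onto the layer. -/
lemma clamp (hf : ContOn I f) {r : ℝ → ℝ} (hr : Continuous r) (hrI : ∀ t, r t ∈ I) :
    Continuous fun q : (ℝ × ℝ) × ℝ × ℝ => f (r q.1.1) q.2.1 q.2.2 (clampUnit q.1.2) := by
  refine ContinuousOn.comp_continuous
    (f := fun q : (ℝ × ℝ) × ℝ × ℝ => (r q.1.1, q.2.1, q.2.2, clampUnit q.1.2))
    hf ?_ fun q => ⟨hrI _, mem_univ _, mem_univ _, clampUnit_mem _⟩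
  have := continuous_clampUnit
  fun_prop

variable {Lx Ly : ℝ}

lemma continuous_cellInt_clamp (hf : ContOn I f) {r : ℝ → ℝ} (hr : Continuous r)
    (hrI : ∀ t, r t ∈ I) :
    Continuous fun q : ℝ × ℝ => cellInt Lx Ly fun x y => f (r q.1) x y (clampUnit q.2) :=
  continuous_cellInt_param (h := fun (q : ℝ × ℝ) x y => f (r q.1) x y (clampUnit q.2))
    (hf.clamp hr hrI)

lemma volInt_clamp (f : ℝ → ℝ → ℝ → ℝ) : volInt Lx Ly f =
    ∫ z in (0 : ℝ)..1, cellInt Lx Ly fun x y => f x y (clampUnit z) :=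
  volInt_congr (g := fun x y z => f x y (clampUnit z))
    fun x y z hz => by simp only [clampUnit_of_mem hz]

lemma continuous_volInt (hf : ContOn I f) {r : ℝ → ℝ} (hr : Continuous r)
    (hrI : ∀ t, r t ∈ I) : Continuous fun t => volInt Lx Ly (f (r t)) := by
  simp only [volInt_clamp]
  exact intervalIntegral.continuous_parametric_intervalIntegral_of_continuous'
    (f := fun t z => cellInt Lx Ly fun x y => f (r t) x y (clampUnit z))
    (hf.continuous_cellInt_clamp hr hrI) 0 1

lemma continuous_cellInt (hf : ContOn I f) {r : ℝ → ℝ} (hr : Continuous r)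
    (hrI : ∀ t, r t ∈ I) {z : ℝ} (hz : z ∈ Icc (0 : ℝ) 1) :
    Continuous fun t => cellInt Lx Ly fun x y => f (r t) x y z := by
  have := (hf.continuous_cellInt_clamp (Lx := Lx) (Ly := Ly) hr hrI).comp
    (by fun_prop : Continuous fun t : ℝ => (t, z))
  simpa only [Function.comp_def, clampUnit_of_mem hz] using this

/-- Derivatives are controlled only for `t > 0`, so the balances are integrated from time `1`, with
time clamped by `max t 1`. The interval `[0, 1]` later enters as a remainder of order `1 / τ`. -/
lemma max_one_mem (t : ℝ) : max t 1 ∈ Ioi (0 : ℝ) :=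
  mem_Ioi.2 (lt_max_of_lt_right zero_lt_one)

lemma continuousOn_volInt (hf : ContOn (Ioi 0) f) :
    ContinuousOn (fun t => volInt Lx Ly (f t)) (Ici 1) :=
  (hf.continuous_volInt (Lx := Lx) (Ly := Ly) (r := fun t => max t 1) (by fun_prop) max_one_mem).continuousOn.congr
    fun t ht => by simp only [max_eq_left (mem_Ici.1 ht)]

/-- The fundamental theorem of calculus in time for integrals over the layer. -/
lemma integral_volInt_dt {f' : Field} (hf : ContOn (Ioi 0) f) (hf' : ContOn (Ioi 0) f')
    (hd : ∀ t > 0, ∀ x y, ∀ z ∈ Icc (0 : ℝ) 1, HasDerivAt (fun s => f s x y z) (f' t x y z) t)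
    {τ : ℝ} (hτ : 1 ≤ τ) :
    ∫ t in (1 : ℝ)..τ, volInt Lx Ly (f' t) = volInt Lx Ly (f τ) - volInt Lx Ly (f 1) := by
  have hr : Continuous fun t : ℝ => max t 1 := by fun_prop
  have hτ0 : 0 < τ := zero_lt_one.trans_le hτ
  calc ∫ t in (1 : ℝ)..τ, volInt Lx Ly (f' t)
      = ∫ t in (1 : ℝ)..τ, ∫ z in (0 : ℝ)..1,
          cellInt Lx Ly fun x y => f' (max t 1) x y (clampUnit z) := by
        refine intervalIntegral.integral_congr fun t ht => ?_
        rw [uIcc_of_le hτ] at ht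
        simp only [volInt_clamp, max_eq_left ht.1]
    _ = ∫ z in (0 : ℝ)..1, ∫ t in (1 : ℝ)..τ,
          cellInt Lx Ly fun x y => f' (max t 1) x y (clampUnit z) := by
        refine intervalIntegral_swap_of_continuous (h := fun z t =>
          cellInt Lx Ly fun x y => f' (max t 1) x y (clampUnit z)) ?_ _ _ _ _
        exact (hf'.continuous_cellInt_clamp hr max_one_mem).comp continuous_swap
    _ = ∫ z in (0 : ℝ)..1, cellInt Lx Ly fun x y =>
          ∫ t in (1 : ℝ)..τ, f' (max t 1) x y (clampUnit z) := by
        refine intervalIntegral.integral_congr fun z _ => ?_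
        exact integral_cellInt_swap (h := fun t x y => f' (max t 1) x y (clampUnit z))
          ((hf'.clamp hr max_one_mem).comp
            (by fun_prop : Continuous fun p : ℝ × ℝ × ℝ => ((p.1, z), p.2))) _ _
    _ = volInt Lx Ly (fun x y z => f τ x y z - f 1 x y z) := by
        rw [volInt_clamp]
        refine intervalIntegral.integral_congr fun z _ => ?_
        congr 1; ext x y
        have hz := clampUnit_mem z
        have hc : Continuous fun t => f' (max t 1) x y (clampUnit z) :=
          (hf'.clamp hr max_one_mem).comp
            (by fun_prop : Continuous fun t : ℝ => (((t, z), x, y) : (ℝ × ℝ) × ℝ × ℝ))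
        refine intervalIntegral.integral_eq_sub_of_hasDerivAt (f := fun t => f t x y (clampUnit z))
          (fun t ht => ?_) (hc.intervalIntegrable _ _)
        rw [uIcc_of_le hτ] at ht
        rw [max_eq_left ht.1]
        exact hd t (zero_lt_one.trans_le ht.1) x y _ hz
    _ = _ := volInt_sub (hf.layer hτ0) (hf.layer (mem_Ioi.2 zero_lt_one))

end ContOn

/-- The energy density of the background method. -/
def Fields.energyDensity (F : Fields) (Pr R α σ δ : ℝ) : Field := fun t x y z =>
  α / R * (Pr⁻¹ * ((F.u t x y z ^ 2 + F.v t x y z ^ 2 + F.w t x y z ^ 2) / 2))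
    + (F.T t x y z - profile σ δ z) ^ 2 / 2

/-- The vertical first moment of the temperature about the midplane. -/
def Fields.moment (F : Fields) (Lx Ly t : ℝ) : ℝ :=
  volInt Lx Ly fun x y z => (z - 1 / 2) * F.T t x y z

namespace IsSolution

variable {Pr R Lx Ly : ℝ} {η : ℝ≥0∞} {F : Fields}

lemma contOn_energyDensity (hF : IsSolution Pr R Lx Ly η F) (α σ δ : ℝ) :
    ContOn (Ioi 0) (F.energyDensity Pr R α σ δ) :=
  (((((hF.reg_u.spaceC1.cont.pow 2).add (hF.reg_v.spaceC1.cont.pow 2)).add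
    (hF.reg_w.spaceC1.cont.pow 2)).div_const 2).const_mul Pr⁻¹ |>.const_mul (α / R)).add
    (((hF.reg_T.spaceC1.cont.sub (ContOn.vertical (continuous_profile σ δ))).pow 2).div_const 2)

lemma contOn_energyRateDensity (hF : IsSolution Pr R Lx Ly η F) (α σ δ : ℝ) :
    ContOn (Ioi 0) (F.energyRateDensity Pr R α σ δ) :=
  (((((hF.reg_u.spaceC1.cont.mul hF.reg_u.cont_dt).add
    (hF.reg_v.spaceC1.cont.mul hF.reg_v.cont_dt)).add
    (hF.reg_w.spaceC1.cont.mul hF.reg_w.cont_dt)).const_mul Pr⁻¹).const_mul (α / R)).add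
    ((hF.reg_T.spaceC1.cont.sub (ContOn.vertical (continuous_profile σ δ))).mul hF.reg_T.cont_dt)

lemma integral_energyRate (hF : IsSolution Pr R Lx Ly η F) (α σ δ : ℝ) {τ : ℝ} (hτ : 1 ≤ τ) :
    ∫ t in (1 : ℝ)..τ, volInt Lx Ly (F.energyRateDensity Pr R α σ δ t) =
      volInt Lx Ly (F.energyDensity Pr R α σ δ τ) - volInt Lx Ly (F.energyDensity Pr R α σ δ 1) :=
  ContOn.integral_volInt_dt (hF.contOn_energyDensity α σ δ) (hF.contOn_energyRateDensity α σ δ)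
    (fun t ht x y z hz => by
      have hu := (hF.reg_u.hasDerivAt_t ht x y hz).fun_pow 2
      have hv := (hF.reg_v.hasDerivAt_t ht x y hz).fun_pow 2
      have hw := (hF.reg_w.hasDerivAt_t ht x y hz).fun_pow 2
      have hT := ((hF.reg_T.hasDerivAt_t ht x y hz).sub_const (profile σ δ z)).fun_pow 2
      refine ((((((hu.fun_add hv).fun_add hw).div_const 2).const_mul Pr⁻¹).const_mul
        (α / R)).fun_add (hT.div_const 2)).congr_deriv ?_
      simp only [Fields.energyRateDensity]
      ring) hτ

lemma integral_moment (hF : IsSolution Pr R Lx Ly η F) {τ : ℝ} (hτ : 1 ≤ τ) :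
    ∫ t in (1 : ℝ)..τ, (F.totalTransport Lx Ly t - F.plateFlux Lx Ly t) =
      F.moment Lx Ly τ - F.moment Lx Ly 1 := by
  have hc : Continuous fun z : ℝ => z - 1 / 2 := by fun_prop
  have := ContOn.integral_volInt_dt (Lx := Lx) (Ly := Ly)
    ((ContOn.vertical hc).mul hF.reg_T.spaceC1.cont) ((ContOn.vertical hc).mul hF.reg_T.cont_dt)
    (fun t ht x y z hz => (hF.reg_T.hasDerivAt_t ht x y hz).const_mul (z - 1 / 2)) hτ
  rw [Fields.moment, Fields.moment, ← this]
  refine intervalIntegral.integral_congr fun t ht => ?_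
  rw [uIcc_of_le hτ] at ht
  exact (hF.volInt_sub_half_mul_dt (zero_lt_one.trans_le ht.1)).symm

/-- The drop contains no derivative, hence is continuous down to `t = 0`, where the time means
begin. -/
lemma continuous_drop_max (hF : IsSolution Pr R Lx Ly η F) :
    Continuous fun t => F.drop Lx Ly (max t 0) := by
  have h0 := fun {z} (hz : z ∈ Icc (0 : ℝ) 1) => hF.reg_T.cont.continuous_cellInt (Lx := Lx)
    (Ly := Ly) (r := fun t => max t 0) (by fun_prop) (fun t => mem_Ici.2 (le_max_right t 0)) hz
  exact ((h0 (z := 0) (by simp)).const_mul (1 / (Lx * Ly))).sub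
    ((h0 (z := 1) (by simp)).const_mul (1 / (Lx * Ly)))

lemma continuousOn_drop (hF : IsSolution Pr R Lx Ly η F) :
    ContinuousOn (F.drop Lx Ly) (Ici 0) :=
  hF.continuous_drop_max.continuousOn.congr fun t ht => by
    simp only [max_eq_left (mem_Ici.1 ht)]

lemma continuousOn_convTransport (hF : IsSolution Pr R Lx Ly η F) :
    ContinuousOn (F.convTransport Lx Ly) (Ici 0) :=
  ((hF.reg_w.cont.mul hF.reg_T.cont).continuous_volInt (r := fun t => max t 0) (by fun_prop)
    (fun t => mem_Ici.2 (le_max_right t 0))).continuousOn.congr fun t ht => by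
      simp only [max_eq_left (mem_Ici.1 ht)]; rfl

lemma continuousOn_plateFlux (hF : IsSolution Pr R Lx Ly η F) :
    ContinuousOn (F.plateFlux Lx Ly) (Ici 1) := by
  have h0 := fun {z} (hz : z ∈ Icc (0 : ℝ) 1) => hF.reg_T.spaceC1.cont_dz.continuous_cellInt
    (Lx := Lx) (Ly := Ly) (r := fun t => max t 1) (by fun_prop) ContOn.max_one_mem hz
  have := ((h0 (z := 0) (by simp)).add (h0 (z := 1) (by simp))).neg.div_const 2
  exact this.continuousOn.congr fun t ht => by
    simp only [Fields.plateFlux, Pi.neg_apply, Pi.add_apply, max_eq_left (mem_Ici.1 ht)]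

end IsSolution

/-! ### Time means and their asymptotic relations. -/

/-- The mean over `[0, τ]` of the total heat transport per unit area. -/
def Fields.fluxMean (F : Fields) (Lx Ly τ : ℝ) : ℝ :=
  timeMean (F.totalTransport Lx Ly) τ / (Lx * Ly)

/-- Supplies the layer width: for fixed `s = σ δ` the absorption condition `s² δ² R ≤ 4 α` holds in
thin layers. -/
lemma exists_small_sq_mul_le (K : ℝ) {c : ℝ} (hK : 0 ≤ K) (hc : 0 < c) :
    ∃ δ : ℝ, 0 < δ ∧ δ ≤ 1 / 2 ∧ δ ^ 2 * K ≤ c := by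
  refine ⟨min (1 / 2) (c / (K + 1)), by positivity, min_le_left _ _, ?_⟩
  set δ := min (1 / 2) (c / (K + 1))
  have h0 : 0 < δ := by positivity
  have h1 : δ ≤ 1 / 2 := min_le_left _ _
  have h2 : δ * (K + 1) ≤ c := (le_div_iff₀ (by positivity)).1 (min_le_right _ _)
  nlinarith [mul_nonneg h0.le hK]

lemma abs_profile_le {σ δ z : ℝ} (hσ : 0 ≤ σ) (hδ : 0 ≤ δ) (hz : z ∈ Icc (0 : ℝ) 1) :
    |profile σ δ z| ≤ 1 / 2 + σ * δ := by
  have h1 : max (δ - z) 0 ≤ δ := max_le (by linarith [hz.1]) hδ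
  have h2 : max (z - (1 - δ)) 0 ≤ δ := max_le (by linarith [hz.2]) hδ
  have h3 : 0 ≤ max (δ - z) 0 := le_max_right _ _
  have h4 : 0 ≤ max (z - (1 - δ)) 0 := le_max_right _ _
  have := mul_le_mul_of_nonneg_left h1 hσ
  have := mul_le_mul_of_nonneg_left h2 hσ
  have := mul_nonneg hσ h3
  have := mul_nonneg hσ h4
  unfold profile
  rw [abs_le]; constructor <;> linarith

namespace IsSolution

variable {Pr R Lx Ly : ℝ} {η : ℝ≥0∞} {F : Fields}

lemma intervalIntegrable_drop (hF : IsSolution Pr R Lx Ly η F) {a b : ℝ} (ha : 0 ≤ a)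
    (hb : 0 ≤ b) : IntervalIntegrable (F.drop Lx Ly) volume a b :=
  (hF.continuousOn_drop.mono fun _ ht => (le_min ha hb).trans ht.1).intervalIntegrable

lemma intervalIntegrable_convTransport (hF : IsSolution Pr R Lx Ly η F) {a b : ℝ} (ha : 0 ≤ a)
    (hb : 0 ≤ b) : IntervalIntegrable (F.convTransport Lx Ly) volume a b :=
  (hF.continuousOn_convTransport.mono fun _ ht => (le_min ha hb).trans ht.1).intervalIntegrable

lemma intervalIntegrable_plateFlux (hF : IsSolution Pr R Lx Ly η F) {τ : ℝ} (hτ : 1 ≤ τ) :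
    IntervalIntegrable (F.plateFlux Lx Ly) volume 1 τ :=
  (hF.continuousOn_plateFlux.mono fun _ ht => by
    rw [uIcc_of_le hτ] at ht; exact ht.1).intervalIntegrable

/-- Nothing is assumed about `T_z` at `t = 0`, which `uIoc 0 τ` leaves out; integrability of the
conductive transport up to time `0` comes from that of the drop. -/
lemma condTransport_eqOn (hF : IsSolution Pr R Lx Ly η F) (hLx : 0 < Lx) (hLy : 0 < Ly) {τ : ℝ}
    (hτ : 0 ≤ τ) :
    EqOn (fun t => Lx * Ly * F.drop Lx Ly t) (F.condTransport Lx Ly) (uIoc 0 τ) := fun t ht => by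
  rw [uIoc_of_le hτ] at ht
  exact (hF.condTransport_eq hLx hLy ht.1).symm

lemma totalTransport_eqOn (hF : IsSolution Pr R Lx Ly η F) (hLx : 0 < Lx) (hLy : 0 < Ly) {τ : ℝ}
    (hτ : 0 ≤ τ) :
    EqOn (fun t => Lx * Ly * F.drop Lx Ly t + F.convTransport Lx Ly t)
      (F.totalTransport Lx Ly) (uIoc 0 τ) := fun t ht => by
  simp only [Fields.totalTransport, ← hF.condTransport_eqOn hLx hLy hτ ht]

lemma intervalIntegrable_condTransport (hF : IsSolution Pr R Lx Ly η F) (hLx : 0 < Lx)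
    (hLy : 0 < Ly) {τ : ℝ} (hτ : 0 ≤ τ) :
    IntervalIntegrable (F.condTransport Lx Ly) volume 0 τ :=
  ((hF.intervalIntegrable_drop le_rfl hτ).const_mul _).congr (hF.condTransport_eqOn hLx hLy hτ)

lemma intervalIntegrable_totalTransport (hF : IsSolution Pr R Lx Ly η F) (hLx : 0 < Lx)
    (hLy : 0 < Ly) {τ : ℝ} (hτ : 0 ≤ τ) :
    IntervalIntegrable (F.totalTransport Lx Ly) volume 0 τ :=
  (((hF.intervalIntegrable_drop le_rfl hτ).const_mul _).add
    (hF.intervalIntegrable_convTransport le_rfl hτ)).congr (hF.totalTransport_eqOn hLx hLy hτ)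

lemma timeMean_condTransport (hF : IsSolution Pr R Lx Ly η F) (hLx : 0 < Lx) (hLy : 0 < Ly)
    {τ : ℝ} (hτ : 0 ≤ τ) :
    timeMean (F.condTransport Lx Ly) τ = Lx * Ly * timeMean (F.drop Lx Ly) τ := by
  have : ∫ t in (0 : ℝ)..τ, F.condTransport Lx Ly t =
      ∫ t in (0 : ℝ)..τ, Lx * Ly * F.drop Lx Ly t :=
    intervalIntegral.integral_congr_ae (ae_of_all _ fun t ht =>
      (hF.condTransport_eqOn hLx hLy hτ ht).symm)
  rw [timeMean, this, intervalIntegral.integral_const_mul, timeMean]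
  ring

lemma timeMean_convTransport (hF : IsSolution Pr R Lx Ly η F) (hLx : 0 < Lx) (hLy : 0 < Ly)
    {τ : ℝ} (hτ : 0 ≤ τ) : timeMean (F.convTransport Lx Ly) τ =
      Lx * Ly * (F.fluxMean Lx Ly τ - timeMean (F.drop Lx Ly) τ) := by
  have : ∫ t in (0 : ℝ)..τ, F.totalTransport Lx Ly t =
      ∫ t in (0 : ℝ)..τ, (Lx * Ly * F.drop Lx Ly t + F.convTransport Lx Ly t) :=
    intervalIntegral.integral_congr_ae (ae_of_all _ fun t ht =>
      (hF.totalTransport_eqOn hLx hLy hτ ht).symm)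
  rw [Fields.fluxMean, timeMean, timeMean, timeMean, this,
    intervalIntegral.integral_add ((hF.intervalIntegrable_drop le_rfl hτ).const_mul _)
      (hF.intervalIntegrable_convTransport le_rfl hτ), intervalIntegral.integral_const_mul]
  field_simp
  ring

lemma integral_drop_eq (hF : IsSolution Pr R Lx Ly η F) {τ : ℝ} (hτ : 1 ≤ τ) :
    ∫ t in (1 : ℝ)..τ, F.drop Lx Ly t =
      τ * timeMean (F.drop Lx Ly) τ - ∫ t in (0 : ℝ)..1, F.drop Lx Ly t := by
  have hτ0 : 0 < τ := zero_lt_one.trans_le hτ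
  rw [timeMean, ← intervalIntegral.integral_add_adjacent_intervals
    (hF.intervalIntegrable_drop le_rfl zero_le_one)
    (hF.intervalIntegrable_drop zero_le_one hτ0.le)]
  field_simp; ring

lemma integral_conv_eq (hF : IsSolution Pr R Lx Ly η F) (hLx : 0 < Lx) (hLy : 0 < Ly) {τ : ℝ}
    (hτ : 1 ≤ τ) :
    ∫ t in (1 : ℝ)..τ, F.convTransport Lx Ly t =
      τ * (Lx * Ly * (F.fluxMean Lx Ly τ - timeMean (F.drop Lx Ly) τ))
        - ∫ t in (0 : ℝ)..1, F.convTransport Lx Ly t := by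
  have hτ0 : 0 < τ := zero_lt_one.trans_le hτ
  rw [← hF.timeMean_convTransport hLx hLy hτ0.le, timeMean,
    ← intervalIntegral.integral_add_adjacent_intervals
    (hF.intervalIntegrable_convTransport le_rfl zero_le_one)
    (hF.intervalIntegrable_convTransport zero_le_one hτ0.le)]
  field_simp; ring

lemma integral_plateFlux_eq (hF : IsSolution Pr R Lx Ly η F) (hLx : 0 < Lx) (hLy : 0 < Ly) {τ : ℝ}
    (hτ : 1 ≤ τ) :
    ∫ t in (1 : ℝ)..τ, F.plateFlux Lx Ly t =
      Lx * Ly * (∫ t in (1 : ℝ)..τ, F.drop Lx Ly t) + (∫ t in (1 : ℝ)..τ, F.convTransport Lx Ly t)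
        - (F.moment Lx Ly τ - F.moment Lx Ly 1) := by
  have hτ0 : 0 < τ := zero_lt_one.trans_le hτ
  have i1 := (hF.intervalIntegrable_drop (Lx := Lx) (Ly := Ly) zero_le_one hτ0.le).const_mul
    (Lx * Ly)
  have i2 := hF.intervalIntegrable_convTransport (Lx := Lx) (Ly := Ly) zero_le_one hτ0.le
  have i3 := hF.intervalIntegrable_plateFlux (Lx := Lx) (Ly := Ly) hτ
  have e : ∫ t in (1 : ℝ)..τ, (F.totalTransport Lx Ly t - F.plateFlux Lx Ly t) =
      ∫ t in (1 : ℝ)..τ, (Lx * Ly * F.drop Lx Ly t + F.convTransport Lx Ly t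
        - F.plateFlux Lx Ly t) := by
    refine intervalIntegral.integral_congr fun t ht => ?_
    rw [uIcc_of_le hτ] at ht
    simp only [Fields.totalTransport, hF.condTransport_eq hLx hLy (zero_lt_one.trans_le ht.1)]
  rw [← hF.integral_moment hτ, e, intervalIntegral.integral_sub (i1.add i2) i3,
    intervalIntegral.integral_add i1 i2, intervalIntegral.integral_const_mul]
  ring

/-- The dissipation inequality of the background method, integrated in time. -/
lemma energy_le (hF : IsSolution Pr R Lx Ly η F) (hLx : 0 < Lx) (hLy : 0 < Ly) (hR : 0 < R)
    {m d : ℝ} (hm : η = ⊤ → m = 1) (hd : η ≠ ⊤ → d = 1 + 2 * η.toReal - 2 * η.toReal * m)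
    {α σ δ : ℝ} (hσ : 0 < σ) (hδ0 : 0 < δ) (hδ : δ ≤ 1 / 2)
    (hα : (σ * δ) ^ 2 * δ ^ 2 * R ≤ 4 * α) {τ : ℝ} (hτ : 1 ≤ τ) :
    volInt Lx Ly (F.energyDensity Pr R α σ δ τ) ≤
      volInt Lx Ly (F.energyDensity Pr R α σ δ 1)
      + Lx * Ly * (σ ^ 2 * δ / 2 - d * m) * (τ - 1)
      + α * (∫ t in (1 : ℝ)..τ, F.convTransport Lx Ly t)
      + m * (Lx * Ly) * (∫ t in (1 : ℝ)..τ, F.drop Lx Ly t)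
      + (d - 2 * (σ * δ)) * ∫ t in (1 : ℝ)..τ, F.plateFlux Lx Ly t := by
  have hτ0 : 0 < τ := zero_lt_one.trans_le hτ
  have i1 := hF.intervalIntegrable_drop (Lx := Lx) (Ly := Ly) zero_le_one hτ0.le
  have i2 := hF.intervalIntegrable_convTransport (Lx := Lx) (Ly := Ly) zero_le_one hτ0.le
  have i3 := hF.intervalIntegrable_plateFlux (Lx := Lx) (Ly := Ly) hτ
  have j1 := i1.const_mul (m * (Lx * Ly))
  have j2 := i2.const_mul α
  have j3 := i3.const_mul (d - 2 * (σ * δ))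
  have j0 : IntervalIntegrable (fun _ => Lx * Ly * (σ ^ 2 * δ / 2 - d * m)) volume 1 τ := by simp
  have hI : IntervalIntegrable (fun t => volInt Lx Ly (F.energyRateDensity Pr R α σ δ t))
      volume 1 τ :=
    ((ContOn.continuousOn_volInt (hF.contOn_energyRateDensity α σ δ)).mono fun t ht => by
      rw [uIcc_of_le hτ] at ht; exact ht.1).intervalIntegrable
  have key : ∫ t in (1 : ℝ)..τ, volInt Lx Ly (F.energyRateDensity Pr R α σ δ t) ≤
      ∫ t in (1 : ℝ)..τ, (Lx * Ly * (σ ^ 2 * δ / 2 - d * m) + α * F.convTransport Lx Ly t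
        + m * (Lx * Ly) * F.drop Lx Ly t + (d - 2 * (σ * δ)) * F.plateFlux Lx Ly t) := by
    refine intervalIntegral.integral_mono_on hτ hI (((j0.add j2).add j1).add j3) fun t ht => ?_
    have := hF.energyRate_le hLx hLy hR hm hd hσ hδ0 hδ hα (zero_lt_one.trans_le ht.1)
    linarith
  rw [hF.integral_energyRate α σ δ hτ, intervalIntegral.integral_add ((j0.add j2).add j1) j3,
    intervalIntegral.integral_add (j0.add j2) j1, intervalIntegral.integral_add j0 j2] at key
  simp only [intervalIntegral.integral_const_mul, intervalIntegral.integral_const,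
    smul_eq_mul] at key
  linarith

lemma energyDensity_nonneg (hPr : 0 < Pr) (hR : 0 < R) {α : ℝ} (hα : 0 ≤ α) (σ δ t x y z : ℝ) :
    0 ≤ F.energyDensity Pr R α σ δ t x y z := by
  unfold Fields.energyDensity; positivity

lemma energy_nonneg (hLx : 0 < Lx) (hLy : 0 < Ly) (hPr : 0 < Pr) (hR : 0 < R) {α : ℝ}
    (hα : 0 ≤ α) (σ δ t : ℝ) : 0 ≤ volInt Lx Ly (F.energyDensity Pr R α σ δ t) :=
  volInt_nonneg hLx.le hLy.le fun x y z _ => energyDensity_nonneg hPr hR hα σ δ t x y z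

/-- Young's inequality for `T - profile`, the profile being bounded. The weight `ε` stays free for
two uses: `1/2` closes a linear bound on the energy, and small values then make the moment
sublinear. -/
lemma abs_moment_le (hF : IsSolution Pr R Lx Ly η F) (hLx : 0 < Lx) (hLy : 0 < Ly) (hPr : 0 < Pr)
    (hR : 0 < R) {α σ δ ε : ℝ} (hα : 0 ≤ α) (hσ : 0 ≤ σ) (hδ : 0 ≤ δ) (hε : 0 < ε) {t : ℝ}
    (ht : 0 < t) :
    |F.moment Lx Ly t| ≤ ε * volInt Lx Ly (F.energyDensity Pr R α σ δ t)
      + Lx * Ly * (1 / (8 * ε) + 1 / 2 * (1 / 2 + σ * δ)) := by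
  have cT : ContLayer fun x y z => (z - 1 / 2) * F.T t x y z :=
    (contLayer_vertical (by fun_prop)).mul (hF.reg_T.spaceC1.layer ht)
  have ce := (hF.contOn_energyDensity α σ δ).layer (mem_Ioi.2 ht)
  have cc : ContLayer fun _ _ _ => 1 / (8 * ε) + 1 / 2 * (1 / 2 + σ * δ) :=
    contLayer_vertical continuous_const
  have pt : ∀ x y, ∀ z ∈ Icc (0 : ℝ) 1, |(z - 1 / 2) * F.T t x y z| ≤
      ε * F.energyDensity Pr R α σ δ t x y z + (1 / (8 * ε) + 1 / 2 * (1 / 2 + σ * δ)) := by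
    intro x y z hz
    have hp := abs_profile_le hσ hδ hz
    have hz' : |z - 1 / 2| ≤ 1 / 2 := by rw [abs_le]; constructor <;> linarith [hz.1, hz.2]
    have hk : 0 ≤ α / R * (Pr⁻¹ * ((F.u t x y z ^ 2 + F.v t x y z ^ 2 + F.w t x y z ^ 2) / 2)) := by
      positivity
    have hT : |F.T t x y z| ≤ |F.T t x y z - profile σ δ z| + |profile σ δ z| := by
      simpa using abs_add_le (F.T t x y z - profile σ δ z) (profile σ δ z)
    have hy : 1 / 2 * |F.T t x y z - profile σ δ z| ≤
        ε * ((F.T t x y z - profile σ δ z) ^ 2 / 2) + 1 / (8 * ε) := by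
      rw [← sq_abs (F.T t x y z - profile σ δ z)]
      set a := |F.T t x y z - profile σ δ z|
      have : ε * (a ^ 2 / 2) + 1 / (8 * ε) - 1 / 2 * a = 1 / (2 * ε) * (ε * a - 1 / 2) ^ 2 := by
        field_simp; ring
      have h2 : 0 ≤ 1 / (2 * ε) * (ε * a - 1 / 2) ^ 2 := by positivity
      linarith
    rw [abs_mul]
    have h1 := mul_le_mul_of_nonneg_right hz' (abs_nonneg (F.T t x y z))
    have h2 := mul_nonneg hε.le hk
    unfold Fields.energyDensity
    linarith
  rw [abs_le, ← volInt_const, ← volInt_const_mul, ← volInt_add (ce.const_mul ε) cc, ← volInt_neg]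
  constructor
  · exact volInt_mono hLx.le hLy.le ((ce.const_mul ε).add cc).neg cT
      fun x y z hz => (abs_le.1 (pt x y z hz)).1
  · exact volInt_mono hLx.le hLy.le cT ((ce.const_mul ε).add cc)
      fun x y z hz => (abs_le.1 (pt x y z hz)).2

/-- The first moment of the temperature grows less than linearly in time. -/
lemma tendsto_moment_div (hF : IsSolution Pr R Lx Ly η F) (hLx : 0 < Lx) (hLy : 0 < Ly)
    (hPr : 0 < Pr) (hR : 0 < R) : Tendsto (fun τ => F.moment Lx Ly τ / τ) atTop (𝓝 0) := by
  obtain ⟨δ, hδ0, hδ, hδR⟩ := exists_small_sq_mul_le R hR.le (by norm_num : (0 : ℝ) < 4)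
  have hσ : 0 < 1 / δ := by positivity
  have hσδ : 1 / δ * δ = 1 := by field_simp
  set E := fun t => volInt Lx Ly (F.energyDensity Pr R 1 (1 / δ) δ t) with hE
  have hA : 0 < Lx * Ly := mul_pos hLx hLy
  have bound : ∃ C > 0, ∀ τ ≥ 1, E τ ≤ C * τ := by
    set k := Lx * Ly * (1 / (8 * (1 / 2)) + 1 / 2 * (1 / 2 + 1 / δ * δ)) with hk
    have hk0 : 0 < k := by positivity
    have hE1 : 0 ≤ E 1 := energy_nonneg hLx hLy hPr hR zero_le_one _ _ _
    refine ⟨2 * (E 1 + Lx * Ly * ((1 / δ) ^ 2 * δ / 2) + k + |F.moment Lx Ly 1|), by positivity,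
      fun τ hτ => ?_⟩
    -- With `m = d = α = σ δ = 1` all transports cancel and, besides a linear term, only the
    -- increment of the moment remains; half of the energy plus a constant controls it.
    have h1 := hF.energy_le hLx hLy hR (m := 1) (d := 1) (fun _ => rfl) (fun _ => by ring) hσ hδ0 hδ
      (α := 1) (by rw [hσδ]; linarith) hτ
    rw [hF.integral_plateFlux_eq hLx hLy hτ, hσδ] at h1
    have h2 := hF.abs_moment_le hLx hLy hPr hR (α := 1) zero_le_one hσ.le hδ0.le
      (ε := 1 / 2) (by norm_num) (zero_lt_one.trans_le hτ)
    have h3 := le_abs_self (F.moment Lx Ly τ)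
    have h4 := neg_abs_le (F.moment Lx Ly 1)
    change E τ ≤ E 1 + _ + _ + _ + _ at h1
    change _ ≤ 1 / 2 * E τ + k at h2
    have h5 : 0 ≤ (E 1 + k + |F.moment Lx Ly 1|) * (τ - 1) :=
      mul_nonneg (by positivity) (by linarith)
    have h6 : 0 ≤ Lx * Ly * (τ - 1) := mul_nonneg hA.le (by linarith)
    have h7 : 0 ≤ Lx * Ly * ((1 / δ) ^ 2 * δ / 2) := by positivity
    linarith
  obtain ⟨C, hC, hb⟩ := bound
  rw [Metric.tendsto_atTop]
  intro e he
  set ε := e / (2 * C) with hε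
  have hε0 : 0 < ε := by positivity
  set k := Lx * Ly * (1 / (8 * ε) + 1 / 2 * (1 / 2 + 1 / δ * δ)) with hk
  have hk0 : 0 < k := by positivity
  refine ⟨max 1 (2 * k / e + 1), fun τ hτ => ?_⟩
  have hτ1 : 1 ≤ τ := (le_max_left _ _).trans hτ
  have hτ0 : 0 < τ := zero_lt_one.trans_le hτ1
  have hτ2 : 2 * k / e < τ := by linarith [(le_max_right 1 (2 * k / e + 1)).trans hτ]
  rw [div_lt_iff₀ he] at hτ2
  have h2 := hF.abs_moment_le hLx hLy hPr hR (α := 1) zero_le_one hσ.le hδ0.le hε0 hτ0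
  change _ ≤ ε * E τ + k at h2
  have h3 : ε * E τ ≤ ε * (C * τ) := mul_le_mul_of_nonneg_left (hb τ hτ1) hε0.le
  have h4 : ε * (C * τ) = e / 2 * τ := by rw [hε]; field_simp
  rw [dist_zero_right, Real.norm_eq_abs, abs_div, abs_of_pos hτ0, div_lt_iff₀ hτ0]
  linarith

/-- Remainders of this form vanish as `τ → ∞`. -/
lemma tendsto_remainder (hF : IsSolution Pr R Lx Ly η F) (hLx : 0 < Lx) (hLy : 0 < Ly)
    (hPr : 0 < Pr) (hR : 0 < R) (a b : ℝ) :
    Tendsto (fun τ => a * τ⁻¹ + b * (F.moment Lx Ly τ / τ)) atTop (𝓝 0) := by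
  simpa using (tendsto_inv_atTop_zero.const_mul a).add
    ((hF.tendsto_moment_div hLx hLy hPr hR).const_mul b)

/-- The background inequality for the time means, up to a vanishing remainder. -/
lemma background_mean_le (hF : IsSolution Pr R Lx Ly η F) (hLx : 0 < Lx) (hLy : 0 < Ly)
    (hPr : 0 < Pr) (hR : 0 < R)
    {m d : ℝ} (hm : η = ⊤ → m = 1) (hd : η ≠ ⊤ → d = 1 + 2 * η.toReal - 2 * η.toReal * m)
    {α σ δ : ℝ} (hσ : 0 < σ) (hδ0 : 0 < δ) (hδ : δ ≤ 1 / 2)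
    (hα : (σ * δ) ^ 2 * δ ^ 2 * R ≤ 4 * α) :
    ∃ r : ℝ → ℝ, Tendsto r atTop (𝓝 0) ∧ ∀ τ ≥ 1,
      (2 * (σ * δ) - α - d) * F.fluxMean Lx Ly τ + (α - m) * timeMean (F.drop Lx Ly) τ ≤
        σ ^ 2 * δ / 2 - d * m + r τ := by
  set A := Lx * Ly with hA
  have hA0 : 0 < A := mul_pos hLx hLy
  set cD := ∫ t in (0 : ℝ)..1, F.drop Lx Ly t
  set cC := ∫ t in (0 : ℝ)..1, F.convTransport Lx Ly t
  set E1 := volInt Lx Ly (F.energyDensity Pr R α σ δ 1) with hE1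
  refine ⟨_, hF.tendsto_remainder hLx hLy hPr hR
    (E1 / A - (σ ^ 2 * δ / 2 - d * m) - α * cC / A - m * cD
      + (d - 2 * (σ * δ)) * (-cD - cC / A + F.moment Lx Ly 1 / A)) (-(d - 2 * (σ * δ)) / A),
    fun τ hτ => ?_⟩
  have hτ0 : 0 < τ := zero_lt_one.trans_le hτ
  have hα0 : 0 ≤ α := by
    have : 0 ≤ (σ * δ) ^ 2 * δ ^ 2 * R := by positivity
    linarith
  have h1 := hF.energy_le hLx hLy hR hm hd hσ hδ0 hδ hα hτ
  have h0 := energy_nonneg (F := F) hLx hLy hPr hR hα0 σ δ τ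
  rw [hF.integral_plateFlux_eq hLx hLy hτ, hF.integral_drop_eq hτ,
    hF.integral_conv_eq hLx hLy hτ] at h1
  rw [← hA] at h1
  set D := timeMean (F.drop Lx Ly) τ
  set N := F.fluxMean Lx Ly τ
  have h2 := h0.trans h1
  rw [← sub_nonneg]
  have e : (A * τ) * (σ ^ 2 * δ / 2 - d * m
      + ((E1 / A - (σ ^ 2 * δ / 2 - d * m) - α * cC / A - m * cD
      + (d - 2 * (σ * δ)) * (-cD - cC / A + F.moment Lx Ly 1 / A)) * τ⁻¹
      + -(d - 2 * (σ * δ)) / A * (F.moment Lx Ly τ / τ))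
      - ((2 * (σ * δ) - α - d) * N + (α - m) * D)) =
      E1 + A * (σ ^ 2 * δ / 2 - d * m) * (τ - 1) + α * (τ * (A * (N - D)) - cC)
      + m * A * (τ * D - cD) + (d - 2 * (σ * δ)) *
        (A * (τ * D - cD) + (τ * (A * (N - D)) - cC)
          - (F.moment Lx Ly τ - F.moment Lx Ly 1)) := by
    field_simp
    ring
  exact nonneg_of_mul_nonneg_right (e ▸ h2) (mul_pos hA0 hτ0)

/-- Buoyancy has to pay for viscous dissipation: the kinetic energy balance makes the mean
convective transport nonnegative up to `O(1 / τ)`. -/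
lemma drop_mean_le (hF : IsSolution Pr R Lx Ly η F) (hLx : 0 < Lx) (hLy : 0 < Ly)
    (hPr : 0 < Pr) (hR : 0 < R) :
    ∃ r : ℝ → ℝ, Tendsto r atTop (𝓝 0) ∧ ∀ τ ≥ 1,
      timeMean (F.drop Lx Ly) τ ≤ F.fluxMean Lx Ly τ + r τ := by
  set A := Lx * Ly with hA
  have hA0 : 0 < A := mul_pos hLx hLy
  set cC := ∫ t in (0 : ℝ)..1, F.convTransport Lx Ly t
  set k : Field := fun t x y z =>
    Pr⁻¹ * ((F.u t x y z ^ 2 + F.v t x y z ^ 2 + F.w t x y z ^ 2) / 2) with hk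
  set k' : Field := fun t x y z => Pr⁻¹ * (F.u t x y z * dt F.u t x y z
        + F.v t x y z * dt F.v t x y z + F.w t x y z * dt F.w t x y z) with hk'
  have ck : ContOn (Ioi 0) k := (((hF.reg_u.spaceC1.cont.pow 2).add
    (hF.reg_v.spaceC1.cont.pow 2)).add (hF.reg_w.spaceC1.cont.pow 2)).div_const 2
      |>.const_mul Pr⁻¹
  have ck' : ContOn (Ioi 0) k' := (((hF.reg_u.spaceC1.cont.mul hF.reg_u.cont_dt).add
    (hF.reg_v.spaceC1.cont.mul hF.reg_v.cont_dt)).add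
    (hF.reg_w.spaceC1.cont.mul hF.reg_w.cont_dt)).const_mul Pr⁻¹
  refine ⟨_, hF.tendsto_remainder hLx hLy hPr hR ((volInt Lx Ly (k 1) / R - cC) / A) 0,
    fun τ hτ => ?_⟩
  have hτ0 : 0 < τ := zero_lt_one.trans_le hτ
  have ftc := ContOn.integral_volInt_dt (Lx := Lx) (Ly := Ly) ck ck' (fun t ht x y z hz => by
      have hu := (hF.reg_u.hasDerivAt_t ht x y hz).fun_pow 2
      have hv := (hF.reg_v.hasDerivAt_t ht x y hz).fun_pow 2
      have hw := (hF.reg_w.hasDerivAt_t ht x y hz).fun_pow 2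
      refine ((((hu.fun_add hv).fun_add hw).div_const 2).const_mul Pr⁻¹).congr_deriv ?_
      simp only [hk']
      ring) hτ
  have mono : ∫ t in (1 : ℝ)..τ, volInt Lx Ly (k' t) ≤
      ∫ t in (1 : ℝ)..τ, R * F.convTransport Lx Ly t := by
    refine intervalIntegral.integral_mono_on hτ ?_
      ((hF.intervalIntegrable_convTransport zero_le_one hτ0.le).const_mul R) fun t ht => ?_
    · exact ((ContOn.continuousOn_volInt ck').mono fun t ht => by
        rw [uIcc_of_le hτ] at ht; exact ht.1).intervalIntegrable
    · have g : ∀ f : Field, 0 ≤ volInt Lx Ly (gradSq f t) := fun f =>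
        volInt_nonneg hLx.le hLy.le fun x y z _ => by unfold gradSq; positivity
      have := hF.volInt_velocity_mul_dt (Lx := Lx) (Ly := Ly) (zero_lt_one.trans_le ht.1)
      change volInt Lx Ly (k' t) = _ at this
      linarith [g F.u, g F.v, g F.w]
  have k0 : 0 ≤ volInt Lx Ly (k τ) :=
    volInt_nonneg hLx.le hLy.le fun x y z _ => by simp only [hk]; positivity
  rw [ftc, intervalIntegral.integral_const_mul, hF.integral_conv_eq hLx hLy hτ, ← hA] at mono
  set D := timeMean (F.drop Lx Ly) τ
  set N := F.fluxMean Lx Ly τ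
  rw [← sub_nonneg]
  have e : (A * τ * R) * (N + ((volInt Lx Ly (k 1) / R - cC) / A * τ⁻¹
      + 0 * (F.moment Lx Ly τ / τ)) - D) =
      volInt Lx Ly (k 1) + R * (τ * (A * (N - D)) - cC) := by
    field_simp
    ring
  exact nonneg_of_mul_nonneg_right (by rw [e]; linarith) (by positivity : 0 < A * τ * R)

/-- The Robin conditions tie the drop to the plate flux at each time; in the mean the plate flux may
be replaced by the total transport, because the moment is sublinear. -/
lemma tendsto_mean_relation (hF : IsSolution Pr R Lx Ly η F) (hLx : 0 < Lx) (hLy : 0 < Ly)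
    (hPr : 0 < Pr) (hR : 0 < R) (hη : η ≠ ⊤) :
    Tendsto (fun τ => timeMean (F.drop Lx Ly) τ + 2 * η.toReal * F.fluxMean Lx Ly τ) atTop
      (𝓝 (1 + 2 * η.toReal)) := by
  set A := Lx * Ly with hA
  have hA0 : 0 < A := mul_pos hLx hLy
  set cD := ∫ t in (0 : ℝ)..1, F.drop Lx Ly t
  set cC := ∫ t in (0 : ℝ)..1, F.convTransport Lx Ly t
  have h := (hF.tendsto_remainder hLx hLy hPr hR (cD - (1 + 2 * η.toReal)
    + 2 * η.toReal * (cD + cC / A - F.moment Lx Ly 1 / A)) (2 * η.toReal / A)).const_add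
    (1 + 2 * η.toReal)
  rw [add_zero] at h
  refine h.congr' ?_
  filter_upwards [eventually_ge_atTop 1] with τ hτ
  have hτ0 : 0 < τ := zero_lt_one.trans_le hτ
  have key : A * (∫ t in (1 : ℝ)..τ, F.drop Lx Ly t) =
      A * (1 + 2 * η.toReal) * (τ - 1) - 2 * η.toReal * ∫ t in (1 : ℝ)..τ, F.plateFlux Lx Ly t := by
    have i3 := hF.intervalIntegrable_plateFlux (Lx := Lx) (Ly := Ly) hτ
    have : ∫ t in (1 : ℝ)..τ, A * F.drop Lx Ly t =
        ∫ t in (1 : ℝ)..τ, (A * (1 + 2 * η.toReal) - 2 * η.toReal * F.plateFlux Lx Ly t) := by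
      refine intervalIntegral.integral_congr fun t ht => ?_
      rw [uIcc_of_le hτ] at ht
      exact hF.drop_eq hLx hLy hη (zero_lt_one.trans_le ht.1)
    rw [← intervalIntegral.integral_const_mul, this, intervalIntegral.integral_sub (by simp)
      (i3.const_mul _)]
    simp only [intervalIntegral.integral_const_mul, intervalIntegral.integral_const, smul_eq_mul]
    ring
  rw [hF.integral_plateFlux_eq hLx hLy hτ, hF.integral_drop_eq hτ,
    hF.integral_conv_eq hLx hLy hτ, ← hA] at key
  set D := timeMean (F.drop Lx Ly) τ
  set N := F.fluxMean Lx Ly τ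
  refine mul_left_cancel₀ (mul_pos hA0 hτ0).ne' ?_
  field_simp
  linear_combination -key

lemma tendsto_fluxMean (hF : IsSolution Pr R Lx Ly η F) (hLx : 0 < Lx) (hLy : 0 < Ly)
    (hPr : 0 < Pr) (hR : 0 < R) (hη : η = ⊤) :
    Tendsto (F.fluxMean Lx Ly) atTop (𝓝 1) := by
  set A := Lx * Ly with hA
  have hA0 : 0 < A := mul_pos hLx hLy
  set cD := ∫ t in (0 : ℝ)..1, F.drop Lx Ly t
  set cC := ∫ t in (0 : ℝ)..1, F.convTransport Lx Ly t
  have h := (hF.tendsto_remainder hLx hLy hPr hR (-1 + cD + cC / A - F.moment Lx Ly 1 / A)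
    (1 / A)).const_add 1
  rw [add_zero] at h
  refine h.congr' ?_
  filter_upwards [eventually_ge_atTop 1] with τ hτ
  have hτ0 : 0 < τ := zero_lt_one.trans_le hτ
  have key : ∫ t in (1 : ℝ)..τ, F.plateFlux Lx Ly t = A * (τ - 1) := by
    have : ∫ t in (1 : ℝ)..τ, F.plateFlux Lx Ly t = ∫ t in (1 : ℝ)..τ, A := by
      refine intervalIntegral.integral_congr fun t ht => ?_
      rw [uIcc_of_le hτ] at ht
      exact hF.plateFlux_eq hη (zero_lt_one.trans_le ht.1)
    rw [this, intervalIntegral.integral_const, smul_eq_mul]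
    ring
  rw [hF.integral_plateFlux_eq hLx hLy hτ, hF.integral_drop_eq hτ,
    hF.integral_conv_eq hLx hLy hτ, ← hA] at key
  set D := timeMean (F.drop Lx Ly) τ
  set N := F.fluxMean Lx Ly τ
  refine mul_left_cancel₀ (mul_pos hA0 hτ0).ne' ?_
  field_simp
  linear_combination -key

end IsSolution

/-! ### Extreme values of the time means and the cubic inequality. -/

namespace IsSolution

variable {Pr R Lx Ly : ℝ} {η : ℝ≥0∞} {F : Fields}

/-- The background inequality in terms of `s = σ δ`, for a layer that is thin enough. -/
lemma exists_background_mean_le (hF : IsSolution Pr R Lx Ly η F) (hLx : 0 < Lx) (hLy : 0 < Ly)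
    (hPr : 0 < Pr) (hR : 0 < R) {s α : ℝ} (hs : 0 < s) (hα : 0 < α) :
    ∃ c : ℝ, ∀ᶠ τ in atTop,
      (2 * s - α - 1) * F.fluxMean Lx Ly τ + (α - 1) * timeMean (F.drop Lx Ly) τ ≤ c := by
  obtain ⟨δ, hδ0, hδ, hδR⟩ := exists_small_sq_mul_le (s ^ 2 * R) (by positivity)
    (by positivity : 0 < 4 * α)
  have hsδ : s / δ * δ = s := by field_simp
  obtain ⟨r, hr, h⟩ := hF.background_mean_le hLx hLy hPr hR (m := 1) (d := 1) (fun _ => rfl)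
    (fun _ => by ring) (α := α) (σ := s / δ) (by positivity) hδ0 hδ (by rw [hsδ]; linarith)
  refine ⟨(s / δ) ^ 2 * δ / 2 - 1 * 1 + 1, ?_⟩
  filter_upwards [eventually_ge_atTop 1, hr.eventually_le_const zero_lt_one] with τ hτ hrτ
  have := h τ hτ
  rw [hsδ] at this
  linarith

lemma exists_bound (hF : IsSolution Pr R Lx Ly η F) (hLx : 0 < Lx) (hLy : 0 < Ly)
    (hPr : 0 < Pr) (hR : 0 < R) :
    ∃ a b : ℝ, ∀ᶠ τ in atTop, (a ≤ timeMean (F.drop Lx Ly) τ ∧ timeMean (F.drop Lx Ly) τ ≤ b) ∧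
      (a ≤ F.fluxMean Lx Ly τ ∧ F.fluxMean Lx Ly τ ≤ b) := by
  -- The coefficients `2 s - α - 1` and `α - 1` are `2` and `0`: the flux is bounded above.
  obtain ⟨c₁, h₁⟩ := hF.exists_background_mean_le hLx hLy hPr hR (s := 2) (α := 1)
    (by norm_num) (by norm_num)
  -- Now they are `0` and `-1/2`: the drop is bounded below. The other two bounds follow from
  -- `drop_mean_le`.
  obtain ⟨c₂, h₂⟩ := hF.exists_background_mean_le hLx hLy hPr hR (s := 3 / 4) (α := 1 / 2)
    (by norm_num) (by norm_num)
  obtain ⟨r, hr, h⟩ := hF.drop_mean_le hLx hLy hPr hR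
  refine ⟨-2 * c₂ - 1, c₁ / 2 + 1, ?_⟩
  filter_upwards [eventually_ge_atTop 1, hr.eventually_le_const zero_lt_one, h₁, h₂]
    with τ hτ hrτ h₁ h₂
  have := h τ hτ
  refine ⟨⟨?_, ?_⟩, ?_, ?_⟩ <;> linarith

/-- The extreme values `n` of the mean flux and `d` of the mean temperature drop, which are
attained together. -/
lemma exists_extremes (hF : IsSolution Pr R Lx Ly η F) (hLx : 0 < Lx) (hLy : 0 < Ly)
    (hPr : 0 < Pr) (hR : 0 < R) :
    ∃ n d : ℝ, (∀ ε > 0, ∀ᶠ τ in atTop,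
        F.fluxMean Lx Ly τ < n + ε ∧ d - ε < timeMean (F.drop Lx Ly) τ) ∧
      (∀ ε > 0, ∃ᶠ τ in atTop,
        n - ε < F.fluxMean Lx Ly τ ∧ timeMean (F.drop Lx Ly) τ < d + ε) ∧
      (η = ⊤ → n = 1) ∧ (η ≠ ⊤ → d = 1 + 2 * η.toReal - 2 * η.toReal * n) := by
  obtain ⟨a, b, hab⟩ := hF.exists_bound hLx hLy hPr hR
  -- For fixed flux `N` converges, and `d` is the limit inferior of `D`. Otherwise `D + 2 η N`
  -- converges, so times at which `N` is near its limit superior `n` are times at which `D` is near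
  -- `d`.
  by_cases hη : η = ⊤
  · have hN := hF.tendsto_fluxMean hLx hLy hPr hR hη
    have bd : IsBoundedUnder (· ≥ ·) atTop (timeMean (F.drop Lx Ly)) :=
      isBoundedUnder_of_eventually_ge (hab.mono fun τ h => h.1.1)
    have bd' : IsBoundedUnder (· ≤ ·) atTop (timeMean (F.drop Lx Ly)) :=
      isBoundedUnder_of_eventually_le (hab.mono fun τ h => h.1.2)
    refine ⟨1, liminf (timeMean (F.drop Lx Ly)) atTop, fun ε hε => ?_, fun ε hε => ?_,
      fun _ => rfl, fun h => absurd hη h⟩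
    · exact (hN.eventually_lt_const (by linarith)).and
        (eventually_lt_of_lt_liminf (by linarith) bd)
    · exact ((frequently_lt_of_liminf_lt bd'.isCoboundedUnder_ge
        (by linarith : _ < liminf (timeMean (F.drop Lx Ly)) atTop + ε)).and_eventually
        (hN.eventually_const_lt (by linarith : 1 - ε < 1))).mono fun _ h => ⟨h.2, h.1⟩
  · have hrel := hF.tendsto_mean_relation hLx hLy hPr hR hη
    set e := η.toReal
    have he : 0 ≤ e := ENNReal.toReal_nonneg
    have bn : IsBoundedUnder (· ≤ ·) atTop (F.fluxMean Lx Ly) :=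
      isBoundedUnder_of_eventually_le (hab.mono fun τ h => h.2.2)
    have bn' : IsBoundedUnder (· ≥ ·) atTop (F.fluxMean Lx Ly) :=
      isBoundedUnder_of_eventually_ge (hab.mono fun τ h => h.2.1)
    set n := limsup (F.fluxMean Lx Ly) atTop
    have small : ∀ ε > 0, ∃ ε' > 0, ε' ≤ ε ∧ 2 * e * ε' ≤ ε / 2 := fun ε hε => by
      refine ⟨ε / (4 * e + 1), by positivity, div_le_self hε.le (by linarith), ?_⟩
      rw [← mul_div_assoc, div_le_iff₀ (by positivity)]
      nlinarith
    refine ⟨n, 1 + 2 * e - 2 * e * n, fun ε hε => ?_, fun ε hε => ?_, fun h => absurd h hη,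
      fun _ => rfl⟩
    · obtain ⟨ε', hε', h1, h2⟩ := small ε hε
      filter_upwards [eventually_lt_of_limsup_lt (by linarith : n < n + ε') bn,
        hrel.eventually_const_lt (by linarith : 1 + 2 * e - ε / 2 < 1 + 2 * e)] with τ k1 k2
      have := mul_le_mul_of_nonneg_left k1.le (by linarith : 0 ≤ 2 * e)
      exact ⟨by linarith, by linarith⟩
    · obtain ⟨ε', hε', h1, h2⟩ := small ε hε
      refine ((frequently_lt_of_lt_limsup bn'.isCoboundedUnder_le
        (by linarith : n - ε' < n)).and_eventually
        (hrel.eventually_lt_const (by linarith : 1 + 2 * e < 1 + 2 * e + ε / 2))).mono ?_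
      rintro τ ⟨k1, k2⟩
      have := mul_le_mul_of_nonneg_left k1.le (by linarith : 0 ≤ 2 * e)
      exact ⟨by linarith, by linarith⟩

lemma mapClusterPt_of_extremes {n d : ℝ} {N D : ℝ → ℝ}
    (h1 : ∀ ε > 0, ∀ᶠ τ in atTop, N τ < n + ε ∧ d - ε < D τ)
    (h2 : ∀ ε > 0, ∃ᶠ τ in atTop, n - ε < N τ ∧ D τ < d + ε) :
    MapClusterPt (n, d) atTop fun τ => (N τ, D τ) := by
  rw [Metric.nhds_basis_ball.mapClusterPt_iff_frequently]
  intro ε hε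
  refine ((h2 ε hε).and_eventually (h1 ε hε)).mono fun τ h => ?_
  rw [Metric.mem_ball, Prod.dist_eq, max_lt_iff, Real.dist_eq, Real.dist_eq, abs_lt, abs_lt]
  refine ⟨⟨?_, ?_⟩, ?_, ?_⟩ <;> linarith [h.1.1, h.1.2, h.2.1, h.2.2]

/-- An ultrafilter plays the role of a sequence of times along which `(N, D)` converges, so linear
inequalities between the means survive at `(n, d)`. -/
lemma le_of_mapClusterPt {n d a b c : ℝ} {N D r : ℝ → ℝ}
    (h : MapClusterPt (n, d) atTop fun τ => (N τ, D τ)) (hr : Tendsto r atTop (𝓝 0))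
    (hle : ∀ τ ≥ 1, a * N τ + b * D τ ≤ c + r τ) : a * n + b * d ≤ c := by
  obtain ⟨U, hU, hUt⟩ := mapClusterPt_iff_ultrafilter.1 h
  have hN : Tendsto N U (𝓝 n) := (continuous_fst.tendsto (n, d)).comp hUt
  have hD : Tendsto D U (𝓝 d) := (continuous_snd.tendsto (n, d)).comp hUt
  have h2 := (hr.mono_left hU).const_add c
  rw [add_zero] at h2
  exact le_of_tendsto_of_tendsto ((hN.const_mul a).add (hD.const_mul b)) h2
    (hU ((eventually_ge_atTop 1).mono hle))

/-- The outcome of the background method. -/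
lemma exists_extremes_bound (hF : IsSolution Pr R Lx Ly η F) (hLx : 0 < Lx) (hLy : 0 < Ly)
    (hPr : 0 < Pr) (hR : 4 ≤ R) :
    ∃ n d : ℝ, (∀ ε > 0, ∀ᶠ τ in atTop,
        F.fluxMean Lx Ly τ < n + ε ∧ d - ε < timeMean (F.drop Lx Ly) τ) ∧
      (η = ⊤ → n = 1) ∧ (η ≠ ⊤ → d = 1 + 2 * η.toReal - 2 * η.toReal * n) ∧
      1 ≤ n ∧ d ≤ 1 ∧ 0 < d ∧ 27 * n ^ 2 ≤ 16 * (R * d ^ 3) := by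
  have hR0 : 0 < R := by linarith
  obtain ⟨n, d, h1, h2, h3, h4⟩ := hF.exists_extremes hLx hLy hPr hR0
  have hcl := mapClusterPt_of_extremes h1 h2
  have hdn : d ≤ n := by
    obtain ⟨r, hr, h⟩ := hF.drop_mean_le hLx hLy hPr hR0
    have := le_of_mapClusterPt (a := -1) (b := 1) (c := 0) hcl hr
      fun τ hτ => by linarith [h τ hτ]
    linarith
  have he : 0 ≤ η.toReal := ENNReal.toReal_nonneg
  -- In the Robin case `d - 1 = -2 η (n - 1)`, so `n < 1` would give `d ≥ 1 > n`, against `d ≤ n`.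
  have hn : 1 ≤ n ∧ d ≤ 1 := by
    by_cases hη : η = ⊤
    · rw [h3 hη] at hdn ⊢; exact ⟨le_rfl, hdn⟩
    · have := h4 hη
      constructor <;> by_contra! hc <;> nlinarith
  obtain ⟨hn1, hd1⟩ := hn
  have hn0 : 0 < n := by linarith
  -- This is `s = σ δ`. Together with `σ = 2 n` and `α = s / 4` it turns the absorption condition
  -- into an equality, and `s ≤ n` says that the layer width is at most `1/2`.
  set s := (4 * n ^ 2 / R) ^ (1 / 3 : ℝ) with hs
  have hs0 : 0 < s := by positivity
  have hs3 : s ^ 3 = 4 * n ^ 2 / R := by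
    rw [hs, ← Real.rpow_natCast, ← Real.rpow_mul (by positivity)]; norm_num
  have hsR : s ^ 3 * R = 4 * n ^ 2 := by rw [hs3]; field_simp
  have hsn : s ≤ n := by
    refine le_of_pow_le_pow_left₀ three_ne_zero hn0.le ?_
    rw [hs3, div_le_iff₀ hR0]
    have : 4 ≤ n * R := by nlinarith
    nlinarith [mul_le_mul_of_nonneg_left this (sq_nonneg n)]
  have hσδ : 2 * n * (s / (2 * n)) = s := by field_simp
  obtain ⟨r, hr, h⟩ := hF.background_mean_le hLx hLy hPr hR0 h3 h4 (α := s / 4) (σ := 2 * n)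
    (δ := s / (2 * n)) (by positivity) (by positivity)
    (by rw [div_le_div_iff₀ (by positivity) two_pos]; linarith)
    (by
      rw [hσδ]
      have : s ^ 2 * (s / (2 * n)) ^ 2 * R = s * (s ^ 3 * R) / (4 * n ^ 2) := by
        field_simp; ring
      rw [this, hsR]
      apply le_of_eq; field_simp)
  have key := le_of_mapClusterPt hcl hr h
  rw [hσδ] at key
  have e1 : (2 * n) ^ 2 * (s / (2 * n)) / 2 = n * s := by field_simp
  rw [e1] at key
  have key2 : 3 / 4 * s * n ≤ d * (n - s / 4) := by linarith
  -- Since `n - s / 4 > 0`, the positive left side forces `d > 0`; only then can the term `-d s / 4`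
  -- be dropped.
  have hd0 : 0 < d := by
    have : 0 < 3 / 4 * s * n := by positivity
    exact (pos_iff_pos_of_mul_pos (this.trans_le key2)).2 (by linarith)
  have hds : 3 / 4 * s ≤ d := by
    have : d * (n - s / 4) ≤ d * n := mul_le_mul_of_nonneg_left (by linarith) hd0.le
    exact le_of_mul_le_mul_right (key2.trans this) hn0
  refine ⟨n, d, h1, h3, h4, hn1, hd1, hd0, ?_⟩
  have hcube : (3 / 4 * s) ^ 3 ≤ d ^ 3 := pow_le_pow_left₀ (by positivity) hds 3
  have := mul_le_mul_of_nonneg_right hcube hR0.le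
  have e2 : (3 / 4 * s) ^ 3 * R = 27 / 64 * (s ^ 3 * R) := by ring
  rw [e2, hsR] at this
  linarith

end IsSolution

/-! ### Fractional powers, and algebraic consequences of the cubic inequality. -/

lemma rpow_pow_three {a : ℝ} (ha : 0 ≤ a) (p : ℝ) : (a ^ p) ^ 3 = a ^ (p * 3) := by
  rw [← Real.rpow_natCast, ← Real.rpow_mul ha]; norm_num

lemma rpow_third_pow {a : ℝ} (ha : 0 ≤ a) : (a ^ (1 / 3 : ℝ)) ^ 3 = a := by
  rw [rpow_pow_three ha]; norm_num

lemma rpow_two_thirds_pow {a : ℝ} (ha : 0 ≤ a) : (a ^ (2 / 3 : ℝ)) ^ 3 = a ^ 2 := by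
  rw [rpow_pow_three ha]; norm_num

lemma rpow_neg_third_pow {a : ℝ} (ha : 0 ≤ a) : (a ^ (-1 / 3 : ℝ)) ^ 3 = a⁻¹ := by
  rw [rpow_pow_three ha]
  norm_num
  rw [Real.rpow_neg_one]

lemma rpow_half_sq {a : ℝ} (ha : 0 ≤ a) : (a ^ (1 / 2 : ℝ)) ^ 2 = a := by
  rw [← Real.rpow_natCast, ← Real.rpow_mul ha]; norm_num

lemma rpow_neg_half_sq {a : ℝ} (ha : 0 ≤ a) : (a ^ (-1 / 2 : ℝ)) ^ 2 = a⁻¹ := by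
  rw [← Real.rpow_natCast, ← Real.rpow_mul ha]
  norm_num
  rw [Real.rpow_neg_one]

section Algebra

variable {R n d D Nu : ℝ}

/-- The cubic inequality gives `(n / d)² ≤ 16/27 R d`, which leaves room below the required `27/8 R
D`. -/
lemma nusselt_le_sqrt_rayleigh (hR : 0 < R) (hd : 0 < d) (hdD : d ≤ D)
    (h : 27 * n ^ 2 ≤ 16 * (R * d ^ 3)) (hNu : Nu ≤ n / d) :
    Nu ≤ 3 * √6 / 4 * (R * D) ^ (1 / 2 : ℝ) := by
  have hD : 0 < D := hd.trans_le hdD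
  refine hNu.trans (le_of_pow_le_pow_left₀ two_ne_zero (by positivity) ?_)
  have e : (3 * √6 / 4 * (R * D) ^ (1 / 2 : ℝ)) ^ 2 = 27 / 8 * (R * D) := by
    rw [mul_pow, rpow_half_sq (by positivity), div_pow, mul_pow, Real.sq_sqrt (by norm_num)]
    ring
  rw [e, div_pow, div_le_iff₀ (by positivity)]
  have h1 : R * d * d ^ 2 ≤ R * D * d ^ 2 := by gcongr
  have h2 : 0 ≤ R * D * d ^ 2 := by positivity
  nlinarith

/-- From `n c ≤ 1` follows `(n / d)³ c ≤ n² / d³ ≤ 16/27 R`, below `81/64 R`. It is applied with `c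
= η` and `c = 2 biotRatio η`; both caps on the flux come from `d > 0`. -/
lemma nusselt_le_of_cube {y c : ℝ} (hR : 0 < R) (hn : 0 < n) (hd : 0 < d)
    (h : 27 * n ^ 2 ≤ 16 * (R * d ^ 3)) (hc : 0 < c) (hnc : n * c ≤ 1) (hNu : Nu ≤ n / d)
    (hy : 0 ≤ y) (hy3 : y ^ 3 = 81 / 64 * R / c) : Nu ≤ y := by
  refine hNu.trans (le_of_pow_le_pow_left₀ three_ne_zero hy ?_)
  rw [hy3, div_pow, div_le_div_iff₀ (by positivity) hc]
  have h1 := mul_le_mul_of_nonneg_left hnc (by positivity : 0 ≤ n ^ 2)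
  have h2 : 0 ≤ R * d ^ 3 := by positivity
  nlinarith

/-- Here `d ≤ 1` is the only further input: `(n / d)² ≤ 16/27 R d ≤ 27/32 R`. -/
lemma nusselt_le_thin (hR : 0 < R) (hd : 0 < d) (hd1 : d ≤ 1)
    (h : 27 * n ^ 2 ≤ 16 * (R * d ^ 3)) (hNu : Nu ≤ n / d) :
    Nu ≤ 3 / (2 * (2 * (2 / 3 : ℝ) ^ (1 / 2 : ℝ) * R ^ (-1 / 2 : ℝ))) := by
  refine hNu.trans (le_of_pow_le_pow_left₀ two_ne_zero (by positivity) ?_)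
  have e : (3 / (2 * (2 * (2 / 3 : ℝ) ^ (1 / 2 : ℝ) * R ^ (-1 / 2 : ℝ)))) ^ 2 = 27 / 32 * R := by
    rw [div_pow, mul_pow, mul_pow, mul_pow, rpow_half_sq (by norm_num), rpow_neg_half_sq hR.le]
    field_simp; ring
  rw [e, div_pow, div_le_iff₀ (by positivity)]
  have h1 : R * d ^ 2 * d ≤ R * d ^ 2 * 1 := by gcongr
  have h2 : 0 ≤ R * d ^ 2 := by positivity
  nlinarith

lemma le_rayleigh_of_cube {y : ℝ} (hR : 0 < R) (hd : 0 < d) (hdD : d ≤ D)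
    (hy : y ^ 3 ≤ R ^ 3 * d ^ 3) : y ≤ R * D := by
  have : y ≤ R * d := le_of_pow_le_pow_left₀ three_ne_zero (by positivity) (by rwa [mul_pow])
  exact this.trans (by gcongr)

end Algebra

section Biot

variable {η : ℝ≥0∞}

lemma toReal_le_half (h : η ≤ 1 / 2) : η.toReal ≤ 1 / 2 := by
  have := ENNReal.toReal_mono (by simp) h
  simpa using this

lemma ne_top_of_le_half (h : η ≤ 1 / 2) : η ≠ ⊤ := ne_top_of_le_ne_top (by simp) h

lemma half_le_toReal (h : 1 / 2 ≤ η) (hη : η ≠ ⊤) : 1 / 2 ≤ η.toReal := by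
  have := ENNReal.toReal_mono hη h
  simpa using this

lemma quarter_le_biotRatio (h : 1 / 2 ≤ η) : 1 / 4 ≤ biotRatio η := by
  unfold biotRatio
  split_ifs with hη
  · norm_num
  · have := half_le_toReal h hη
    rw [div_le_div_iff₀ (by norm_num) (by linarith)]
    linarith

end Biot

/-- The flux is at most half the inverse of `biotRatio`. -/
lemma mul_two_biotRatio_le {η : ℝ≥0∞} {n d : ℝ} (htop : η = ⊤ → n = 1)
    (hrel : η ≠ ⊤ → d = 1 + 2 * η.toReal - 2 * η.toReal * n) (hd : 0 < d) :
    n * (2 * biotRatio η) ≤ 1 := by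
  unfold biotRatio
  split_ifs with hη
  · rw [htop hη]; norm_num
  · have he : 0 ≤ η.toReal := ENNReal.toReal_nonneg
    have := hrel hη
    rw [← mul_div_assoc, ← mul_div_assoc, div_le_one (by linarith)]
    linarith

/-! ### Long-time averages and the two Nusselt numbers. -/

namespace IsSolution

variable {Pr R Lx Ly : ℝ} {η : ℝ≥0∞} {F : Fields}

lemma hasFiniteTimeAvg_of_bound {g : ℝ → ℝ} {a b : ℝ}
    (hi : ∀ τ > 0, IntervalIntegrable g volume 0 τ)
    (h : ∀ᶠ τ in atTop, a ≤ timeMean g τ ∧ timeMean g τ ≤ b) : HasFiniteTimeAvg g :=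
  ⟨hi, isBoundedUnder_of_eventually_le (h.mono fun _ h => h.2),
    isBoundedUnder_of_eventually_ge (h.mono fun _ h => h.1)⟩

lemma timeMean_totalTransport (hLx : 0 < Lx) (hLy : 0 < Ly) (τ : ℝ) :
    timeMean (F.totalTransport Lx Ly) τ = Lx * Ly * F.fluxMean Lx Ly τ := by
  unfold Fields.fluxMean; field_simp

lemma hasFiniteTimeAvg (hF : IsSolution Pr R Lx Ly η F) (hLx : 0 < Lx) (hLy : 0 < Ly)
    (hPr : 0 < Pr) (hR : 0 < R) :
    HasFiniteTimeAvg (F.drop Lx Ly) ∧ HasFiniteTimeAvg (F.condTransport Lx Ly) ∧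
    HasFiniteTimeAvg (F.convTransport Lx Ly) ∧ HasFiniteTimeAvg (F.totalTransport Lx Ly) := by
  obtain ⟨a, b, hab⟩ := hF.exists_bound hLx hLy hPr hR
  have hA : 0 < Lx * Ly := mul_pos hLx hLy
  refine ⟨hasFiniteTimeAvg_of_bound (a := a) (b := b)
      (fun τ hτ => hF.intervalIntegrable_drop le_rfl hτ.le) (hab.mono fun _ h => h.1),
    hasFiniteTimeAvg_of_bound (a := Lx * Ly * a) (b := Lx * Ly * b)
      (fun τ hτ => hF.intervalIntegrable_condTransport hLx hLy hτ.le) ?_,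
    hasFiniteTimeAvg_of_bound (a := Lx * Ly * (a - b)) (b := Lx * Ly * (b - a))
      (fun τ hτ => hF.intervalIntegrable_convTransport le_rfl hτ.le) ?_,
    hasFiniteTimeAvg_of_bound (a := Lx * Ly * a) (b := Lx * Ly * b)
      (fun τ hτ => hF.intervalIntegrable_totalTransport hLx hLy hτ.le) ?_⟩
  · filter_upwards [hab, eventually_ge_atTop 0] with τ h hτ
    rw [hF.timeMean_condTransport hLx hLy hτ]
    exact ⟨mul_le_mul_of_nonneg_left h.1.1 hA.le, mul_le_mul_of_nonneg_left h.1.2 hA.le⟩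
  · filter_upwards [hab, eventually_ge_atTop 0] with τ h hτ
    rw [hF.timeMean_convTransport hLx hLy hτ]
    exact ⟨mul_le_mul_of_nonneg_left (by linarith) hA.le,
      mul_le_mul_of_nonneg_left (by linarith) hA.le⟩
  · filter_upwards [hab] with τ h
    rw [timeMean_totalTransport hLx hLy]
    exact ⟨mul_le_mul_of_nonneg_left h.2.1 hA.le, mul_le_mul_of_nonneg_left h.2.2 hA.le⟩

lemma timeAvg_condTransport (hF : IsSolution Pr R Lx Ly η F) (hLx : 0 < Lx) (hLy : 0 < Ly)
    (hPr : 0 < Pr) (hR : 0 < R) :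
    timeAvg (F.condTransport Lx Ly) = Lx * Ly * F.tempDrop Lx Ly := by
  obtain ⟨_, hb, hb'⟩ := (hF.hasFiniteTimeAvg hLx hLy hPr hR).1
  have hmono : Monotone fun x : ℝ => Lx * Ly * x :=
    fun _ _ h => mul_le_mul_of_nonneg_left h (mul_pos hLx hLy).le
  have := hmono.map_limsup_of_continuousAt (F := atTop) (timeMean (F.drop Lx Ly))
    (by fun_prop) hb hb'.isCoboundedUnder_le
  rw [Fields.tempDrop, timeAvg, timeAvg, this]
  refine limsup_congr ?_
  filter_upwards [eventually_ge_atTop 0] with τ hτ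
  exact hF.timeMean_condTransport hLx hLy hτ

lemma timeAvg_le_of_forall {g : ℝ → ℝ} (hg : HasFiniteTimeAvg g) {c : ℝ}
    (h : ∀ ε > 0, ∀ᶠ τ in atTop, timeMean g τ ≤ c + ε) : timeAvg g ≤ c :=
  le_of_forall_pos_le_add fun ε hε => limsup_le_of_le hg.2.2.isCoboundedUnder_le (h ε hε)

/-- Both expressions for the Nusselt number are at most the ratio of the extreme values. -/
lemma nusselt_le (hF : IsSolution Pr R Lx Ly η F) (hLx : 0 < Lx) (hLy : 0 < Ly)
    (hPr : 0 < Pr) (hR : 0 < R) {n d : ℝ} (hn : 1 ≤ n) (hd1 : d ≤ 1) (hd : 0 < d)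
    (h : ∀ ε > 0, ∀ᶠ τ in atTop,
        F.fluxMean Lx Ly τ < n + ε ∧ d - ε < timeMean (F.drop Lx Ly) τ) :
    d ≤ F.tempDrop Lx Ly ∧
      ∀ Nu : ℝ, Nu = F.nusselt Lx Ly ∨ Nu = F.nusseltConv Lx Ly → Nu ≤ n / d := by
  obtain ⟨hD, hC, hV, hT⟩ := hF.hasFiniteTimeAvg hLx hLy hPr hR
  have hA : 0 < Lx * Ly := mul_pos hLx hLy
  have hdD : d ≤ F.tempDrop Lx Ly := by
    refine le_of_forall_pos_le_add fun ε hε => ?_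
    have : d - ε ≤ F.tempDrop Lx Ly := le_limsup_of_frequently_le
      ((h ε hε).mono fun _ h => h.2.le).frequently hD.2.1
    linarith
  have hD0 : 0 < F.tempDrop Lx Ly := hd.trans_le hdD
  refine ⟨hdD, fun Nu hNu => ?_⟩
  rcases hNu with rfl | rfl
  · have hle : timeAvg (F.totalTransport Lx Ly) ≤ Lx * Ly * n := by
      refine timeAvg_le_of_forall hT fun ε hε => ?_
      filter_upwards [h (ε / (Lx * Ly)) (by positivity)] with τ hτ
      rw [timeMean_totalTransport hLx hLy]
      have := mul_le_mul_of_nonneg_left hτ.1.le hA.le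
      rwa [mul_add, mul_div_cancel₀ _ hA.ne'] at this
    rw [Fields.nusselt, hF.timeAvg_condTransport hLx hLy hPr hR]
    calc _ ≤ Lx * Ly * n / (Lx * Ly * F.tempDrop Lx Ly) := by gcongr
      _ = n / F.tempDrop Lx Ly := by field_simp
      _ ≤ n / d := by gcongr
  · have hle : timeAvg (F.convTransport Lx Ly) ≤ Lx * Ly * (n - d) := by
      refine timeAvg_le_of_forall hV fun ε hε => ?_
      filter_upwards [h (ε / (2 * (Lx * Ly))) (by positivity), eventually_ge_atTop 0] with τ hτ hτ0
      rw [hF.timeMean_convTransport hLx hLy hτ0]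
      have : F.fluxMean Lx Ly τ - timeMean (F.drop Lx Ly) τ ≤
          n - d + 2 * (ε / (2 * (Lx * Ly))) := by linarith [hτ.1, hτ.2]
      have := mul_le_mul_of_nonneg_left this hA.le
      have e : Lx * Ly * (n - d + 2 * (ε / (2 * (Lx * Ly)))) = Lx * Ly * (n - d) + ε := by
        field_simp
      rwa [e] at this
    -- The sign matters: the quotient grows when `d` replaces the larger drop only because its
    -- numerator is nonnegative.
    have hnd : 0 ≤ n - d := by linarith
    rw [Fields.nusseltConv]
    calc _ ≤ 1 + 1 / (Lx * Ly) * (Lx * Ly * (n - d)) / F.tempDrop Lx Ly := by gcongr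
      _ = 1 + (n - d) / F.tempDrop Lx Ly := by field_simp
      _ ≤ 1 + (n - d) / d := by gcongr
      _ = n / d := by field_simp; ring

end IsSolution

end RayleighBenard

end

theorem mainTheorem1 (Pr R Lx Ly : ℝ) (hPr : 0 < Pr) (hLx : 0 < Lx) (hLy : 0 < Ly)
    (η : ℝ≥0∞)
    (hR₁ : η ≤ 1 / 2 → 32 / 3 ≤ R)
    (hR₂ : 1 / 2 ≤ η → 128 / 3 * RayleighBenard.biotRatio η ≤ R)
    (F : RayleighBenard.Fields) (hF : RayleighBenard.IsSolution Pr R Lx Ly η F) :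
    -- the long-time averages are finite and the quotients make sense
    RayleighBenard.HasFiniteTimeAvg (F.drop Lx Ly) ∧
    RayleighBenard.HasFiniteTimeAvg (F.condTransport Lx Ly) ∧
    RayleighBenard.HasFiniteTimeAvg (F.convTransport Lx Ly) ∧
    RayleighBenard.HasFiniteTimeAvg (F.totalTransport Lx Ly) ∧
    RayleighBenard.timeAvg (F.condTransport Lx Ly) = Lx * Ly * F.tempDrop Lx Ly ∧
    0 < F.tempDrop Lx Ly ∧
    -- the bounds, for either expression for the Nusselt number
    (∀ Nu : ℝ, Nu = F.nusselt Lx Ly ∨ Nu = F.nusseltConv Lx Ly →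
      Nu ≤ 3 * √6 / 4 * F.rayleigh R Lx Ly ^ (1 / 2 : ℝ) ∧
      Nu ≤ 3 / (2 * RayleighBenard.deltaS η R) ∧
      (η ≤ 1 / 2 → 8 / 3 ≤ R * η.toReal ^ 2 →
        Nu ≤ 3 / 4 * (3 / η.toReal) ^ (1 / 3 : ℝ) * R ^ (1 / 3 : ℝ)) ∧
      (1 / 2 ≤ η →
        Nu ≤ 3 / 4 * (3 / 2 / RayleighBenard.biotRatio η) ^ (1 / 3 : ℝ) * R ^ (1 / 3 : ℝ))) ∧
    -- the bounds from below for the Rayleigh number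
    (η ≤ 1 / 2 → 8 / 3 ≤ R * η.toReal ^ 2 →
      1 / 2 * (1 / (3 * η.toReal ^ 2)) ^ (1 / 3 : ℝ) * R ^ (2 / 3 : ℝ) ≤ F.rayleigh R Lx Ly) ∧
    (1 / 2 ≤ η →
      1 / 4 * (2 / 3 : ℝ) ^ (1 / 3 : ℝ) * (1 / RayleighBenard.biotRatio η) ^ (2 / 3 : ℝ)
        * R ^ (2 / 3 : ℝ) ≤ F.rayleigh R Lx Ly) := by
  -- For `η ≥ 1/2` the ratio is at least `1/4`, and `128/3 * 1/4 = 32/3`. The background method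
  -- itself asks only for `R ≥ 4`.
  have hR : 32 / 3 ≤ R := by
    rcases le_total η (1 / 2) with h | h
    · exact hR₁ h
    · linarith [hR₂ h, RayleighBenard.quarter_le_biotRatio h]
  have hR0 : 0 < R := by linarith
  obtain ⟨n, d, hex, htop, hrel, hn1, hd1, hd0, hnd⟩ :=
    hF.exists_extremes_bound hLx hLy hPr (by linarith)
  have hn0 : 0 < n := by linarith
  obtain ⟨hdD, hNu⟩ := hF.nusselt_le hLx hLy hPr hR0 hn1 hd1 hd0 hex
  obtain ⟨hfD, hfC, hfV, hfT⟩ := hF.hasFiniteTimeAvg hLx hLy hPr hR0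
  have he0 : 0 ≤ η.toReal := ENNReal.toReal_nonneg
  have hpos : 8 / 3 ≤ R * η.toReal ^ 2 → 0 < η.toReal := fun h => by
    refine he0.lt_of_ne fun h0 => ?_
    rw [← h0] at h; norm_num at h
  -- Positivity of `d = 1 + 2 η - 2 η n` gives `2 η n < 1 + 2 η ≤ 2`.
  have hne : η ≤ 1 / 2 → n * η.toReal ≤ 1 := fun h => by
    have h1 := hrel (RayleighBenard.ne_top_of_le_half h)
    have h2 := RayleighBenard.toReal_le_half h
    linarith
  have hnb := RayleighBenard.mul_two_biotRatio_le htop hrel hd0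
  refine ⟨hfD, hfC, hfV, hfT, hF.timeAvg_condTransport hLx hLy hPr hR0, hd0.trans_le hdD,
    fun Nu h => ?_, fun h₁ h₂ => ?_, fun h₁ => ?_⟩
  · have hN := hNu Nu h
    refine ⟨RayleighBenard.nusselt_le_sqrt_rayleigh hR0 hd0 hdD hnd hN, ?_, fun h₁ h₂ => ?_,
      fun h₁ => ?_⟩
    · unfold RayleighBenard.deltaS
      split_ifs with h₁ h₂
      · exact RayleighBenard.nusselt_le_thin hR0 hd0 hd1 hnd hN
      · have he := hpos (not_lt.1 h₂)
        refine RayleighBenard.nusselt_le_of_cube hR0 hn0 hd0 hnd he (hne h₁) hN (by positivity) ?_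
        rw [div_pow, mul_pow, mul_pow, mul_pow, RayleighBenard.rpow_third_pow (by positivity),
          RayleighBenard.rpow_neg_third_pow hR0.le]
        field_simp; norm_num
      · have hb : 0 < RayleighBenard.biotRatio η := by
          linarith [RayleighBenard.quarter_le_biotRatio (not_le.1 h₁).le]
        refine RayleighBenard.nusselt_le_of_cube hR0 hn0 hd0 hnd
          (by positivity : 0 < 2 * RayleighBenard.biotRatio η) hnb hN (by positivity) ?_
        rw [div_pow, mul_pow, mul_pow, mul_pow, mul_pow,
          RayleighBenard.rpow_third_pow (by positivity),
          RayleighBenard.rpow_third_pow hb.le, RayleighBenard.rpow_neg_third_pow hR0.le]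
        field_simp; norm_num
    · have he := hpos h₂
      refine RayleighBenard.nusselt_le_of_cube hR0 hn0 hd0 hnd he (hne h₁) hN (by positivity) ?_
      rw [mul_pow, mul_pow, RayleighBenard.rpow_third_pow (by positivity),
        RayleighBenard.rpow_third_pow hR0.le]
      field_simp; norm_num
    · have hb : 0 < RayleighBenard.biotRatio η := by
        linarith [RayleighBenard.quarter_le_biotRatio h₁]
      refine RayleighBenard.nusselt_le_of_cube hR0 hn0 hd0 hnd
        (by positivity : 0 < 2 * RayleighBenard.biotRatio η) hnb hN (by positivity) ?_
      rw [mul_pow, mul_pow, RayleighBenard.rpow_third_pow (by positivity),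
        RayleighBenard.rpow_third_pow hR0.le]
      field_simp; norm_num
  · have he := hpos h₂
    have h1 := hrel (RayleighBenard.ne_top_of_le_half h₁)
    refine RayleighBenard.le_rayleigh_of_cube hR0 hd0 hdD ?_
    rw [mul_pow, mul_pow, RayleighBenard.rpow_third_pow (by positivity),
      RayleighBenard.rpow_two_thirds_pow hR0.le]
    set e := η.toReal
    -- If `d ≤ 1/2`, the relation between `n` and `d` keeps `n η ≥ 1/4` and the cubic inequality
    -- suffices; if `d ≥ 1/2`, the hypothesis `R η² ≥ 8/3` does.
    have goal' : 1 ≤ 24 * (R * e ^ 2 * d ^ 3) := by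
      rcases le_total d (1 / 2) with hd | hd
      · have hne4 : 1 / 4 ≤ n * e := by linarith
        have h3 : (1 / 4) ^ 2 ≤ (n * e) ^ 2 := by gcongr
        have h4 := mul_le_mul_of_nonneg_right hnd (sq_nonneg e)
        linarith
      · have h3 : (1 / 2) ^ 3 ≤ d ^ 3 := by gcongr
        have h4 : 8 / 3 * (1 / 2) ^ 3 ≤ R * e ^ 2 * d ^ 3 := by gcongr
        linarith
    have e1 : (1 / 2) ^ 3 * (1 / (3 * e ^ 2)) * R ^ 2 = R ^ 2 / (24 * e ^ 2) * 1 := by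
      field_simp; norm_num
    have e2 : R ^ 3 * d ^ 3 = R ^ 2 / (24 * e ^ 2) * (24 * (R * e ^ 2 * d ^ 3)) := by
      field_simp
    rw [e1, e2]
    exact mul_le_mul_of_nonneg_left goal' (by positivity)
  · have hb := RayleighBenard.quarter_le_biotRatio h₁
    have hb0 : 0 < RayleighBenard.biotRatio η := by linarith
    refine RayleighBenard.le_rayleigh_of_cube hR0 hd0 hdD ?_
    rw [mul_pow, mul_pow, mul_pow, RayleighBenard.rpow_third_pow (by norm_num),
      RayleighBenard.rpow_two_thirds_pow (by positivity),
      RayleighBenard.rpow_two_thirds_pow hR0.le]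
    -- Crude bounds are enough: after division by `R²` the left side is at most `1/6`, while `n ≥ 1`
    -- gives `R d³ ≥ 27/16`.
    have h1 : 1 / RayleighBenard.biotRatio η ≤ 4 := by
      rw [div_le_iff₀ hb0]; linarith
    have h2 : (1 / RayleighBenard.biotRatio η) ^ 2 ≤ 4 ^ 2 := by gcongr
    have h3 : 1 ≤ n ^ 2 := one_le_pow₀ hn1
    have h4 : 27 / 16 ≤ R * d ^ 3 := by linarith
    calc (1 / 4) ^ 3 * (2 / 3) * (1 / RayleighBenard.biotRatio η) ^ 2 * R ^ 2
        ≤ (1 / 4) ^ 3 * (2 / 3) * 4 ^ 2 * R ^ 2 := by gcongr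
      _ ≤ R ^ 2 * (27 / 16) := by nlinarith [sq_nonneg R]
      _ ≤ R ^ 2 * (R * d ^ 3) := by gcongr
      _ = R ^ 3 * d ^ 3 := by ring
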